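/- Let $S$ be a finite set of $n$ points in the plane and let $0<\omega<\pi$. Consider all (nondegenerate) triangles that have an interior angle equal to $\omega$ and whose closed region contains $S$. There is an algorithm, one and the same for all $n$, $S$ and $\omega$, that outputs exactly the list of all triangles of minimum area among these, in $O(n\log n)$ time (in $O(1)$ time if $n\le 1$). (If the points of $S$ are collinear, no such triangle of minimum area exists and the output is empty.) If the input is instead a convex $n$-gon $P$, $n\ge 3$, given by its vertices in clockwise order, then there is an algorithm that outputs all triangles of minimum area among those that have an angle $\omega$ and contain $P$, in $O(n)$ time. The constants in the $O$-bounds are absolute; they depend neither on the points nor on $\omega$. The machine model is the real RAM with exact arithmetic. It has registers and arrays (with indirect addressing) of nonnegative integers and of real numbers. The operations of unit cost are addition, truncated subtraction and comparison of integers; addition, subtraction, multiplication, division and comparison of reals; the use of integer and rational constants; reading from and writing to memory; branching; and the extraction of the $k$-th smallest distinct real root of a real polynomial of degree at most four. Real numbers cannot be rounded or converted to integers. Points are given by their Cartesian coordinates, and the angle $\omega$ is given by $\cos\omega$ and $\sin\omega$. Each triangle is output through the coordinates of its three vertices; a triangle may be listed more than once. -/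

import Mathlib

/-! ### Geometry: enclosing triangles with a prescribed angle -/

namespace FixedAngleTriangle

/-- The Euclidean plane. -/
abbrev Plane : Type := EuclideanSpace ℝ (Fin 2)

/-- Twice the signed area of the triangle `a b c`: positive if `a, b, c` turn counterclockwise,
negative if they turn clockwise, zero if they are collinear. -/
def orient (a b c : Plane) : ℝ :=
  (b 0 - a 0) * (c 1 - a 1) - (b 1 - a 1) * (c 0 - a 0)

/-- The area of a (nondegenerate) triangle. -/
noncomputable def area (T : Affine.Triangle ℝ Plane) : ℝ :=
  |orient (T.points 0) (T.points 1) (T.points 2)| / 2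

/-- One of the three interior angles of `T` is equal to `ω`. -/
def HasAngle (ω : ℝ) (T : Affine.Triangle ℝ Plane) : Prop :=
  ∃ i : Fin 3, EuclideanGeometry.angle (T.points (i + 1)) (T.points i) (T.points (i + 2)) = ω

/-- The closed region bounded by the triangle `T` contains `S`. -/
def Encloses (T : Affine.Triangle ℝ Plane) (S : Set Plane) : Prop :=
  S ⊆ convexHull ℝ (Set.range T.points)

/-- `T` is a triangle of minimum area among all triangles that enclose `S` and have an
angle `ω`. -/
def IsMinTriangle (ω : ℝ) (S : Set Plane) (T : Affine.Triangle ℝ Plane) : Prop :=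
  HasAngle ω T ∧ Encloses T S ∧
    ∀ T' : Affine.Triangle ℝ Plane, HasAngle ω T' → Encloses T' S → area T ≤ area T'

/-- `v 0, …, v (n - 1)` are the vertices, in clockwise order, of a convex `n`-gon. -/
def IsClockwiseConvexPolygon {n : ℕ} (v : Fin n → Plane) : Prop :=
  3 ≤ n ∧ ∀ i j k : Fin n, i < j → j < k → orient (v i) (v j) (v k) < 0

end FixedAngleTriangle

/-! ### The real RAM -/

namespace RealRAM

/-- A memory configuration: registers and arrays of nonnegative integers, and registers and arrays
of real numbers. Registers and arrays are named by natural numbers; a program mentions only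
finitely many of them. -/
structure State where
  nat : ℕ → ℕ
  real : ℕ → ℝ
  natArr : ℕ → ℕ → ℕ
  realArr : ℕ → ℕ → ℝ

/-- Integer expressions. The subtraction is truncated at zero. -/
inductive NatExpr : Type
  | const (m : ℕ)
  | reg (x : ℕ)
  | read (A : ℕ) (i : NatExpr)
  | add (e f : NatExpr)
  | sub (e f : NatExpr)

def NatExpr.eval (s : State) : NatExpr → ℕ
  | .const m => m
  | .reg x => s.nat x
  | .read A i => s.natArr A (i.eval s)
  | .add e f => e.eval s + f.eval s
  | .sub e f => e.eval s - f.eval s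

/-- The number of elementary steps of the evaluation. -/
def NatExpr.cost : NatExpr → ℕ
  | .const _ => 1
  | .reg _ => 1
  | .read _ i => i.cost + 1
  | .add e f => e.cost + f.cost + 1
  | .sub e f => e.cost + f.cost + 1

open Polynomial in
/-- The `k`-th smallest (counted from `k = 0`, without multiplicity) real root of the polynomial
`a₀ + a₁ X + a₂ X ^ 2 + a₃ X ^ 3 + a₄ X ^ 4`. The value is `0` if there is no such root or if the
polynomial is zero. -/
noncomputable def rootOfQuartic (k : Fin 4) (a₀ a₁ a₂ a₃ a₄ : ℝ) : ℝ :=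
  (((C a₀ + C a₁ * X + C a₂ * X ^ 2 + C a₃ * X ^ 3 + C a₄ * X ^ 4 : ℝ[X]).roots.toFinset).sort
    (· ≤ ·)).getD k 0

/-- Real expressions: rational constants, registers, array entries (indirect addressing), the four
arithmetic operations, and the extraction of a real root of a polynomial of degree at most four.
There is no conversion from real numbers to integers. -/
inductive RealExpr : Type
  | const (c : ℚ)
  | reg (x : ℕ)
  | read (A : ℕ) (i : NatExpr)
  | add (e f : RealExpr)
  | sub (e f : RealExpr)
  | mul (e f : RealExpr)
  | div (e f : RealExpr)
  | root (k : Fin 4) (a₀ a₁ a₂ a₃ a₄ : RealExpr)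

noncomputable def RealExpr.eval (s : State) : RealExpr → ℝ
  | .const c => (c : ℝ)
  | .reg x => s.real x
  | .read A i => s.realArr A (i.eval s)
  | .add e f => e.eval s + f.eval s
  | .sub e f => e.eval s - f.eval s
  | .mul e f => e.eval s * f.eval s
  | .div e f => e.eval s / f.eval s
  | .root k a₀ a₁ a₂ a₃ a₄ =>
      rootOfQuartic k (a₀.eval s) (a₁.eval s) (a₂.eval s) (a₃.eval s) (a₄.eval s)

/-- The number of elementary steps of the evaluation. -/
def RealExpr.cost : RealExpr → ℕ
  | .const _ => 1
  | .reg _ => 1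
  | .read _ i => i.cost + 1
  | .add e f => e.cost + f.cost + 1
  | .sub e f => e.cost + f.cost + 1
  | .mul e f => e.cost + f.cost + 1
  | .div e f => e.cost + f.cost + 1
  | .root _ a₀ a₁ a₂ a₃ a₄ => a₀.cost + a₁.cost + a₂.cost + a₃.cost + a₄.cost + 1

/-- Comparisons of integers and of real numbers, and their Boolean combinations. -/
inductive Test : Type
  | natLt (e f : NatExpr)
  | natEq (e f : NatExpr)
  | realLt (e f : RealExpr)
  | realEq (e f : RealExpr)
  | not (b : Test)
  | and (b c : Test)
  | or (b c : Test)

def Test.Holds (s : State) : Test → Prop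
  | .natLt e f => e.eval s < f.eval s
  | .natEq e f => e.eval s = f.eval s
  | .realLt e f => e.eval s < f.eval s
  | .realEq e f => e.eval s = f.eval s
  | .not b => ¬ b.Holds s
  | .and b c => b.Holds s ∧ c.Holds s
  | .or b c => b.Holds s ∨ c.Holds s

/-- The number of elementary steps of the test. -/
def Test.cost : Test → ℕ
  | .natLt e f => e.cost + f.cost + 1
  | .natEq e f => e.cost + f.cost + 1
  | .realLt e f => e.cost + f.cost + 1
  | .realEq e f => e.cost + f.cost + 1
  | .not b => b.cost + 1
  | .and b c => b.cost + c.cost + 1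
  | .or b c => b.cost + c.cost + 1

/-- Programs. `writeNat A i e` and `writeReal A i e` store the value of `e` at the index `i` of the
array `A`. -/
inductive Program : Type
  | skip
  | setNat (x : ℕ) (e : NatExpr)
  | setReal (x : ℕ) (e : RealExpr)
  | writeNat (A : ℕ) (i e : NatExpr)
  | writeReal (A : ℕ) (i : NatExpr) (e : RealExpr)
  | seq (p q : Program)
  | ite (b : Test) (p q : Program)
  | loop (b : Test) (p : Program)

/-- `Runs p s s' t`: the program `p`, started in the configuration `s`, halts in the configuration
`s'` after exactly `t` elementary steps. `loop b p` is "while `b` holds, do `p`". -/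
inductive Runs : Program → State → State → ℕ → Prop
  | skip (s : State) : Runs .skip s s 1
  | setNat (s : State) (x : ℕ) (e : NatExpr) :
      Runs (.setNat x e) s { s with nat := Function.update s.nat x (e.eval s) } (e.cost + 1)
  | setReal (s : State) (x : ℕ) (e : RealExpr) :
      Runs (.setReal x e) s { s with real := Function.update s.real x (e.eval s) } (e.cost + 1)
  | writeNat (s : State) (A : ℕ) (i e : NatExpr) :
      Runs (.writeNat A i e) s
        { s with natArr := Function.update s.natArr A
                  (Function.update (s.natArr A) (i.eval s) (e.eval s)) }
        (i.cost + e.cost + 1)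
  | writeReal (s : State) (A : ℕ) (i : NatExpr) (e : RealExpr) :
      Runs (.writeReal A i e) s
        { s with realArr := Function.update s.realArr A
                  (Function.update (s.realArr A) (i.eval s) (e.eval s)) }
        (i.cost + e.cost + 1)
  | seq {p q : Program} {s s' s'' : State} {t t' : ℕ} :
      Runs p s s' t → Runs q s' s'' t' → Runs (.seq p q) s s'' (t + t')
  | ite_true {b : Test} {p : Program} (q : Program) {s s' : State} {t : ℕ} :
      b.Holds s → Runs p s s' t → Runs (.ite b p q) s s' (b.cost + t)
  | ite_false {b : Test} (p : Program) {q : Program} {s s' : State} {t : ℕ} :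
      ¬ b.Holds s → Runs q s s' t → Runs (.ite b p q) s s' (b.cost + t)
  | loop_done {b : Test} (p : Program) {s : State} :
      ¬ b.Holds s → Runs (.loop b p) s s b.cost
  | loop_step {b : Test} {p : Program} {s s' s'' : State} {t t' : ℕ} :
      b.Holds s → Runs p s s' t → Runs (.loop b p) s' s'' t' →
        Runs (.loop b p) s s'' (b.cost + t + t')

end RealRAM

/-! ### Input and output -/

namespace FixedAngleTriangle

open RealRAM

/-- The initial configuration for the points `p 0, …, p (n - 1)` and the angle `ω`: integer
register `0` holds `n`, real registers `0` and `1` hold `cos ω` and `sin ω`, the real arrays `0`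
and `1` hold the two coordinates of the points, and everything else is `0`. -/
noncomputable def inputState {n : ℕ} (p : Fin n → Plane) (ω : ℝ) : State where
  nat x := if x = 0 then n else 0
  real x := if x = 0 then Real.cos ω else if x = 1 then Real.sin ω else 0
  natArr _ _ := 0
  realArr A i :=
    if h : i < n then (if A = 0 then p ⟨i, h⟩ 0 else if A = 1 then p ⟨i, h⟩ 1 else 0) else 0

/-- The number of triangles that a final configuration reports. -/
def outputCount (s : State) : ℕ := s.nat 0

/-- The vertex number `l` (with `l = 0, 1, 2`) of the `j`-th reported triangle; its coordinates
are the entries number `j` of the real arrays `2 l` and `2 l + 1`. -/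
noncomputable def outputVertex (s : State) (j l : ℕ) : Plane :=
  !₂[s.realArr (2 * l) j, s.realArr (2 * l + 1) j]

/-- The triangles reported by the final configuration `s` are exactly the triangles of minimum
area that enclose `S` and have an angle `ω`, where a triangle is given by the set of its three
vertices. -/
def ReportsMinTriangles (ω : ℝ) (S : Set Plane) (s : State) : Prop :=
  {V : Set Plane | ∃ j < outputCount s,
      V = {outputVertex s j 0, outputVertex s j 1, outputVertex s j 2}} =
    {V : Set Plane | ∃ T : Affine.Triangle ℝ Plane, IsMinTriangle ω S T ∧ V = Set.range T.points}

end FixedAngleTriangle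

/-! Label an enclosing triangle counterclockwise as A B C with the angle ω at A. Let φ be the
direction of AB. Then CA has the direction φ + ω + π, and BC has a direction ψ between φ + ω and φ +
π. Only the convex hull of the points matters (`minimal_congr`), so take a strictly convex polygon
with vertices p m. Its edge directions α m, measured continuously, increase by 2π per turn
(`IsPolygon.exists_isLift`).

Variations restrict the minimum triangles to finitely many per triple of contact vertices. Shrinking
towards a vertex shows that every side touches the polygon (`Minimal.exists_touch`). Tilting BC
shows that it touches on both sides of its midpoint (`Minimal.exists_touch_midpoint`), so BC
contains an edge or has a vertex as its midpoint. If no side contains an edge, turn AB and CA around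
their contact vertices and keep BC bisected by its own. The areas for the turns x and -x then have a
product smaller than the square of the original area, a contradiction (`SideLines.false_of_touch`).
If BC alone contains an edge, the area as a function of the direction of AB is a rational function,
whose critical points are roots of a quartic (`SideLines.exists_criticalRoot`). Otherwise AB or CA
contains an edge, which fixes φ. Altogether each triple (i, j, k) of contact vertices yields eight
pairs of directions to try, and every minimum triangle occurs among them
(`Minimal.exists_candidate`).

Only linearly many triples have to be tried. As φ makes one turn, the contacts i and j advance. The
contact k of BC advances too: on the line of edge k, the midpoint between AB and AC moves forward as
φ grows (`IsLift.beyond_mono`), and whether it has passed the end of the edge tells whether the base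
lies further on (`IsLift.not_beyond`, `IsLift.beyond_of_lt`). Hence three pointers that never move
back meet every triple that matters (`Pending.advance`, `sweep_step`).

A candidate is recorded only after a check that it is admissible. This takes constant time, because
on a convex polygon a local minimum of a linear functional is global (`orient_nonneg_of_support`).
The list keeps the triangles of the smallest area found. Since a minimum exists by compactness
(`exists_minimal`) and all minimum triangles are tried, the final list is exactly right
(`reports_of_recorded`).

For point sets, merge sort around the lexicographically smallest point and a scan for the convex
hull come first, at a cost of O(n log n). A hull with fewer than three vertices lies in a segment.
Then the area can be made arbitrarily small and there is nothing to report
(`not_minimal_of_subset_segment`). -/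

/-! ### Reasoning about programs of the real RAM -/

namespace RealRAM

/-- The program contains no loop. -/
def Program.LoopFree : Program → Prop
  | .seq p q => p.LoopFree ∧ q.LoopFree
  | .ite _ p q => p.LoopFree ∧ q.LoopFree
  | .loop _ _ => False
  | _ => True

open Classical in
/-- The final configuration of a program without loops. -/
noncomputable def Program.exec : Program → State → State
  | .skip, s => s
  | .setNat x e, s => { s with nat := Function.update s.nat x (e.eval s) }
  | .setReal x e, s => { s with real := Function.update s.real x (e.eval s) }
  | .writeNat A i e, s =>
      { s with natArr := Function.update s.natArr A
                (Function.update (s.natArr A) (i.eval s) (e.eval s)) }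
  | .writeReal A i e, s =>
      { s with realArr := Function.update s.realArr A
                (Function.update (s.realArr A) (i.eval s) (e.eval s)) }
  | .seq p q, s => q.exec (p.exec s)
  | .ite b p q, s => if b.Holds s then p.exec s else q.exec s
  | .loop _ _, s => s

/-- A bound for the running time of a program without loops. -/
def Program.bound : Program → ℕ
  | .skip => 1
  | .setNat _ e => e.cost + 1
  | .setReal _ e => e.cost + 1
  | .writeNat _ i e => i.cost + e.cost + 1
  | .writeReal _ i e => i.cost + e.cost + 1
  | .seq p q => p.bound + q.bound
  | .ite b p q => b.cost + (p.bound + q.bound)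
  | .loop _ _ => 0

/-- Straight-line code can thus be handled by computing `exec`. Since `bound` charges both branches
of a conditional, it does not depend on the configuration, which makes all later constants absolute.
-/
theorem Program.LoopFree.runs {p : Program} (h : p.LoopFree) (s : State) :
    ∃ t ≤ p.bound, Runs p s (p.exec s) t := by
  induction p generalizing s with
  | skip => exact ⟨_, le_rfl, .skip s⟩
  | setNat x e => exact ⟨_, le_rfl, .setNat s x e⟩
  | setReal x e => exact ⟨_, le_rfl, .setReal s x e⟩
  | writeNat A i e => exact ⟨_, le_rfl, .writeNat s A i e⟩
  | writeReal A i e => exact ⟨_, le_rfl, .writeReal s A i e⟩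
  | seq p q ihp ihq =>
    obtain ⟨t, ht, hr⟩ := ihp h.1 s
    obtain ⟨t', ht', hr'⟩ := ihq h.2 (p.exec s)
    exact ⟨t + t', Nat.add_le_add ht ht', .seq hr hr'⟩
  | ite b p q ihp ihq =>
    by_cases hb : b.Holds s
    · obtain ⟨t, ht, hr⟩ := ihp h.1 s
      refine ⟨b.cost + t, ?_, ?_⟩
      · simp only [bound]; omega
      · simpa [exec, hb] using Runs.ite_true q hb hr
    · obtain ⟨t, ht, hr⟩ := ihq h.2 s
      refine ⟨b.cost + t, ?_, ?_⟩
      · simp only [bound]; omega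
      · simpa [exec, hb] using Runs.ite_false p hb hr
  | loop b p => exact h.elim

/-- Started in `s`, the program `p` halts within `T` steps in a configuration that satisfies
`Q`. -/
def Does (p : Program) (s : State) (T : ℕ) (Q : State → Prop) : Prop :=
  ∃ s' t, Runs p s s' t ∧ t ≤ T ∧ Q s'

theorem Does.of_exec {p : Program} (h : p.LoopFree) {s : State} {Q : State → Prop}
    (hQ : Q (p.exec s)) : Does p s p.bound Q :=
  let ⟨t, ht, hr⟩ := h.runs s
  ⟨_, t, hr, ht, hQ⟩

theorem Does.mono {p : Program} {s : State} {T T' : ℕ} {Q Q' : State → Prop}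
    (h : Does p s T Q) (hT : T ≤ T') (hQ : ∀ s, Q s → Q' s) : Does p s T' Q' :=
  let ⟨s', t, hr, ht, hq⟩ := h
  ⟨s', t, hr, ht.trans hT, hQ _ hq⟩

theorem Does.seq {p q : Program} {s : State} {T T' : ℕ} {P Q : State → Prop}
    (h : Does p s T P) (h' : ∀ s', P s' → Does q s' T' Q) : Does (.seq p q) s (T + T') Q :=
  let ⟨s', t, hr, ht, hp⟩ := h
  let ⟨s'', t', hr', ht', hq⟩ := h' s' hp
  ⟨s'', t + t', .seq hr hr', Nat.add_le_add ht ht', hq⟩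

theorem Does.ite_true {b : Test} {p : Program} (q : Program) {s : State} {T : ℕ}
    {Q : State → Prop} (hb : b.Holds s) (h : Does p s T Q) :
    Does (.ite b p q) s (b.cost + T) Q :=
  let ⟨s', t, hr, ht, hq⟩ := h
  ⟨s', b.cost + t, .ite_true q hb hr, Nat.add_le_add_left ht _, hq⟩

theorem Does.ite_false {b : Test} (p : Program) {q : Program} {s : State} {T : ℕ}
    {Q : State → Prop} (hb : ¬ b.Holds s) (h : Does q s T Q) :
    Does (.ite b p q) s (b.cost + T) Q :=
  let ⟨s', t, hr, ht, hq⟩ := h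
  ⟨s', b.cost + t, .ite_false p hb hr, Nat.add_le_add_left ht _, hq⟩

/-- The variant `μ` bounds the number of rounds; the extra `b.cost` pays for the final test that
fails. -/
theorem Does.loop {b : Test} {p : Program} (I : State → Prop) (μ : State → ℕ) (c : ℕ)
    (step : ∀ s, I s → b.Holds s → Does p s c fun s' => I s' ∧ μ s' < μ s)
    {s : State} (hs : I s) :
    Does (.loop b p) s (μ s * (b.cost + c) + b.cost) fun s' => I s' ∧ ¬ b.Holds s' := by
  induction h : μ s using Nat.strong_induction_on generalizing s with
  | _ m ih =>
    by_cases hb : b.Holds s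
    · obtain ⟨s', t, hr, ht, hI, hμ⟩ := step s hs hb
      obtain ⟨s'', t', hr', ht', hq⟩ := ih (μ s') (h ▸ hμ) hI rfl
      refine ⟨s'', b.cost + t + t', .loop_step hb hr hr', ?_, hq⟩
      have h1 : (μ s' + 1) * (b.cost + c) ≤ m * (b.cost + c) :=
        Nat.mul_le_mul_right _ (h ▸ hμ)
      rw [add_mul] at h1
      omega
    · exact ⟨s, b.cost, .loop_done p hb, Nat.le_add_left _ _, hs, hb⟩

theorem Does.loop_exec {b : Test} {p : Program} (hp : p.LoopFree) (I : State → Prop)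
    (μ : State → ℕ)
    (step : ∀ s, I s → b.Holds s → I (p.exec s) ∧ μ (p.exec s) < μ s)
    {s : State} (hs : I s) :
    Does (.loop b p) s (μ s * (b.cost + p.bound) + b.cost) fun s' => I s' ∧ ¬ b.Holds s' :=
  Does.loop I μ _ (fun s hI hb => .of_exec hp (step s hI hb)) hs

/-- A loop with a linear number of rounds, after some preparations. -/
theorem Does.setup_loop {q : Program} {b : Test} {p : Program} (hq : q.LoopFree)
    (hp : p.LoopFree) (I : State → Prop) (μ : State → ℕ)
    (step : ∀ s, I s → b.Holds s → I (p.exec s) ∧ μ (p.exec s) < μ s)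
    {s : State} (hs : I (q.exec s)) (c : ℕ) {N : ℕ} (hN : 1 ≤ N) (hμ : μ (q.exec s) ≤ c * N) :
    Does (.seq q (.loop b p)) s ((q.bound + (c + 1) * (b.cost + p.bound)) * N)
      fun s' => I s' ∧ ¬ b.Holds s' := by
  refine ((Does.of_exec (Q := fun s' => s' = q.exec s) hq rfl).seq (by
    rintro _ rfl
    exact Does.loop_exec hp I μ step hs)).mono ?_ fun _ h => h
  rw [add_mul, add_mul, one_mul, add_mul]
  have h1 : μ (q.exec s) * (b.cost + p.bound) ≤ c * (b.cost + p.bound) * N := by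
    rw [mul_right_comm]
    exact Nat.mul_le_mul_right _ hμ
  have h2 := Nat.le_mul_of_pos_right q.bound hN
  have h3 := Nat.le_mul_of_pos_right (b.cost + p.bound) hN
  omega

/-! ### Arithmetic notation for expressions, and their values -/

instance : Add RealExpr := ⟨.add⟩
instance : Sub RealExpr := ⟨.sub⟩
instance : Mul RealExpr := ⟨.mul⟩
instance : Div RealExpr := ⟨.div⟩
instance : Add NatExpr := ⟨.add⟩
instance : Sub NatExpr := ⟨.sub⟩

section eval
variable (s : State) (e f : RealExpr) (a b : NatExpr)

@[simp] theorem RealExpr.eval_add : (e + f).eval s = e.eval s + f.eval s := rfl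
@[simp] theorem RealExpr.eval_sub : (e - f).eval s = e.eval s - f.eval s := rfl
@[simp] theorem RealExpr.eval_mul : (e * f).eval s = e.eval s * f.eval s := rfl
@[simp] theorem RealExpr.eval_div : (e / f).eval s = e.eval s / f.eval s := rfl
@[simp] theorem RealExpr.eval_const (c : ℚ) : (RealExpr.const c).eval s = c := rfl
@[simp] theorem RealExpr.eval_reg (x : ℕ) : (RealExpr.reg x).eval s = s.real x := rfl
@[simp] theorem RealExpr.eval_read (A : ℕ) : (RealExpr.read A a).eval s = s.realArr A (a.eval s) :=
  rfl
@[simp] theorem RealExpr.eval_root (k : Fin 4) (a₀ a₁ a₂ a₃ a₄ : RealExpr) :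
    (RealExpr.root k a₀ a₁ a₂ a₃ a₄).eval s =
      rootOfQuartic k (a₀.eval s) (a₁.eval s) (a₂.eval s) (a₃.eval s) (a₄.eval s) := rfl
@[simp] theorem NatExpr.eval_add : (a + b).eval s = a.eval s + b.eval s := rfl
@[simp] theorem NatExpr.eval_sub : (a - b).eval s = a.eval s - b.eval s := rfl
@[simp] theorem NatExpr.eval_const (m : ℕ) : (NatExpr.const m).eval s = m := rfl
@[simp] theorem NatExpr.eval_reg (x : ℕ) : (NatExpr.reg x).eval s = s.nat x := rfl

end eval

open Polynomial in
/-- Every zero of a nonzero polynomial of degree at most four is found by `rootOfQuartic`. -/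
theorem exists_rootOfQuartic_eq {a₀ a₁ a₂ a₃ a₄ t : ℝ}
    (h0 : ¬ (a₀ = 0 ∧ a₁ = 0 ∧ a₂ = 0 ∧ a₃ = 0 ∧ a₄ = 0))
    (ht : a₀ + a₁ * t + a₂ * t ^ 2 + a₃ * t ^ 3 + a₄ * t ^ 4 = 0) :
    ∃ k, rootOfQuartic k a₀ a₁ a₂ a₃ a₄ = t := by
  set P : ℝ[X] := C a₀ + C a₁ * X + C a₂ * X ^ 2 + C a₃ * X ^ 3 + C a₄ * X ^ 4 with hP
  have hP0 : P ≠ 0 := by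
    intro h
    apply h0
    have hc : ∀ m, P.coeff m = 0 := by simp [h]
    have h0 := hc 0
    have h1 := hc 1
    have h2 := hc 2
    have h3 := hc 3
    have h4 := hc 4
    simp [hP, coeff_X, coeff_C, coeff_X_pow] at h0 h1 h2 h3 h4
    exact ⟨h0, h1, h2, h3, h4⟩
  have hdeg : P.natDegree ≤ 4 := by rw [hP]; compute_degree
  have hmem : t ∈ P.roots.toFinset := by
    rw [Multiset.mem_toFinset, mem_roots hP0, IsRoot]
    simpa [hP] using ht
  have hl : t ∈ P.roots.toFinset.sort (· ≤ ·) := by simpa using hmem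
  -- The position of `t` in the sorted list of distinct roots is the index to extract. It is below 4
  -- because the degree is at most four.
  obtain ⟨m, hm, hmt⟩ := List.getElem_of_mem hl
  have hm4 : m < 4 := by
    refine lt_of_lt_of_le hm ?_
    rw [Finset.length_sort]
    exact (Multiset.toFinset_card_le _).trans ((card_roots' P).trans hdeg)
  refine ⟨⟨m, hm4⟩, ?_⟩
  rw [rootOfQuartic, ← hP]
  exact (List.getD_eq_getElem _ _ hm).trans hmt

end RealRAM

/-! ### Triangles in coordinates -/

namespace FixedAngleTriangle

open Real

/-- The point with coordinates `x`, `y`. -/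
noncomputable def pt (x y : ℝ) : Plane := !₂[x, y]

@[simp] theorem pt_zero (x y : ℝ) : pt x y 0 = x := rfl
@[simp] theorem pt_one (x y : ℝ) : pt x y 1 = y := rfl

theorem plane_ext {a b : Plane} (h0 : a 0 = b 0) (h1 : a 1 = b 1) : a = b := by
  ext i; fin_cases i <;> assumption

/-- The cross product. -/
def cr (v w : Plane) : ℝ := v 0 * w 1 - v 1 * w 0

/-- The scalar product. -/
def dt (v w : Plane) : ℝ := v 0 * w 0 + v 1 * w 1

/-- The rotation by the angle with cosine `c` and sine `s`. -/
noncomputable def rot (c s : ℝ) (v : Plane) : Plane := pt (c * v 0 - s * v 1) (s * v 0 + c * v 1)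

/-- The unit vector of direction `θ`. -/
noncomputable def unit (θ : ℝ) : Plane := pt (cos θ) (sin θ)

theorem orient_eq_cr (a b c : Plane) : orient a b c = cr (b - a) (c - a) := by
  simp [orient, cr]

theorem cr_unit_unit (a b : ℝ) : cr (unit a) (unit b) = sin (b - a) := by
  simp [cr, unit, sin_sub]; ring

theorem dt_unit_unit (a b : ℝ) : dt (unit a) (unit b) = cos (b - a) := by
  simp [dt, unit, cos_sub]; ring

theorem rot_unit (ω θ : ℝ) : rot (cos ω) (sin ω) (unit θ) = unit (θ + ω) := by
  apply plane_ext <;> simp [rot, unit, sin_add, cos_add] <;> ring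

theorem cr_smul_left (r : ℝ) (v w : Plane) : cr (r • v) w = r * cr v w := by
  simp [cr]; ring
theorem cr_smul_right (r : ℝ) (v w : Plane) : cr v (r • w) = r * cr v w := by
  simp [cr]; ring
theorem cr_add_right (v w z : Plane) : cr v (w + z) = cr v w + cr v z := by
  simp [cr]; ring
theorem cr_add_left (v w z : Plane) : cr (v + w) z = cr v z + cr w z := by
  simp [cr]; ring
theorem cr_sub_right (v w z : Plane) : cr v (w - z) = cr v w - cr v z := by
  simp [cr]; ring
theorem cr_sub_left (v w z : Plane) : cr (v - w) z = cr v z - cr w z := by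
  simp [cr]; ring
theorem cr_swap (v w : Plane) : cr v w = - cr w v := by
  simp [cr]; ring
theorem cr_self (v : Plane) : cr v v = 0 := by
  simp [cr]; ring
theorem rot_smul (c s r : ℝ) (v : Plane) : rot c s (r • v) = r • rot c s v := by
  apply plane_ext <;> simp [rot] <;> ring

theorem orient_rotate (a b c : Plane) : orient b c a = orient a b c := by
  simp only [orient]; ring
theorem orient_swap (a b c : Plane) : orient a c b = - orient a b c := by
  simp only [orient]; ring

theorem unit_add_pi (θ : ℝ) : unit (θ + π) = - unit θ := by
  apply plane_ext <;> simp [unit]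

/-- The triangle `A B C` is labelled counterclockwise and has the angle `ω` at `A`. -/
def IsAngleTriangle (ω : ℝ) (A B C : Plane) : Prop :=
  0 < orient A B C ∧ dt (B - A) (C - A) * sin ω = orient A B C * cos ω

/-- The points of `S` lie on the inner sides of the sides of `A B C`. -/
def Inside (S : Set Plane) (A B C : Plane) : Prop :=
  ∀ q ∈ S, 0 ≤ orient A B q ∧ 0 ≤ orient B C q ∧ 0 ≤ orient C A q

/-- `A B C` has the angle `ω` at `A` and encloses `S`. -/
def Admissible (ω : ℝ) (S : Set Plane) (A B C : Plane) : Prop :=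
  IsAngleTriangle ω A B C ∧ Inside S A B C

/-- `A B C` has minimum area among the admissible triangles. -/
def Minimal (ω : ℝ) (S : Set Plane) (A B C : Plane) : Prop :=
  Admissible ω S A B C ∧ ∀ A' B' C', Admissible ω S A' B' C' → orient A B C ≤ orient A' B' C'

/-- The three values `orient B C q`, `orient C A q`, `orient A B q`, divided by `orient A B C`, are
the barycentric coordinates of `q`. Conversely, three closed half-planes intersect in a convex set
that contains the vertices. -/
theorem mem_convexHull_triangle {A B C : Plane} (h : 0 < orient A B C) (q : Plane) :
    q ∈ convexHull ℝ {A, B, C} ↔ 0 ≤ orient A B q ∧ 0 ≤ orient B C q ∧ 0 ≤ orient C A q := by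
  constructor
  · intro hq
    have hconv : Convex ℝ {q | 0 ≤ orient A B q ∧ 0 ≤ orient B C q ∧ 0 ≤ orient C A q} := by
      have aux : ∀ a b x y : Plane, ∀ s t : ℝ, s + t = 1 →
          orient a b (s • x + t • y) = s * orient a b x + t * orient a b y := by
        intro a b x y s t hst
        obtain rfl : s = 1 - t := by linarith
        simp [orient]; ring
      intro x hx y hy s t hs ht hst
      simp only [Set.mem_ofPred_eq] at hx hy ⊢
      rw [aux _ _ _ _ _ _ hst, aux _ _ _ _ _ _ hst, aux _ _ _ _ _ _ hst]
      obtain ⟨h1, h2, h3⟩ := hx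
      obtain ⟨k1, k2, k3⟩ := hy
      refine ⟨?_, ?_, ?_⟩ <;> positivity
    refine convexHull_min ?_ hconv hq
    have h1 : ∀ a b : Plane, orient a b a = 0 := by intro a b; simp [orient]
    have h2 : ∀ a b : Plane, orient a b b = 0 := by intro a b; simp [orient]; ring
    have h3 : orient B C A = orient A B C := orient_rotate _ _ _
    have h4 : orient C A B = orient A B C := by rw [orient_rotate, orient_rotate]
    rintro x (rfl | rfl | rfl) <;> simp [h1, h2, h3, h4, h.le]
  · rintro ⟨h1, h2, h3⟩
    have key := (convex_convexHull ℝ ({A, B, C} : Set Plane)).sum_mem (t := Finset.univ)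
      (w := ![orient B C q / orient A B C, orient C A q / orient A B C,
        orient A B q / orient A B C]) (z := ![A, B, C]) ?_ ?_ ?_
    · convert key using 1
      simp only [Fin.sum_univ_three, Matrix.cons_val_zero, Matrix.cons_val_one, Matrix.cons_val]
      have h' : orient A B C ≠ 0 := h.ne'
      apply plane_ext
      all_goals
        simp only [PiLp.add_apply, PiLp.smul_apply, smul_eq_mul]
        field_simp
        simp only [orient]
        ring
    · intro i _
      fin_cases i <;> simp <;> positivity
    · simp only [Fin.sum_univ_three, Matrix.cons_val_zero, Matrix.cons_val_one, Matrix.cons_val]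
      have h' : orient A B C ≠ 0 := h.ne'
      field_simp
      simp only [orient]
      ring
    · intro i _
      fin_cases i <;> exact subset_convexHull ℝ _ (by simp)

/-- `dt` and `cr` are the cosine and the sine of the angle times the product of the norms. So the
equation says that the sine of a difference vanishes, and this difference lies strictly between -π
and π. The result is a condition that the machine can test and that is closed in the vertices. -/
theorem angle_eq_iff {ω : ℝ} (h0 : 0 < ω) (hπ : ω < π) {v w : Plane} (h : 0 < cr v w) :
    InnerProductGeometry.angle v w = ω ↔ dt v w * sin ω = cr v w * cos ω := by
  have hv : v ≠ 0 := by rintro rfl; simp [cr] at h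
  have hw : w ≠ 0 := by rintro rfl; simp [cr] at h
  have hi : ∀ v w : Plane, inner ℝ v w = dt v w := by
    intro v w; simp [PiLp.inner_apply, Fin.sum_univ_two, dt]; ring
  have hc := InnerProductGeometry.cos_angle_mul_norm_mul_norm v w
  have hs := InnerProductGeometry.sin_angle_mul_norm_mul_norm v w
  rw [hi] at hc
  rw [hi, hi, hi] at hs
  have hsq : dt v v * dt w w - dt v w * dt v w = cr v w ^ 2 := by simp only [dt, cr]; ring
  rw [hsq, sqrt_sq h.le] at hs
  have hn : 0 < ‖v‖ * ‖w‖ := mul_pos (norm_pos_iff.2 hv) (norm_pos_iff.2 hw)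
  constructor
  · rintro rfl
    rw [← hc, ← hs]; ring
  · intro he
    rw [← hc, ← hs] at he
    have h1 : sin (ω - InnerProductGeometry.angle v w) = 0 := by
      rw [sin_sub]
      have : (‖v‖ * ‖w‖) * (sin ω * cos (InnerProductGeometry.angle v w) -
        cos ω * sin (InnerProductGeometry.angle v w)) = 0 := by linear_combination he
      exact (mul_eq_zero.1 this).resolve_left hn.ne'
    have h2 := InnerProductGeometry.angle_nonneg v w
    have h3 := InnerProductGeometry.angle_le_pi v w
    rw [sin_eq_zero_iff_of_lt_of_lt (by linarith) (by linarith)] at h1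
    linarith

theorem collinear_of_orient_eq_zero {A B C : Plane} (h : orient A B C = 0) :
    Collinear ℝ {A, B, C} := by
  rw [collinear_iff_of_mem (p₀ := A) (by simp)]
  rw [orient_eq_cr] at h
  by_cases hB : B = A
  · refine ⟨C - A, ?_⟩
    rintro p (rfl | rfl | rfl)
    · exact ⟨0, by simp⟩
    · exact ⟨0, by simp [hB]⟩
    · exact ⟨1, by simp⟩
  · refine ⟨B - A, ?_⟩
    rintro p (rfl | rfl | rfl)
    · exact ⟨0, by simp⟩
    · exact ⟨1, by simp⟩
    · set v := B - A with hv
      have hv0 : v ≠ 0 := sub_ne_zero.2 hB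
      have hd : 0 < dt v v := by
        simp only [dt]
        by_contra hle
        have h0 : v 0 = 0 := by nlinarith [mul_self_nonneg (v 0), mul_self_nonneg (v 1)]
        have h1 : v 1 = 0 := by nlinarith [mul_self_nonneg (v 0), mul_self_nonneg (v 1)]
        exact hv0 (plane_ext h0 h1)
      refine ⟨dt v (p - A) / dt v v, ?_⟩
      have h' : p - A = (dt v (p - A) / dt v v) • v := by
        generalize p - A = w at *
        simp only [dt, cr] at *
        have hd' := hd.ne'
        apply plane_ext
        · simp only [PiLp.smul_apply, smul_eq_mul]
          rw [div_mul_eq_mul_div, eq_div_iff hd']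
          linear_combination -(v 1) * h
        · simp only [PiLp.smul_apply, smul_eq_mul]
          rw [div_mul_eq_mul_div, eq_div_iff hd']
          linear_combination (v 0) * h
      rw [← h']; simp

theorem orient_eq_zero_of_collinear {A B C : Plane} (h : Collinear ℝ {A, B, C}) :
    orient A B C = 0 := by
  rw [collinear_iff_of_mem (p₀ := A) (by simp)] at h
  obtain ⟨v, hv⟩ := h
  obtain ⟨r, rfl⟩ := hv B (by simp)
  obtain ⟨s, rfl⟩ := hv C (by simp)
  simp [orient]; ring

/-- A cyclic shift brings the angle to the first vertex; exchanging the other two, if necessary,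
makes the labelling counterclockwise. -/
theorem HasAngle.exists_labels {ω : ℝ} (h0 : 0 < ω) (hπ : ω < π) {T : Affine.Triangle ℝ Plane}
    (h : HasAngle ω T) : ∃ A B C, Set.range T.points = {A, B, C} ∧ IsAngleTriangle ω A B C ∧
      area T = orient A B C / 2 := by
  obtain ⟨i, hi⟩ := h
  have hne : orient (T.points 0) (T.points 1) (T.points 2) ≠ 0 := by
    intro h
    have := T.independent
    rw [affineIndependent_iff_not_collinear] at this
    apply this
    have hr : Set.range T.points = {T.points 0, T.points 1, T.points 2} := by
      ext x; simp [Fin.exists_fin_succ, eq_comm]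
    rw [hr]
    exact collinear_of_orient_eq_zero h
  have hr : Set.range T.points = {T.points i, T.points (i + 1), T.points (i + 2)} := by
    ext x
    fin_cases i <;> simp [Fin.exists_fin_succ, eq_comm] <;> tauto
  have ho : orient (T.points i) (T.points (i + 1)) (T.points (i + 2)) =
      orient (T.points 0) (T.points 1) (T.points 2) := by
    fin_cases i
    · rfl
    · exact orient_rotate (T.points 0) (T.points 1) (T.points 2)
    · exact (orient_rotate (T.points 1) (T.points 2) (T.points 0)).trans (orient_rotate _ _ _)
  rw [area, ← ho, hr]
  rw [← ho] at hne
  generalize T.points i = A at *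
  generalize T.points (i + 1) = B at *
  generalize T.points (i + 2) = C at *
  rw [EuclideanGeometry.angle, vsub_eq_sub, vsub_eq_sub] at hi
  rcases lt_or_gt_of_ne hne with hlt | hgt
  · have hpos : 0 < orient A C B := by rw [orient_swap]; linarith
    refine ⟨A, C, B, by rw [Set.pair_comm], ⟨hpos, ?_⟩, ?_⟩
    · rw [InnerProductGeometry.angle_comm] at hi
      rw [orient_eq_cr] at hpos ⊢
      exact (angle_eq_iff h0 hπ hpos).1 hi
    · rw [abs_of_neg hlt, orient_swap A B C]
  · refine ⟨A, B, C, rfl, ⟨hgt, ?_⟩, by rw [abs_of_pos hgt]⟩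
    rw [orient_eq_cr] at hgt ⊢
    exact (angle_eq_iff h0 hπ hgt).1 hi

theorem IsAngleTriangle.exists_triangle {ω : ℝ} (h0 : 0 < ω) (hπ : ω < π) {A B C : Plane}
    (h : IsAngleTriangle ω A B C) : ∃ T : Affine.Triangle ℝ Plane,
      Set.range T.points = {A, B, C} ∧ HasAngle ω T ∧ area T = orient A B C / 2 := by
  have hr : Set.range ![A, B, C] = {A, B, C} := by
    ext x; simp [eq_comm]; tauto
  refine ⟨⟨![A, B, C], ?_⟩, hr, ⟨0, ?_⟩, ?_⟩
  · rw [affineIndependent_iff_not_collinear, hr]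
    exact fun hc => h.1.ne' (orient_eq_zero_of_collinear hc)
  · have h1 := h.1
    have h2 := h.2
    rw [orient_eq_cr] at h1 h2
    exact (angle_eq_iff h0 hπ h1).2 h2
  · have : |orient A B C| = orient A B C := abs_of_pos h.1
    simp [area, this]

theorem encloses_iff {A B C : Plane} (h : 0 < orient A B C) {T : Affine.Triangle ℝ Plane}
    (hT : Set.range T.points = {A, B, C}) (S : Set Plane) : Encloses T S ↔ Inside S A B C := by
  rw [Encloses, hT]
  exact forall₂_congr fun q _ => mem_convexHull_triangle h q

/-- Minimum triangles in terms of labelled triples of points. -/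
theorem setOf_isMinTriangle {ω : ℝ} (h0 : 0 < ω) (hπ : ω < π) (S : Set Plane) :
    {V : Set Plane | ∃ T : Affine.Triangle ℝ Plane, IsMinTriangle ω S T ∧ V = Set.range T.points} =
      {V | ∃ A B C, Minimal ω S A B C ∧ V = {A, B, C}} := by
  ext V
  constructor
  · rintro ⟨T, ⟨hω, hS, hmin⟩, rfl⟩
    obtain ⟨A, B, C, hr, hABC, har⟩ := hω.exists_labels h0 hπ
    refine ⟨A, B, C, ⟨⟨hABC, (encloses_iff hABC.1 hr S).1 hS⟩, ?_⟩, hr⟩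
    rintro A' B' C' ⟨h', hS'⟩
    obtain ⟨T', hr', hω', har'⟩ := h'.exists_triangle h0 hπ
    have := hmin T' hω' ((encloses_iff h'.1 hr' S).2 hS')
    linarith
  · rintro ⟨A, B, C, ⟨⟨hABC, hS⟩, hmin⟩, rfl⟩
    obtain ⟨T, hr, hω, har⟩ := hABC.exists_triangle h0 hπ
    refine ⟨T, ⟨hω, (encloses_iff hABC.1 hr S).2 hS, ?_⟩, hr.symm⟩
    intro T' hω' hS'
    obtain ⟨A', B', C', hr', h', har'⟩ := hω'.exists_labels h0 hπ
    have := hmin A' B' C' ⟨h', (encloses_iff h'.1 hr' S).1 hS'⟩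
    linarith

theorem inside_of_subset_convexHull {S S' : Set Plane} {A B C : Plane} (h : 0 < orient A B C)
    (hS : S' ⊆ convexHull ℝ S) (hI : Inside S A B C) : Inside S' A B C := by
  have : convexHull ℝ S ⊆ convexHull ℝ {A, B, C} :=
    convexHull_min (fun q hq => (mem_convexHull_triangle h q).2 (hI q hq)) (convex_convexHull ℝ _)
  exact fun q hq => (mem_convexHull_triangle h q).1 (this (hS hq))

/-- This allows passing between a polygon and its vertices, and between a point set and the vertices
of its hull. -/
theorem minimal_congr {S S' : Set Plane} (h : S' ⊆ convexHull ℝ S) (h' : S ⊆ convexHull ℝ S')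
    {ω : ℝ} {A B C : Plane} : Minimal ω S A B C ↔ Minimal ω S' A B C := by
  have key : ∀ A B C, Admissible ω S A B C ↔ Admissible ω S' A B C := fun A B C =>
    and_congr_right fun hABC =>
      ⟨inside_of_subset_convexHull hABC.1 h, inside_of_subset_convexHull hABC.1 h'⟩
  simp only [Minimal, key]

end FixedAngleTriangle

/-! ### Convex polygons and the directions of their edges -/

namespace FixedAngleTriangle

open Real

/-- The direction of a vector. -/
noncomputable def direction (v : Plane) : ℝ := Complex.arg ⟨v 0, v 1⟩

theorem eq_smul_unit_direction (v : Plane) : v = ‖(⟨v 0, v 1⟩ : ℂ)‖ • unit (direction v) := by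
  apply plane_ext
  · exact (Complex.norm_mul_cos_arg ⟨v 0, v 1⟩).symm
  · exact (Complex.norm_mul_sin_arg ⟨v 0, v 1⟩).symm

theorem exists_smul_unit {v : Plane} (hv : v ≠ 0) (a : ℝ) :
    ∃ r θ : ℝ, 0 < r ∧ a ≤ θ ∧ θ < a + 2 * π ∧ v = r • unit θ := by
  refine ⟨‖(⟨v 0, v 1⟩ : ℂ)‖, toIcoMod two_pi_pos a (direction v), ?_,
    left_le_toIcoMod _ _ _, toIcoMod_lt_right _ _ _, ?_⟩
  · rw [norm_pos_iff]
    intro h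
    apply hv
    rw [Complex.ext_iff] at h
    exact plane_ext h.1 h.2
  · have : unit (toIcoMod two_pi_pos a (direction v)) = unit (direction v) := by
      rw [toIcoMod, zsmul_eq_mul, unit, unit, cos_sub_int_mul_two_pi, sin_sub_int_mul_two_pi]
    rw [this]
    exact eq_smul_unit_direction v

/-- `p 0, …, p (N - 1)` are the vertices, in counterclockwise order, of a strictly convex polygon,
and `p` is continued periodically. -/
structure IsPolygon (N : ℕ) (p : ℕ → Plane) : Prop where
  three : 3 ≤ N
  periodic : ∀ m, p (m + N) = p m
  left : ∀ m l, ¬ l ≡ m [MOD N] → ¬ l ≡ m + 1 [MOD N] → 0 < orient (p m) (p (m + 1)) (p l)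

theorem isPolygon_of_orient_pos {N : ℕ} (hN : 3 ≤ N) {h : ℕ → Plane}
    (ho : ∀ i j k, i < j → j < k → k < N → 0 < orient (h i) (h j) (h k)) :
    IsPolygon N fun m => h (m % N) := by
  refine ⟨hN, fun m => by simp, fun m l h1 h2 => ?_⟩
  have ha : m % N < N := Nat.mod_lt _ (by omega)
  have hc : l % N < N := Nat.mod_lt _ (by omega)
  have hb : (m + 1) % N = if m % N + 1 = N then 0 else m % N + 1 := by
    rw [Nat.add_mod, Nat.mod_eq_of_lt (by omega : 1 < N)]
    split_ifs with hN'
    · rw [hN', Nat.mod_self]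
    · exact Nat.mod_eq_of_lt (by omega)
  unfold Nat.ModEq at h1 h2
  rw [hb] at h2 ⊢
  generalize m % N = a at *
  generalize l % N = c at *
  -- The closing edge from the vertex `N - 1` to the vertex `0` is the only one where the indices do
  -- not increase.
  split_ifs at h2 ⊢ with hN'
  · rw [← orient_rotate]
    exact ho _ _ _ (by omega) (by omega) (by omega)
  · rcases Nat.lt_or_ge c a with hlt | hge
    · rw [orient_rotate (h c)]
      exact ho _ _ _ hlt (by omega) (by omega)
    · exact ho _ _ _ (by omega) (by omega) (by omega)

namespace IsPolygon

variable {N : ℕ} {p : ℕ → Plane}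

theorem congr (hP : IsPolygon N p) {l m : ℕ} (h : l ≡ m [MOD N]) : p l = p m := by
  have : Function.Periodic p N := hP.periodic
  rw [← this.map_mod_nat l, ← this.map_mod_nat m, h]

theorem left_le (hP : IsPolygon N p) (m l : ℕ) : 0 ≤ orient (p m) (p (m + 1)) (p l) := by
  by_cases h1 : l ≡ m [MOD N]
  · rw [hP.congr h1]; simp [orient]
  by_cases h2 : l ≡ m + 1 [MOD N]
  · rw [hP.congr h2]; simp [orient]; linarith
  · exact (hP.left m l h1 h2).le

theorem not_modEq_add (_hP : IsPolygon N p) (m : ℕ) {a : ℕ} (h0 : 0 < a) (ha : a < N) :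
    ¬ m + a ≡ m [MOD N] := by
  intro h
  have : a ≡ 0 [MOD N] := Nat.ModEq.add_left_cancel' m h
  rw [Nat.modEq_zero_iff_dvd] at this
  exact absurd (Nat.le_of_dvd h0 this) (by omega)

theorem turn (hP : IsPolygon N p) (m : ℕ) : 0 < orient (p m) (p (m + 1)) (p (m + 2)) :=
  have := hP.three
  hP.left _ _ (hP.not_modEq_add m (by omega) (by omega))
    (hP.not_modEq_add (m + 1) (a := 1) (by omega) (by omega))

/-- Cramer's rule for `q - b` in terms of `c - b` and `a - b`, with a linear functional applied. If
`q` lies to the left of both edges at `b`, then it lies in the cone they span, which is why local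
minima are global. -/
theorem _root_.FixedAngleTriangle.cr_cone (a b c q d : Plane) : orient a b c * cr d (q - b) =
    orient a b q * cr d (c - b) + orient b c q * cr d (a - b) := by
  simp only [orient, cr, PiLp.sub_apply]; ring

/-- A local minimum of a linear functional on the vertices is a global minimum. -/
theorem le_of_local (hP : IsPolygon N p) {d : Plane} {m : ℕ}
    (h1 : cr d (p (m + 1)) ≤ cr d (p m)) (h2 : cr d (p (m + 1)) ≤ cr d (p (m + 2))) (l : ℕ) :
    cr d (p (m + 1)) ≤ cr d (p l) := by
  have h := cr_cone (p m) (p (m + 1)) (p (m + 2)) (p l) d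
  rw [cr_sub_right, cr_sub_right, cr_sub_right] at h
  have h3 : 0 ≤ orient (p m) (p (m + 1)) (p (m + 2)) * (cr d (p l) - cr d (p (m + 1))) := by
    rw [h]
    exact add_nonneg (mul_nonneg (hP.left_le _ _) (by linarith))
      (mul_nonneg (hP.left_le (m + 1) _) (by linarith))
  linarith [nonneg_of_mul_nonneg_right h3 (hP.turn m)]

theorem lt_of_local (hP : IsPolygon N p) {d : Plane} {m : ℕ}
    (h1 : cr d (p (m + 1)) < cr d (p m)) (h2 : cr d (p (m + 1)) < cr d (p (m + 2))) {l : ℕ}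
    (hl : ¬ l ≡ m + 1 [MOD N]) : cr d (p (m + 1)) < cr d (p l) := by
  have h := cr_cone (p m) (p (m + 1)) (p (m + 2)) (p l) d
  rw [cr_sub_right, cr_sub_right, cr_sub_right] at h
  by_cases hl' : l ≡ m [MOD N]
  · rwa [hP.congr hl']
  have h3 : 0 < orient (p m) (p (m + 1)) (p (m + 2)) * (cr d (p l) - cr d (p (m + 1))) := by
    rw [h]
    exact add_pos_of_pos_of_nonneg (mul_pos (hP.left _ _ hl' hl) (by linarith))
      (mul_nonneg (hP.left_le (m + 1) _) (by linarith))
  linarith [(pos_iff_pos_of_mul_pos h3).1 (hP.turn m)]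

end IsPolygon

/-- The edge number `m` has the length `r m` and the direction `α m`, where the directions are
measured continuously along the boundary. -/
structure IsLift (N : ℕ) (p : ℕ → Plane) (α r : ℕ → ℝ) : Prop where
  pos : ∀ m, 0 < r m
  edge : ∀ m, p (m + 1) - p m = r m • unit (α m)
  lt : ∀ m, α m < α (m + 1)
  lt_pi : ∀ m, α (m + 1) < α m + π
  period : ∀ m, α (m + N) = α m + 2 * π

/-- Each left turn contributes an angle between 0 and π, and the lift is the sum of these angles.
The delicate point is that they add up to 2π and not to a larger multiple, which follows from global
convexity. -/
theorem IsPolygon.exists_isLift {N : ℕ} {p : ℕ → Plane} (hP : IsPolygon N p) :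
    ∃ α r, IsLift N p α r := by
  have hN := hP.three
  set e : ℕ → Plane := fun m => p (m + 1) - p m with he
  set β : ℕ → ℝ := fun m => direction (e m) with hβ
  set r : ℕ → ℝ := fun m => ‖(⟨e m 0, e m 1⟩ : ℂ)‖ with hr
  have hturn : ∀ m, 0 < cr (e m) (e (m + 1)) := by
    intro m
    have h := hP.turn m
    simp only [orient] at h
    simp only [he, cr, PiLp.sub_apply]
    linarith
  have hpol : ∀ m, e m = r m • unit (β m) := fun m => eq_smul_unit_direction _
  have hpos : ∀ m, 0 < r m := by
    intro m
    refine (norm_nonneg _).lt_of_ne fun h => ?_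
    have h' := hturn m
    rw [hpol m, show r m = 0 from h.symm] at h'
    simp [cr] at h'
  have hsin : ∀ m, 0 < sin (β (m + 1) - β m) := by
    intro m
    have h' := hturn m
    rw [hpol m, hpol (m + 1), cr_smul_left, cr_smul_right, cr_unit_unit] at h'
    have h1 := (pos_iff_pos_of_mul_pos h').1 (hpos m)
    exact (pos_iff_pos_of_mul_pos h1).1 (hpos (m + 1))
  set δ : ℕ → ℝ := fun m => toIcoMod two_pi_pos 0 (β (m + 1) - β m) with hδ
  have hδz : ∀ m, ∃ z : ℤ, δ m = β (m + 1) - β m + z * (2 * π) := by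
    intro m
    refine ⟨-toIcoDiv two_pi_pos 0 (β (m + 1) - β m), ?_⟩
    simp only [hδ]
    rw [toIcoMod, zsmul_eq_mul]
    push_cast
    ring
  have hδ0 : ∀ m, 0 < δ m ∧ δ m < π := by
    intro m
    have h0 : 0 ≤ δ m := left_le_toIcoMod _ _ _
    have h1 : δ m < 0 + 2 * π := toIcoMod_lt_right _ _ _
    have hs : 0 < sin (δ m) := by
      obtain ⟨z, hz⟩ := hδz m
      rw [hz, sin_add_int_mul_two_pi]
      exact hsin m
    refine ⟨h0.lt_of_ne fun h => ?_, ?_⟩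
    · rw [← h] at hs; simp at hs
    · by_contra hge
      have : 0 ≤ sin (δ m - π) := sin_nonneg_of_nonneg_of_le_pi (by linarith) (by linarith)
      rw [sin_sub_pi] at this
      linarith
  set α : ℕ → ℝ := fun m => β 0 + ∑ l ∈ Finset.range m, δ l with hα
  have hsucc : ∀ m, α (m + 1) = α m + δ m := by
    intro m; simp only [hα, Finset.sum_range_succ]; ring
  have hαz : ∀ m, ∃ z : ℤ, α m = β m + z * (2 * π) := by
    intro m
    induction m with
    | zero => exact ⟨0, by simp [hα]⟩
    | succ m ih =>
      obtain ⟨z, hz⟩ := ih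
      obtain ⟨z', hz'⟩ := hδz m
      refine ⟨z + z', ?_⟩
      rw [hsucc, hz, hz']
      push_cast
      ring
  have hedge : ∀ m, e m = r m • unit (α m) := by
    intro m
    obtain ⟨z, hz⟩ := hαz m
    have : unit (α m) = unit (β m) := by
      simp [hz, unit, cos_add_int_mul_two_pi, sin_add_int_mul_two_pi]
    rw [this]
    exact hpol m
  have hlt : ∀ m, α m < α (m + 1) := fun m => by linarith [hsucc m, (hδ0 m).1]
  have hltpi : ∀ m, α (m + 1) < α m + π := fun m => by linarith [hsucc m, (hδ0 m).2]
  have hmono : StrictMono α := strictMono_nat_of_lt_succ hlt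
  -- At the first edge that completes a full turn, the height over the edge `0` would have a local
  -- minimum, hence a global one. But the vertex there lies strictly to the left of the edge `0`.
  have hturn2 : ∀ m, m + 1 ≤ N → α m < α 0 + 2 * π := by
    intro m
    induction m with
    | zero => intro _; linarith [pi_pos]
    | succ m ih =>
      intro hm
      by_contra hge
      have h1 := ih (by omega)
      have h2 := hltpi m
      have hm1 : 1 ≤ m := by
        by_contra h
        obtain rfl : m = 0 := by omega
        linarith [pi_pos]
      have hs1 : sin (α m - α 0) ≤ 0 := by
        rw [← sin_sub_two_pi]
        exact sin_nonpos_of_nonpos_of_neg_pi_le (by linarith) (by linarith)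
      have hs2 : 0 ≤ sin (α (m + 1) - α 0) := by
        rw [← sin_sub_two_pi]
        exact sin_nonneg_of_nonneg_of_le_pi (by linarith) (by linarith)
      have hc1 : cr (unit (α 0)) (p (m + 1)) ≤ cr (unit (α 0)) (p m) := by
        have h : cr (unit (α 0)) (e m) ≤ 0 := by
          rw [hedge, cr_smul_right, cr_unit_unit]
          exact mul_nonpos_of_nonneg_of_nonpos (hpos m).le hs1
        rw [he, cr_sub_right] at h
        linarith
      have hc2 : cr (unit (α 0)) (p (m + 1)) ≤ cr (unit (α 0)) (p (m + 2)) := by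
        have h : 0 ≤ cr (unit (α 0)) (e (m + 1)) := by
          rw [hedge, cr_smul_right, cr_unit_unit]
          exact mul_nonneg (hpos _).le hs2
        rw [he, cr_sub_right] at h
        linarith
      have h0 := hP.le_of_local hc1 hc2 0
      have h3 := hP.left 0 (m + 1)
        (by simpa using hP.not_modEq_add 0 (a := m + 1) (by omega) (by omega))
        (by simpa [add_comm] using hP.not_modEq_add 1 (a := m) (by omega) (by omega))
      rw [orient_eq_cr] at h3
      have h4 : p (0 + 1) - p 0 = _ := hedge 0
      rw [h4, cr_smul_left, cr_sub_right] at h3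
      linarith [(pos_iff_pos_of_mul_pos h3).1 (hpos 0)]
  have hN0 : α N = α 0 + 2 * π := by
    obtain ⟨z, hz⟩ := hαz N
    have hβN : β N = β 0 := by
      have h1 := hP.periodic 0
      have h2 := hP.periodic 1
      rw [zero_add] at h1
      rw [add_comm] at h2
      simp only [hβ, he, h1, h2, zero_add]
    rw [hβN] at hz
    have hα0 : α 0 = β 0 := by simp [hα]
    -- The total turn is a positive multiple of 2π, and it is below 2π plus one further turn of less
    -- than π, so the multiple is one.
    obtain ⟨M, rfl⟩ : ∃ M, N = M + 1 := ⟨N - 1, by omega⟩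
    have h1 := hturn2 M le_rfl
    have h2 := hltpi M
    have h3 := hmono (Nat.succ_pos M)
    rw [hα0] at h1 h3 ⊢
    have hz0 : (0 : ℝ) < z := by
      by_contra h
      have : (z : ℝ) * (2 * π) ≤ 0 :=
        mul_nonpos_of_nonpos_of_nonneg (not_lt.1 h) two_pi_pos.le
      linarith
    have hz2 : (z : ℝ) < 2 := by
      by_contra h
      have : 2 * (2 * π) ≤ (z : ℝ) * (2 * π) :=
        mul_le_mul_of_nonneg_right (not_lt.1 h) two_pi_pos.le
      linarith [pi_pos]
    have hz1 : z = 1 := by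
      have h1 : 0 < z := by exact_mod_cast hz0
      have h2 : z < 2 := by exact_mod_cast hz2
      omega
    rw [hz, hz1]; simp
  refine ⟨α, r, hpos, hedge, hlt, hltpi, fun m => ?_⟩
  induction m with
  | zero => rw [zero_add, hN0]
  | succ m ih =>
    have hδN : δ (m + N) = δ m := by
      have h1 := hP.periodic m
      have h2 := hP.periodic (m + 1)
      have h3 := hP.periodic (m + 1 + 1)
      rw [show m + 1 + N = m + N + 1 by omega] at h2
      rw [show m + 1 + 1 + N = m + N + 1 + 1 by omega] at h3
      simp only [hδ, hβ, he, h1, h2, h3]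
    rw [show m + 1 + N = m + N + 1 by omega, hsucc, ih, hsucc, hδN]
    ring

end FixedAngleTriangle

/-! ### Supporting lines -/

namespace FixedAngleTriangle

open Real

/-- The least value of `cr (unit θ)` on the points `p m`. -/
noncomputable def support (p : ℕ → Plane) (θ : ℝ) : ℝ := sInf (Set.range fun l => cr (unit θ) (p l))

/-- The distance of `q` from the line of direction `θ` that supports the points `p m` from the
right. -/
noncomputable def width (p : ℕ → Plane) (θ : ℝ) (q : Plane) : ℝ := cr (unit θ) q - support p θ

theorem width_eq {p : ℕ → Plane} {θ : ℝ} {m : ℕ}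
    (h : ∀ l, cr (unit θ) (p m) ≤ cr (unit θ) (p l)) (q : Plane) :
    width p θ q = cr (unit θ) (q - p m) := by
  have : IsLeast (Set.range fun l => cr (unit θ) (p l)) (cr (unit θ) (p m)) :=
    ⟨⟨m, rfl⟩, by rintro _ ⟨l, rfl⟩; exact h l⟩
  rw [width, support, this.csInf_eq, cr_sub_right]

/-- With `φ` the direction of the side `AB`, the line of the edge number `k` meets the sides `AB`
and `AC` at points the midpoint of which lies beyond the end of the edge; or the edge comes before
the third side. -/
def Beyond (ω : ℝ) (p : ℕ → Plane) (α : ℕ → ℝ) (φ : ℝ) (k : ℕ) : Prop :=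
  α k ≤ φ + ω ∨ (α k < φ + π ∧ width p φ (p (k + 1)) * sin (α k - (φ + ω)) <
    width p (φ + ω + π) (p (k + 1)) * sin (α k - φ))

/-- With `φ` the direction of the side `AB`, the minimum third side passes through the vertex
number `k`, possibly along the edge number `k`. -/
def IsBase (ω : ℝ) (p : ℕ → Plane) (α : ℕ → ℝ) (φ : ℝ) (k : ℕ) : Prop :=
  ∃ ψ, φ + ω < ψ ∧ ψ < φ + π ∧ (∀ l < k, α l < ψ) ∧ ψ ≤ α k ∧
    0 < width p (φ + ω + π) (p k) ∧
    width p φ (p k) * sin (ψ - (φ + ω)) ≤ width p (φ + ω + π) (p k) * sin (ψ - φ) ∧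
    ((ψ = α k ∧ width p (φ + ω + π) (p (k + 1)) * sin (ψ - φ) ≤
        width p φ (p (k + 1)) * sin (ψ - (φ + ω))) ∨
      width p (φ + ω + π) (p k) * sin (ψ - φ) ≤ width p φ (p k) * sin (ψ - (φ + ω)))

/-- It governs the monotonicity of the quotient of `sin (a - χ)` by `sin (a - φ)` in `a`, that is,
how the ratio of the two parts of a chord changes when the chord turns. -/
theorem sin_mul_sin_sub (a b φ χ : ℝ) : sin (a - χ) * sin (b - φ) - sin (b - χ) * sin (a - φ) =
    sin (a - b) * sin (χ - φ) := by
  simp only [sin_sub]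
  have h1 := sin_sq_add_cos_sq a
  have h2 := sin_sq_add_cos_sq b
  ring

/-- The Plücker relation for four vectors. It compares where two lines through one point, of
directions `φ` and `φ'`, meet a line of direction `α`. -/
theorem cr_unit_identity (α φ φ' : ℝ) (v : Plane) :
    cr (unit φ) v * sin (α - φ') - cr (unit φ') v * sin (α - φ) =
      - (sin (φ' - φ) * cr (unit α) v) := by
  simp only [cr, unit, sin_sub, pt_zero, pt_one]
  ring

theorem cr_unit_add_pi (θ : ℝ) (v : Plane) : cr (unit (θ + π)) v = - cr (unit θ) v := by
  simp [unit_add_pi, cr]; ring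

namespace IsLift

variable {N : ℕ} {p : ℕ → Plane} {α r : ℕ → ℝ}

theorem strictMono (hα : IsLift N p α r) : StrictMono α := strictMono_nat_of_lt_succ hα.lt

theorem cr_edge (hα : IsLift N p α r) (θ : ℝ) (m : ℕ) :
    cr (unit θ) (p (m + 1)) - cr (unit θ) (p m) = r m * sin (α m - θ) := by
  rw [← cr_sub_right, hα.edge, cr_smul_right, cr_unit_unit]

/-- The edge before the vertex descends and the edge after it ascends, relative to lines of
direction `θ`; a local minimum suffices. -/
theorem contact (hα : IsLift N p α r) (hP : IsPolygon N p) {θ : ℝ} {m : ℕ} (h1 : α m ≤ θ)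
    (h2 : θ ≤ α (m + 1)) (l : ℕ) : cr (unit θ) (p (m + 1)) ≤ cr (unit θ) (p l) := by
  have := hα.lt_pi m
  apply hP.le_of_local
  · have h := hα.cr_edge θ m
    have : r m * sin (α m - θ) ≤ 0 := mul_nonpos_of_nonneg_of_nonpos (hα.pos m).le
      (sin_nonpos_of_nonpos_of_neg_pi_le (by linarith) (by linarith))
    linarith
  · have h := hα.cr_edge θ (m + 1)
    have : 0 ≤ r (m + 1) * sin (α (m + 1) - θ) := mul_nonneg (hα.pos _).le
      (sin_nonneg_of_nonneg_of_le_pi (by linarith) (by linarith))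
    linarith

theorem contact_lt (hα : IsLift N p α r) (hP : IsPolygon N p) {θ : ℝ} {m : ℕ} (h1 : α m < θ)
    (h2 : θ < α (m + 1)) {l : ℕ} (hl : ¬ l ≡ m + 1 [MOD N]) :
    cr (unit θ) (p (m + 1)) < cr (unit θ) (p l) := by
  have := hα.lt_pi m
  refine hP.lt_of_local ?_ ?_ hl
  · have h := hα.cr_edge θ m
    have : r m * sin (α m - θ) < 0 := mul_neg_of_pos_of_neg (hα.pos m)
      (sin_neg_of_neg_of_neg_pi_lt (by linarith) (by linarith))
    linarith
  · have h := hα.cr_edge θ (m + 1)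
    have : 0 < r (m + 1) * sin (α (m + 1) - θ) := mul_pos (hα.pos _)
      (sin_pos_of_pos_of_lt_pi (by linarith) (by linarith))
    linarith

theorem contact_edge (hα : IsLift N p α r) (hP : IsPolygon N p) {m l : ℕ}
    (hl : ¬ l ≡ m [MOD N]) (hl' : ¬ l ≡ m + 1 [MOD N]) :
    cr (unit (α m)) (p (m + 1)) < cr (unit (α m)) (p l) := by
  have h := hP.left m l hl hl'
  have h0 := hα.cr_edge (α m) m
  rw [orient_eq_cr, hα.edge, cr_smul_left, cr_sub_right] at h
  have := (pos_iff_pos_of_mul_pos h).1 (hα.pos m)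
  rw [sub_self, sin_zero, mul_zero] at h0
  linarith

theorem exists_index (hα : IsLift N p α r) {θ : ℝ} {m₀ : ℕ} (h : α m₀ ≤ θ) :
    ∃ m, m₀ ≤ m ∧ α m ≤ θ ∧ θ < α (m + 1) := by
  have hub : ∀ k : ℕ, α (m₀ + k * N) = α m₀ + k * (2 * π) := by
    intro k
    induction k with
    | zero => simp
    | succ k ih =>
      rw [add_mul, one_mul, ← add_assoc, hα.period, ih]; push_cast; ring
  have hex : ∃ k, θ < α (m₀ + k + 1) := by
    obtain ⟨k, hk⟩ := exists_nat_gt ((θ - α m₀) / (2 * π))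
    refine ⟨k * N, ?_⟩
    have h1 := hα.lt (m₀ + k * N)
    rw [div_lt_iff₀ two_pi_pos] at hk
    rw [hub] at h1
    linarith
  classical
  refine ⟨m₀ + Nat.find hex, Nat.le_add_right _ _, ?_, Nat.find_spec hex⟩
  rcases Nat.eq_zero_or_pos (Nat.find hex) with h0 | hpos
  · rw [h0]; exact h
  · have := Nat.find_min hex (Nat.sub_one_lt_of_lt hpos)
    rw [show m₀ + (Nat.find hex - 1) + 1 = m₀ + Nat.find hex by omega] at this
    exact not_lt.1 this

theorem exists_contact (hα : IsLift N p α r) (hP : IsPolygon N p) {θ : ℝ} {m₀ : ℕ}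
    (h : α m₀ ≤ θ) : ∃ m, ∀ l, cr (unit θ) (p m) ≤ cr (unit θ) (p l) := by
  obtain ⟨m, -, h1, h2⟩ := hα.exists_index h
  exact ⟨m + 1, hα.contact hP h1 h2.le⟩

/-- Measure along the line of the edge `k` from its end `q`. The distance back to AB is the width of
`q` over AB divided by `sin (α k - φ)`; the distance forward to AC is the width over CA divided by
`sin (α k - (φ + ω))`. When φ grows, the supporting lines roll around the polygon, which lies to the
left of the edge, so the first distance does not grow and the second does not shrink. A midpoint
beyond `q` therefore stays beyond it. -/
theorem beyond_mono (hα : IsLift N p α r) (hP : IsPolygon N p) {ω φ φ' : ℝ} (h0 : 0 < ω)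
    {m₀ k : ℕ} (hφ : α m₀ ≤ φ) (hφ' : φ ≤ φ') (h : Beyond ω p α φ k) :
    Beyond ω p α φ' k := by
  rcases hφ'.eq_or_lt with rfl | hlt
  · exact h
  by_cases hk : α k ≤ φ' + ω
  · exact Or.inl hk
  rw [not_le] at hk
  rcases h with h | ⟨h1, h2⟩
  · exact Or.inl (by linarith)
  refine Or.inr ⟨by linarith, ?_⟩
  set q := p (k + 1) with hq
  have hleft : ∀ m, cr (unit (α k)) (q - p m) ≤ 0 := by
    intro m
    have := hα.contact hP (hα.lt k).le le_rfl
    have h := hP.left_le k m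
    have h' := hα.cr_edge (α k) k
    rw [orient_eq_cr, hα.edge, cr_smul_left, cr_sub_right] at h
    have := nonneg_of_mul_nonneg_right h (hα.pos k)
    rw [sub_self, sin_zero, mul_zero] at h'
    rw [cr_sub_right, hq]
    linarith
  obtain ⟨a, ha⟩ := hα.exists_contact hP hφ
  obtain ⟨a', ha'⟩ := hα.exists_contact hP (hφ.trans hφ')
  obtain ⟨b, hb⟩ := hα.exists_contact hP (show α m₀ ≤ φ + ω + π by linarith)
  obtain ⟨b', hb'⟩ := hα.exists_contact hP (show α m₀ ≤ φ' + ω + π by linarith)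
  have s1 : 0 < sin (α k - φ) := sin_pos_of_pos_of_lt_pi (by linarith) (by linarith)
  have s2 : 0 < sin (α k - φ') := sin_pos_of_pos_of_lt_pi (by linarith) (by linarith)
  have s3 : 0 < sin (α k - (φ + ω)) := sin_pos_of_pos_of_lt_pi (by linarith) (by linarith)
  have s4 : 0 < sin (α k - (φ' + ω)) := sin_pos_of_pos_of_lt_pi (by linarith) (by linarith)
  have s5 : 0 ≤ sin (φ' - φ) := sin_nonneg_of_nonneg_of_le_pi (by linarith) (by linarith)
  -- Turn the new line AB back around its contact vertex, then push it out to the old supporting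
  -- line.
  have e1 : width p φ' q * sin (α k - φ) ≤ width p φ q * sin (α k - φ') := by
    have i1 : width p φ' q * sin (α k - φ) ≤ cr (unit φ) (q - p a') * sin (α k - φ') := by
      rw [width_eq ha']
      have := cr_unit_identity (α k) φ φ' (q - p a')
      have := mul_nonpos_of_nonneg_of_nonpos s5 (hleft a')
      linarith
    have i2 : cr (unit φ) (q - p a') ≤ width p φ q := by
      rw [width_eq ha, cr_sub_right, cr_sub_right]
      linarith [ha a']
    exact i1.trans (mul_le_mul_of_nonneg_right i2 s2.le)
  have e2 : width p (φ + ω + π) q * sin (α k - (φ' + ω)) ≤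
      width p (φ' + ω + π) q * sin (α k - (φ + ω)) := by
    have i1 : width p (φ + ω + π) q * sin (α k - (φ' + ω)) ≤
        cr (unit (φ' + ω + π)) (q - p b) * sin (α k - (φ + ω)) := by
      rw [width_eq hb, cr_unit_add_pi, cr_unit_add_pi]
      have := cr_unit_identity (α k) (φ + ω) (φ' + ω) (q - p b)
      rw [show φ' + ω - (φ + ω) = φ' - φ by ring] at this
      have := mul_nonpos_of_nonneg_of_nonpos s5 (hleft b)
      linarith
    have i2 : cr (unit (φ' + ω + π)) (q - p b) ≤ width p (φ' + ω + π) q := by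
      rw [width_eq hb', cr_sub_right, cr_sub_right]
      linarith [hb' b]
    exact i1.trans (mul_le_mul_of_nonneg_right i2 s3.le)
  -- The comparison of quotients is cleared of denominators, all of which are positive.
  have key : (width p φ' q * sin (α k - (φ' + ω))) * (sin (α k - φ) * sin (α k - (φ + ω))) <
      (width p (φ' + ω + π) q * sin (α k - φ')) * (sin (α k - φ) * sin (α k - (φ + ω))) := by
    calc _ = (width p φ' q * sin (α k - φ)) * (sin (α k - (φ' + ω)) * sin (α k - (φ + ω))) := by
          ring
      _ ≤ (width p φ q * sin (α k - φ')) * (sin (α k - (φ' + ω)) * sin (α k - (φ + ω))) :=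
          mul_le_mul_of_nonneg_right e1 (mul_pos s4 s3).le
      _ = (width p φ q * sin (α k - (φ + ω))) * (sin (α k - φ') * sin (α k - (φ' + ω))) := by
          ring
      _ < (width p (φ + ω + π) q * sin (α k - φ)) * (sin (α k - φ') * sin (α k - (φ' + ω))) :=
          mul_lt_mul_of_pos_right h2 (mul_pos s2 s4)
      _ = (width p (φ + ω + π) q * sin (α k - (φ' + ω))) * (sin (α k - φ') * sin (α k - φ)) := by
          ring
      _ ≤ (width p (φ' + ω + π) q * sin (α k - (φ + ω))) * (sin (α k - φ') * sin (α k - φ)) :=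
          mul_le_mul_of_nonneg_right e2 (mul_pos s2 s1).le
      _ = _ := by ring
  exact lt_of_mul_lt_mul_right key (mul_pos s1 s3).le

/-- If the base lies along the edge, this is part of its definition. If the base is bisected at the
vertex `k`, turn it forward to the edge and move the reference point to the end of the edge. Both
changes lengthen the part towards AB relative to the part towards AC, so the midpoint cannot have
passed that end. -/
theorem not_beyond (hα : IsLift N p α r) (hP : IsPolygon N p) {ω φ : ℝ} (h0 : 0 < ω)
    {m₀ k : ℕ} (hφ : α m₀ ≤ φ) (h : IsBase ω p α φ k) : ¬ Beyond ω p α φ k := by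
  obtain ⟨ψ, h1, h2, -, h4, -, -, h5⟩ := h
  rintro (h6 | ⟨h6, h7⟩)
  · linarith
  rcases h5 with ⟨rfl, h5⟩ | h5
  · linarith
  obtain ⟨a, ha⟩ := hα.exists_contact hP hφ
  obtain ⟨b, hb⟩ := hα.exists_contact hP (show α m₀ ≤ φ + ω + π by linarith)
  have d1 : 0 ≤ width p φ (p k) := by rw [width_eq ha, cr_sub_right]; linarith [ha k]
  have d2 : width p φ (p k) ≤ width p φ (p (k + 1)) := by
    have h := hα.cr_edge φ k
    have : 0 ≤ r k * sin (α k - φ) := mul_nonneg (hα.pos k).le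
      (sin_nonneg_of_nonneg_of_le_pi (by linarith) (by linarith))
    simp only [width]
    linarith
  have d3 : width p (φ + ω + π) (p (k + 1)) ≤ width p (φ + ω + π) (p k) := by
    have h := hα.cr_edge (φ + ω + π) k
    have : r k * sin (α k - (φ + ω + π)) ≤ 0 := mul_nonpos_of_nonneg_of_nonpos (hα.pos k).le
      (sin_nonpos_of_nonpos_of_neg_pi_le (by linarith) (by linarith))
    simp only [width]
    linarith
  have s1 : 0 < sin (ψ - φ) := sin_pos_of_pos_of_lt_pi (by linarith) (by linarith)
  have s2 : 0 < sin (ψ - (φ + ω)) := sin_pos_of_pos_of_lt_pi (by linarith) (by linarith)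
  have s3 : 0 < sin (α k - φ) := sin_pos_of_pos_of_lt_pi (by linarith) (by linarith)
  have s4 : sin (ψ - (φ + ω)) * sin (α k - φ) ≤ sin (α k - (φ + ω)) * sin (ψ - φ) := by
    have h := sin_mul_sin_sub (α k) ψ φ (φ + ω)
    have : 0 ≤ sin (α k - ψ) * sin (φ + ω - φ) :=
      mul_nonneg (sin_nonneg_of_nonneg_of_le_pi (by linarith) (by linarith))
        (sin_nonneg_of_nonneg_of_le_pi (by linarith) (by linarith))
    linarith
  have key : width p (φ + ω + π) (p (k + 1)) * sin (α k - φ) * sin (ψ - φ) ≤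
      width p φ (p (k + 1)) * sin (α k - (φ + ω)) * sin (ψ - φ) := by
    calc _ = width p (φ + ω + π) (p (k + 1)) * (sin (α k - φ) * sin (ψ - φ)) := by ring
      _ ≤ width p (φ + ω + π) (p k) * (sin (α k - φ) * sin (ψ - φ)) :=
          mul_le_mul_of_nonneg_right d3 (mul_pos s3 s1).le
      _ = (width p (φ + ω + π) (p k) * sin (ψ - φ)) * sin (α k - φ) := by ring
      _ ≤ (width p φ (p k) * sin (ψ - (φ + ω))) * sin (α k - φ) :=
          mul_le_mul_of_nonneg_right h5 s3.le
      _ = width p φ (p k) * (sin (ψ - (φ + ω)) * sin (α k - φ)) := by ring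
      _ ≤ width p φ (p (k + 1)) * (sin (ψ - (φ + ω)) * sin (α k - φ)) :=
          mul_le_mul_of_nonneg_right d2 (mul_pos s2 s3).le
      _ ≤ width p φ (p (k + 1)) * (sin (α k - (φ + ω)) * sin (ψ - φ)) :=
          mul_le_mul_of_nonneg_left s4 (d1.trans d2)
      _ = _ := by ring
  exact absurd h7 (not_lt.2 (le_of_mul_le_mul_right key s1))

/-- The counterpart of `not_beyond`: going back from the base to an earlier edge moves away from AC
and closer to AB, and the turn back by the angle from ψ to `α l` is genuine. The inequality is
strict because the vertex `k` has positive width over CA, which is why `IsBase` demands this. -/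
theorem beyond_of_lt (hα : IsLift N p α r) {ω φ : ℝ} (h0 : 0 < ω) {k l : ℕ}
    (h : IsBase ω p α φ k) (hl : l < k) : Beyond ω p α φ l := by
  obtain ⟨ψ, h1, h2, h3, -, h5, h6, -⟩ := h
  have hlψ := h3 l hl
  by_cases hc : α l ≤ φ + ω
  · exact Or.inl hc
  rw [not_le] at hc
  refine Or.inr ⟨by linarith, ?_⟩
  have mono : ∀ m, l + 1 ≤ m → m ≤ k → width p φ (p (l + 1)) ≤ width p φ (p m) ∧
      width p (φ + ω + π) (p m) ≤ width p (φ + ω + π) (p (l + 1)) := by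
    intro m hm
    induction m, hm using Nat.le_induction with
    | base => exact fun _ => ⟨le_rfl, le_rfl⟩
    | succ m hm ih =>
      intro hmk
      obtain ⟨i1, i2⟩ := ih (by omega)
      have m1 := h3 m (by omega)
      have m2 := hα.strictMono (show l < m by omega)
      have g1 := hα.cr_edge φ m
      have g2 := hα.cr_edge (φ + ω + π) m
      have : 0 ≤ r m * sin (α m - φ) := mul_nonneg (hα.pos m).le
        (sin_nonneg_of_nonneg_of_le_pi (by linarith) (by linarith))
      have : r m * sin (α m - (φ + ω + π)) ≤ 0 := mul_nonpos_of_nonneg_of_nonpos (hα.pos m).le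
        (sin_nonpos_of_nonpos_of_neg_pi_le (by linarith) (by linarith))
      simp only [width] at *
      exact ⟨by linarith, by linarith⟩
  obtain ⟨i1, i2⟩ := mono k (by omega) le_rfl
  have s1 : 0 < sin (ψ - φ) := sin_pos_of_pos_of_lt_pi (by linarith) (by linarith)
  have s2 : 0 < sin (ψ - (φ + ω)) := sin_pos_of_pos_of_lt_pi (by linarith) (by linarith)
  have s3 : 0 < sin (α l - φ) := sin_pos_of_pos_of_lt_pi (by linarith) (by linarith)
  have s5 : 0 < sin (α l - (φ + ω)) := sin_pos_of_pos_of_lt_pi (by linarith) (by linarith)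
  have s4 : sin (ψ - φ) * sin (α l - (φ + ω)) < sin (α l - φ) * sin (ψ - (φ + ω)) := by
    have h := sin_mul_sin_sub ψ (α l) φ (φ + ω)
    have : 0 < sin (ψ - α l) * sin (φ + ω - φ) :=
      mul_pos (sin_pos_of_pos_of_lt_pi (by linarith) (by linarith))
        (sin_pos_of_pos_of_lt_pi (by linarith) (by linarith))
    linarith
  have key : width p φ (p k) * sin (α l - (φ + ω)) * sin (ψ - (φ + ω)) <
      width p (φ + ω + π) (p k) * sin (α l - φ) * sin (ψ - (φ + ω)) := by
    calc _ = (width p φ (p k) * sin (ψ - (φ + ω))) * sin (α l - (φ + ω)) := by ring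
      _ ≤ (width p (φ + ω + π) (p k) * sin (ψ - φ)) * sin (α l - (φ + ω)) :=
          mul_le_mul_of_nonneg_right h6 s5.le
      _ = width p (φ + ω + π) (p k) * (sin (ψ - φ) * sin (α l - (φ + ω))) := by ring
      _ < width p (φ + ω + π) (p k) * (sin (α l - φ) * sin (ψ - (φ + ω))) :=
          mul_lt_mul_of_pos_left s4 h5
      _ = _ := by ring
  calc _ ≤ width p φ (p k) * sin (α l - (φ + ω)) := mul_le_mul_of_nonneg_right i1 s5.le
    _ < width p (φ + ω + π) (p k) * sin (α l - φ) := lt_of_mul_lt_mul_right key s2.le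
    _ ≤ _ := mul_le_mul_of_nonneg_right i2 s3.le

end IsLift

end FixedAngleTriangle

/-! ### Necessary conditions for minimum area -/

namespace FixedAngleTriangle

open Real Filter Topology

theorem continuous_orient :
    Continuous fun x : Plane × Plane × Plane => orient x.1 x.2.1 x.2.2 := by
  unfold orient; fun_prop

theorem tendsto_orient {l : Filter ℝ} {a b c : ℝ → Plane} {A B C : Plane}
    (ha : Tendsto a l (𝓝 A)) (hb : Tendsto b l (𝓝 B)) (hc : Tendsto c l (𝓝 C)) :
    Tendsto (fun x => orient (a x) (b x) (c x)) l (𝓝 (orient A B C)) :=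
  (continuous_orient.tendsto (A, B, C)).comp (ha.prodMk_nhds (hb.prodMk_nhds hc))

section

variable {ω : ℝ} {S : Set Plane} {A B C : Plane}

/-- A minimum triangle cannot be deformed into a smaller admissible one. -/
theorem Minimal.eventually_le (h : Minimal ω S A B C) (hS : S.Finite) {l : Filter ℝ}
    {a b c : ℝ → Plane} (ha : Tendsto a l (𝓝 A)) (hb : Tendsto b l (𝓝 B))
    (hc : Tendsto c l (𝓝 C))
    (hω : ∀ᶠ x in l, dt (b x - a x) (c x - a x) * sin ω = orient (a x) (b x) (c x) * cos ω)
    (hab : ∀ q ∈ S, 0 < orient A B q ∨ ∀ᶠ x in l, 0 ≤ orient (a x) (b x) q)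
    (hbc : ∀ q ∈ S, 0 < orient B C q ∨ ∀ᶠ x in l, 0 ≤ orient (b x) (c x) q)
    (hca : ∀ q ∈ S, 0 < orient C A q ∨ ∀ᶠ x in l, 0 ≤ orient (c x) (a x) q) :
    ∀ᶠ x in l, orient A B C ≤ orient (a x) (b x) (c x) := by
  have aux : ∀ {a b : ℝ → Plane} {A B q : Plane}, Tendsto a l (𝓝 A) → Tendsto b l (𝓝 B) →
      (0 < orient A B q ∨ ∀ᶠ x in l, 0 ≤ orient (a x) (b x) q) →
      ∀ᶠ x in l, 0 ≤ orient (a x) (b x) q := by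
    rintro a b A B q ha hb (h | h)
    · exact ((tendsto_orient ha hb tendsto_const_nhds).eventually_const_lt h).mono
        fun _ => le_of_lt
    · exact h
  have h1 := (eventually_all_finite hS).2 fun q hq => aux ha hb (hab q hq)
  have h2 := (eventually_all_finite hS).2 fun q hq => aux hb hc (hbc q hq)
  have h3 := (eventually_all_finite hS).2 fun q hq => aux hc ha (hca q hq)
  filter_upwards [h1, h2, h3, hω, (tendsto_orient ha hb hc).eventually_const_lt h.1.1.1]
    with x k1 k2 k3 k4 k5
  exact h.2 _ _ _ ⟨⟨k5, k4⟩, fun q hq => ⟨k1 q hq, k2 q hq, k3 q hq⟩⟩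

/-- Contract the triangle slightly towards `V`. A side whose line contains `V` stays on that line,
and a side that is clear of the finite set has room to move. The result is admissible and smaller.
-/
theorem Minimal.false_of_homothety (h : Minimal ω S A B C) (hS : S.Finite) (V : Plane)
    (hab : (∀ q ∈ S, 0 < orient A B q) ∨ orient A B V = 0)
    (hbc : (∀ q ∈ S, 0 < orient B C q) ∨ orient B C V = 0)
    (hca : (∀ q ∈ S, 0 < orient C A q) ∨ orient C A V = 0) : False := by
  set g : Plane → ℝ → Plane := fun X x => V + (1 - x) • (X - V) with hg
  have ht : ∀ X, Tendsto (g X) (𝓝[>] 0) (𝓝 X) := by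
    intro X
    have : Continuous (g X) := by fun_prop
    have h' := this.tendsto 0
    simp only [hg, sub_zero, one_smul, add_sub_cancel] at h'
    exact h'.mono_left nhdsWithin_le_nhds
  have hx : ∀ᶠ x : ℝ in 𝓝[>] 0, 0 < x ∧ x < 1 :=
    (Ioo_mem_nhdsGT (by norm_num : (0 : ℝ) < 1))
  have hside : ∀ X Y, (∀ q ∈ S, 0 ≤ orient X Y q) →
      ((∀ q ∈ S, 0 < orient X Y q) ∨ orient X Y V = 0) →
      ∀ q ∈ S, 0 < orient X Y q ∨ ∀ᶠ x in 𝓝[>] 0, 0 ≤ orient (g X x) (g Y x) q := by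
    rintro X Y h0 (h1 | h1) q hq
    · exact Or.inl (h1 q hq)
    · right
      filter_upwards [hx] with x hx
      have : orient (g X x) (g Y x) q = (1 - x) * orient X Y q - x * (1 - x) * orient X Y V := by
        simp [orient, hg]; ring
      rw [this, h1]
      have := h0 q hq
      have : 0 ≤ 1 - x := by linarith
      simp only [mul_zero, sub_zero]
      positivity
  have harea : ∀ x, orient (g A x) (g B x) (g C x) = (1 - x) ^ 2 * orient A B C := by
    intro x; simp [orient, hg]; ring
  have := h.eventually_le hS (ht A) (ht B) (ht C) (Eventually.of_forall fun x => by
      have h2 := h.1.1.2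
      have : dt (g B x - g A x) (g C x - g A x) = (1 - x) ^ 2 * dt (B - A) (C - A) := by
        simp [dt, hg]; ring
      rw [harea, this]
      linear_combination (1 - x) ^ 2 * h2)
    (hside A B (fun q hq => (h.1.2 q hq).1) hab) (hside B C (fun q hq => (h.1.2 q hq).2.1) hbc)
    (hside C A (fun q hq => (h.1.2 q hq).2.2) hca)
  obtain ⟨x, h1, h2⟩ := (this.and hx).exists
  rw [harea] at h1
  have h3 := h.1.1.1
  nlinarith [mul_pos h3 h2.1, mul_pos (mul_pos h3 h2.1) (sub_pos.2 h2.2)]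

theorem orient_left_eq (A B : Plane) : orient A B A = 0 ∧ orient A B B = 0 := by
  constructor <;> simp only [orient] <;> ring

/-- A side that misses the set can be moved by a homothety centred at the opposite vertex, through
which the other two sides pass. -/
theorem Minimal.exists_touch (h : Minimal ω S A B C) (hS : S.Finite) :
    (∃ q ∈ S, orient A B q = 0) ∧ (∃ q ∈ S, orient B C q = 0) ∧ ∃ q ∈ S, orient C A q = 0 := by
  have aux : ∀ {X Y : Plane}, (∀ q ∈ S, 0 ≤ orient X Y q) → (¬ ∃ q ∈ S, orient X Y q = 0) →
      ∀ q ∈ S, 0 < orient X Y q := fun h0 hne q hq =>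
    (h0 q hq).lt_of_ne fun he => hne ⟨q, hq, he.symm⟩
  refine ⟨?_, ?_, ?_⟩ <;> by_contra hne
  · exact h.false_of_homothety hS C (Or.inl (aux (fun q hq => (h.1.2 q hq).1) hne))
      (Or.inr (orient_left_eq _ _).2) (Or.inr (orient_left_eq _ _).1)
  · exact h.false_of_homothety hS A (Or.inr (orient_left_eq _ _).1)
      (Or.inl (aux (fun q hq => (h.1.2 q hq).2.1) hne)) (Or.inr (orient_left_eq _ _).2)
  · exact h.false_of_homothety hS B (Or.inr (orient_left_eq _ _).2)
      (Or.inr (orient_left_eq _ _).1) (Or.inl (aux (fun q hq => (h.1.2 q hq).2.2) hne))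

theorem orient_add_orient (A B C q : Plane) :
    orient A B q + orient B C q + orient C A q = orient A B C := by
  simp only [orient]; ring

/-- Slide B and C along their lines so that their distances from A are divided by `f` and `g`. The
area is divided by `f * g`, and the barycentric coordinates of a point at B and C are multiplied by
`f` and `g`. Thus only the points on BC impose a condition. -/
theorem Minimal.false_of_tilt (h : Minimal ω S A B C) (hS : S.Finite) {f g : ℝ → ℝ}
    (hf : Tendsto f (𝓝[>] 0) (𝓝 1)) (hg : Tendsto g (𝓝[>] 0) (𝓝 1))
    (hfg : ∀ᶠ x in 𝓝[>] 0, 1 < f x * g x)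
    (hq : ∀ q ∈ S, orient B C q = 0 →
      ∀ᶠ x in 𝓝[>] 0, f x * orient C A q + g x * orient A B q ≤ orient A B C) : False := by
  have hf0 := hf.eventually_const_lt zero_lt_one
  have hg0 := hg.eventually_const_lt zero_lt_one
  set b : ℝ → Plane := fun x => A + (f x)⁻¹ • (B - A) with hb
  set c : ℝ → Plane := fun x => A + (g x)⁻¹ • (C - A) with hc
  have tb : Tendsto b (𝓝[>] 0) (𝓝 B) := by
    have := (tendsto_const_nhds (x := A)).add
      ((hf.inv₀ one_ne_zero).smul (tendsto_const_nhds (x := B - A)))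
    simpa using this
  have tc : Tendsto c (𝓝[>] 0) (𝓝 C) := by
    have := (tendsto_const_nhds (x := A)).add
      ((hg.inv₀ one_ne_zero).smul (tendsto_const_nhds (x := C - A)))
    simpa using this
  have harea : ∀ x, orient A (b x) (c x) = (f x)⁻¹ * (g x)⁻¹ * orient A B C := by
    intro x; simp [orient, hb, hc]; ring
  have := h.eventually_le hS tendsto_const_nhds tb tc (Eventually.of_forall fun x => by
      have h2 := h.1.1.2
      have : dt (b x - A) (c x - A) = (f x)⁻¹ * (g x)⁻¹ * dt (B - A) (C - A) := by
        simp [dt, hb, hc]; ring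
      rw [harea, this]
      linear_combination (f x)⁻¹ * (g x)⁻¹ * h2)
    (fun q hqS => Or.inr (by
      filter_upwards [hf0] with x hx
      have : orient A (b x) q = (f x)⁻¹ * orient A B q := by simp [orient, hb]; ring
      rw [this]
      have := (h.1.2 q hqS).1
      positivity))
    (fun q hqS => (h.1.2 q hqS).2.1.lt_or_eq.imp id fun he => by
      filter_upwards [hf0, hg0, hq q hqS he.symm] with x h1 h2 h3
      have : orient (b x) (c x) q = (f x)⁻¹ * (g x)⁻¹ *
          (orient A B C - (f x * orient C A q + g x * orient A B q)) := by
        have e1 := h1.ne'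
        have e2 := h2.ne'
        simp only [orient, hb, hc, PiLp.add_apply, PiLp.smul_apply, PiLp.sub_apply, smul_eq_mul]
        field_simp
        ring
      rw [this]
      exact mul_nonneg (by positivity) (by linarith))
    (fun q hqS => Or.inr (by
      filter_upwards [hg0] with x hx
      have : orient (c x) A q = (g x)⁻¹ * orient C A q := by simp [orient, hc]; ring
      rw [this]
      have := (h.1.2 q hqS).2.2
      positivity))
  obtain ⟨x, h1, h2, h3, h4⟩ := (this.and (hfg.and (hf0.and hg0))).exists
  rw [harea, ← mul_inv] at h1
  have h5 := inv_lt_one_of_one_lt₀ h2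
  have := mul_lt_mul_of_pos_right h5 h.1.1.1
  linarith

/-- The factors `1 + t` and `1 - t + 2 t²` tilt the side to first order about its midpoint. The
quadratic term raises their product to `1 + t² + 2 t³`, so the area decreases, and it is too small
to undo the first-order gain `t (x - y)`. -/
theorem eventually_tilt {x y z : ℝ} (h : x + y = z) (hxy : x < y) :
    ∀ᶠ t : ℝ in 𝓝[>] 0, (1 + t) * x + (1 - t + 2 * t ^ 2) * y ≤ z := by
  have h1 : Tendsto (fun t : ℝ => x - y + 2 * t * y) (𝓝[>] 0) (𝓝 (x - y)) := by
    have : Continuous fun t : ℝ => x - y + 2 * t * y := by fun_prop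
    have h' := this.tendsto 0
    simp only [mul_zero, zero_mul, add_zero] at h'
    exact h'.mono_left nhdsWithin_le_nhds
  filter_upwards [h1.eventually_lt_const (sub_neg.2 hxy), self_mem_nhdsWithin] with t ht ht0
  have : 0 < t := ht0
  nlinarith [mul_neg_of_pos_of_neg this ht]

/-- The third side of a minimum triangle touches the points on both sides of its midpoint. -/
theorem Minimal.exists_touch_midpoint (h : Minimal ω S A B C) (hS : S.Finite) :
    (∃ q ∈ S, orient B C q = 0 ∧ orient A B q ≤ orient C A q) ∧
      ∃ q ∈ S, orient B C q = 0 ∧ orient C A q ≤ orient A B q := by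
  have t1 : Tendsto (fun t : ℝ => 1 + t) (𝓝[>] 0) (𝓝 1) := by
    have : Continuous fun t : ℝ => 1 + t := by fun_prop
    have h' := this.tendsto 0
    simp only [add_zero] at h'
    exact h'.mono_left nhdsWithin_le_nhds
  have t2 : Tendsto (fun t : ℝ => 1 - t + 2 * t ^ 2) (𝓝[>] 0) (𝓝 1) := by
    have : Continuous fun t : ℝ => 1 - t + 2 * t ^ 2 := by fun_prop
    have h' := this.tendsto 0
    norm_num at h'
    exact h'.mono_left nhdsWithin_le_nhds
  have t3 : ∀ᶠ t : ℝ in 𝓝[>] 0, 1 < (1 + t) * (1 - t + 2 * t ^ 2) := by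
    filter_upwards [self_mem_nhdsWithin] with t ht
    have : 0 < t := ht
    have : 0 < t ^ 2 + 2 * t ^ 3 := by positivity
    linarith
  -- If all contacts of BC lie strictly on one side of its midpoint, a tilt away from them is
  -- possible, in one direction or in the other.
  constructor <;> by_contra! hne
  · refine h.false_of_tilt hS t1 t2 t3 fun q hq h0 => ?_
    have := orient_add_orient A B C q
    exact eventually_tilt (by linarith) (hne q hq h0)
  · refine h.false_of_tilt hS t2 t1 (by simpa only [mul_comm] using t3) fun q hq h0 => ?_
    have := orient_add_orient A B C q
    refine (eventually_tilt (x := orient A B q) (y := orient C A q) (by linarith)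
      (hne q hq h0)).mono fun x hx => ?_
    linarith

end

/-! ### Intersections of lines -/

/-- The intersection of the line through `a` of direction `v` and the line through `b` of
direction `w`. -/
noncomputable def meet (a v b w : Plane) : Plane := a + (cr (b - a) w / cr v w) • v

theorem meet_eq {a v b w x : Plane} (h : cr v w ≠ 0) (ha : cr v (x - a) = 0)
    (hb : cr w (x - b) = 0) : meet a v b w = x := by
  have e : ∀ y : Plane, cr v w • y = cr y w • v - cr y v • w := by
    intro y
    apply plane_ext <;>
      simp only [cr, PiLp.smul_apply, PiLp.sub_apply, smul_eq_mul] <;> ring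
  have h1 : cr v w • (x - a) = cr (b - a) w • v := by
    rw [e, cr_swap (x - a) v, ha]
    have : cr (x - a) w = cr (b - a) w := by
      rw [cr_sub_left, cr_sub_left]
      rw [cr_sub_right] at hb
      rw [cr_swap x, cr_swap b]
      linarith
    rw [this]; simp
  have h2 : x - a = (cr (b - a) w / cr v w) • v := by
    rw [div_eq_inv_mul, mul_smul, ← h1, smul_smul, inv_mul_cancel₀ h, one_smul]
  rw [meet, ← h2]; simp

theorem cr_meet_left (a v b w : Plane) : cr v (meet a v b w - a) = 0 := by
  simp [meet, cr]; ring

theorem cr_meet_right {a v b w : Plane} (h : cr v w ≠ 0) : cr w (meet a v b w - b) = 0 := by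
  have : meet a v b w - b = (cr (b - a) w / cr v w) • v - (b - a) := by
    rw [meet]; abel
  rw [this, cr_sub_right, cr_smul_right, cr_swap w v, cr_swap w (b - a)]
  field_simp
  ring

theorem tendsto_meet {l : Filter ℝ} {a b v₀ w₀ : Plane} {v w : ℝ → Plane}
    (hv : Tendsto v l (𝓝 v₀)) (hw : Tendsto w l (𝓝 w₀)) (h : cr v₀ w₀ ≠ 0) :
    Tendsto (fun x => meet a (v x) b (w x)) l (𝓝 (meet a v₀ b w₀)) := by
  have hc : Continuous fun x : Plane × Plane => cr x.1 x.2 := by unfold cr; fun_prop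
  have h1 : Tendsto (fun x => cr (v x) (w x)) l (𝓝 (cr v₀ w₀)) :=
    (hc.tendsto (v₀, w₀)).comp (hv.prodMk_nhds hw)
  have h2 : Tendsto (fun x => cr (b - a) (w x)) l (𝓝 (cr (b - a) w₀)) :=
    (hc.tendsto (b - a, w₀)).comp (tendsto_const_nhds.prodMk_nhds hw)
  exact tendsto_const_nhds.add ((h2.div h1 h).smul hv)

end FixedAngleTriangle

/-! ### Triangles bounded by lines of given directions -/

namespace FixedAngleTriangle

open Real Filter Topology

theorem exists_smul_of_cr_eq_zero {d v : Plane} (hd : d ≠ 0) (h : cr d v = 0) :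
    ∃ x : ℝ, v = x • d := by
  simp only [cr] at h
  by_cases h0 : d 0 = 0
  · have h1 : d 1 ≠ 0 := fun h1 => hd (plane_ext h0 h1)
    refine ⟨v 1 / d 1, plane_ext ?_ ?_⟩
    · rw [h0] at h
      have : v 0 = 0 := by simpa [h1] using h
      simp [this, h0]
    · simp [h1]
  · refine ⟨v 0 / d 0, plane_ext ?_ ?_⟩
    · simp [h0]
    · simp only [PiLp.smul_apply, smul_eq_mul]
      field_simp
      linarith

theorem cr_plucker (a b c d : Plane) : cr a b * cr c d - cr a c * cr b d + cr a d * cr b c = 0 := by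
  simp only [cr]; ring

/-- The vector `v` turned by a right angle. -/
noncomputable def perp (v : Plane) : Plane := pt (-v 1) (v 0)

/-- Rotation by `ω`. -/
noncomputable abbrev rotate (ω : ℝ) (v : Plane) : Plane := rot (cos ω) (sin ω) v

theorem cr_rotate_self (ω : ℝ) (v : Plane) : cr v (rotate ω v) = sin ω * dt v v := by
  simp [cr, dt, rotate, rot]; ring

theorem dt_rotate_self (ω : ℝ) (v : Plane) : dt v (rotate ω v) = cos ω * dt v v := by
  simp [dt, rotate, rot]; ring

theorem dt_self_pos {v : Plane} (h : v ≠ 0) : 0 < dt v v := by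
  have : 0 ≤ dt v v := add_nonneg (mul_self_nonneg _) (mul_self_nonneg _)
  refine this.lt_of_ne fun he => h ?_
  simp only [dt] at he
  exact plane_ext (by simp; nlinarith [mul_self_nonneg (v 0), mul_self_nonneg (v 1)])
    (by simp; nlinarith [mul_self_nonneg (v 0), mul_self_nonneg (v 1)])

/-- The sides `AB`, `CA`, `BC` have the directions `d`, `rotate ω d`, `f` and lie on lines through
`P`, `Q`, `M`. -/
structure SideLines (ω : ℝ) (A B C d f P Q M : Plane) : Prop where
  area : 0 < orient A B C
  ab : ∃ x : ℝ, B - A = x • d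
  ac : ∃ x : ℝ, C - A = x • rotate ω d
  bc : ∃ x : ℝ, C - B = x • f
  onAB : orient A B P = 0
  onCA : orient C A Q = 0
  onBC : orient B C M = 0

namespace SideLines

variable {ω : ℝ} {A B C d f P Q M : Plane}

theorem cr_ne (h : SideLines ω A B C d f P Q M) :
    cr d (rotate ω d) ≠ 0 ∧ cr d f ≠ 0 ∧ cr (rotate ω d) f ≠ 0 := by
  obtain ⟨x, hx⟩ := h.ab
  obtain ⟨y, hy⟩ := h.ac
  obtain ⟨z, hz⟩ := h.bc
  have h1 : orient A B C = x * y * cr d (rotate ω d) := by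
    rw [orient_eq_cr, hx, hy, cr_smul_left, cr_smul_right]; ring
  have h2 : orient A B C = x * z * cr d f := by
    have : orient A B C = cr (B - A) (C - B) := by simp only [orient, cr, PiLp.sub_apply]; ring
    rw [this, hx, hz, cr_smul_left, cr_smul_right]; ring
  have h3 : orient A B C = y * z * cr (rotate ω d) f := by
    have : orient A B C = cr (C - A) (C - B) := by simp only [orient, cr, PiLp.sub_apply]; ring
    rw [this, hy, hz, cr_smul_left, cr_smul_right]; ring
  have := h.area.ne'
  exact ⟨right_ne_zero_of_mul (h1 ▸ this), right_ne_zero_of_mul (h2 ▸ this),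
    right_ne_zero_of_mul (h3 ▸ this)⟩

theorem cr_eq (h : SideLines ω A B C d f P Q M) :
    cr d (A - P) = 0 ∧ cr d (B - P) = 0 ∧ cr (rotate ω d) (A - Q) = 0 ∧
      cr (rotate ω d) (C - Q) = 0 ∧ cr f (B - M) = 0 ∧ cr f (C - M) = 0 := by
  have aux : ∀ {X Y R v : Plane} {x : ℝ}, X ≠ Y → Y - X = x • v → orient X Y R = 0 →
      cr v (X - R) = 0 ∧ cr v (Y - R) = 0 := by
    intro X Y R v x hne hv ho
    have hx : x ≠ 0 := by
      rintro rfl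
      rw [zero_smul, sub_eq_zero] at hv
      exact hne hv.symm
    rw [orient_eq_cr, hv, cr_smul_left] at ho
    have h1 := (mul_eq_zero.1 ho).resolve_left hx
    have h2 : X - R = -(1 : ℝ) • (R - X) := by simp
    have h3 : Y - R = x • v - (R - X) := by rw [← hv]; abel
    exact ⟨by rw [h2, cr_smul_right, h1]; simp,
      by rw [h3, cr_sub_right, cr_smul_right, cr_self, h1]; simp⟩
  have hA := h.area.ne'
  obtain ⟨x, hx⟩ := h.ab
  obtain ⟨y, hy⟩ := h.ac
  obtain ⟨z, hz⟩ := h.bc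
  have n1 : A ≠ B := by rintro rfl; simp [orient] at hA
  have n2 : A ≠ C := by rintro rfl; simp [orient] at hA
  have n3 : B ≠ C := by rintro rfl; apply hA; simp only [orient]; ring
  have h1 := aux n1 hx h.onAB
  have h2 := aux n2 hy (R := Q) (by have := h.onCA; simp only [orient] at this ⊢; linarith)
  have h3 := aux n3 hz h.onBC
  exact ⟨h1.1, h1.2, h2.1, h2.2, h3.1, h3.2⟩

/-- Three contact points and two directions determine the triangle; this is how the program computes
its vertices. -/
theorem eq_meet (h : SideLines ω A B C d f P Q M) :
    meet P d Q (rotate ω d) = A ∧ meet P d M f = B ∧ meet Q (rotate ω d) M f = C := by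
  obtain ⟨h1, h2, h3⟩ := h.cr_ne
  obtain ⟨k1, k2, k3, k4, k5, k6⟩ := h.cr_eq
  exact ⟨meet_eq h1 k1 k3, meet_eq h2 k2 k5, meet_eq h3 k4 k6⟩

/-- A minimum triangle is at most as large as the triangles that arise from it by turning its
sides around points of the set. -/
theorem eventually_le (hL : SideLines ω A B C d f P Q M) {S : Set Plane} (hS : S.Finite)
    (h : Minimal ω S A B C) {l : Filter ℝ} {d' f' : ℝ → Plane} (hd : Tendsto d' l (𝓝 d))
    (hf : Tendsto f' l (𝓝 f)) (hP : ∀ q ∈ S, 0 < orient A B q ∨ q = P)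
    (hQ : ∀ q ∈ S, 0 < orient C A q ∨ q = Q)
    (hM : ∀ q ∈ S, 0 < orient B C q ∨ ∀ᶠ x in l, 0 ≤ cr f (A - M) * cr (f' x) (q - M)) :
    ∀ᶠ x in l, orient A B C ≤ orient (meet P (d' x) Q (rotate ω (d' x)))
      (meet P (d' x) M (f' x)) (meet Q (rotate ω (d' x)) M (f' x)) := by
  obtain ⟨h1, h2, h3⟩ := hL.cr_ne
  obtain ⟨e1, e2, e3⟩ := hL.eq_meet
  have hr : Tendsto (fun x => rotate ω (d' x)) l (𝓝 (rotate ω d)) := by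
    have : Continuous (rotate ω) := by unfold rotate rot pt; fun_prop
    exact (this.tendsto d).comp hd
  have ta := tendsto_meet (a := P) (b := Q) hd hr h1
  have tb := tendsto_meet (a := P) (b := M) hd hf h2
  have tc := tendsto_meet (a := Q) (b := M) hr hf h3
  rw [e1] at ta
  rw [e2] at tb
  rw [e3] at tc
  have hc : Continuous fun x : Plane × Plane => cr x.1 x.2 := by unfold cr; fun_prop
  have n1 : ∀ᶠ x in l, cr (d' x) (rotate ω (d' x)) ≠ 0 :=
    ((hc.tendsto _).comp (hd.prodMk_nhds hr)).eventually_ne h1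
  have n2 : ∀ᶠ x in l, cr (d' x) (f' x) ≠ 0 :=
    ((hc.tendsto _).comp (hd.prodMk_nhds hf)).eventually_ne h2
  have n3 : ∀ᶠ x in l, cr (rotate ω (d' x)) (f' x) ≠ 0 :=
    ((hc.tendsto _).comp (hr.prodMk_nhds hf)).eventually_ne h3
  have para : ∀ {v X Y R : Plane}, v ≠ 0 → cr v (X - R) = 0 → cr v (Y - R) = 0 →
      ∃ x : ℝ, Y - X = x • v := by
    intro v X Y R hv hX hY
    apply exists_smul_of_cr_eq_zero hv
    rw [cr_sub_right] at hX hY ⊢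
    linarith
  have hzero : ∀ {v X Y R : Plane}, v ≠ 0 → cr v (X - R) = 0 → cr v (Y - R) = 0 →
      orient X Y R = 0 := by
    intro v X Y R hv hX hY
    obtain ⟨x, hx⟩ := para hv hX hY
    rw [orient_eq_cr, hx, cr_smul_left, show R - X = (-1 : ℝ) • (X - R) by simp, cr_smul_right, hX]
    simp
  have hne : ∀ {v w : Plane}, cr v w ≠ 0 → v ≠ 0 ∧ w ≠ 0 := by
    intro v w hvw
    constructor <;> rintro rfl <;> simp [cr] at hvw
  refine h.eventually_le hS ta tb tc ?_ ?_ ?_ ?_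
  · filter_upwards [n1, n2, n3] with x m1 m2 m3
    obtain ⟨y, hy⟩ := para (hne m1).1 (cr_meet_left P (d' x) Q (rotate ω (d' x)))
      (cr_meet_left P (d' x) M (f' x))
    obtain ⟨z, hz⟩ := para (hne m1).2 (cr_meet_right m1)
      (cr_meet_left Q (rotate ω (d' x)) M (f' x))
    rw [orient_eq_cr, hy, hz, cr_smul_left, cr_smul_right, cr_rotate_self]
    have : ∀ a b : Plane, dt (y • a) (z • b) = y * (z * dt a b) := by
      intro a b; simp [dt]; ring
    rw [this, dt_rotate_self]
    ring
  · intro q hq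
    refine (hP q hq).imp id ?_
    rintro rfl
    filter_upwards [n1] with x m1
    exact (hzero (hne m1).1 (cr_meet_left q (d' x) Q (rotate ω (d' x)))
      (cr_meet_left q (d' x) M (f' x))).ge
  · intro q hq
    refine (hM q hq).imp id fun hq' => ?_
    have hA0 : cr f (A - M) ≠ 0 := by
      obtain ⟨y, hy⟩ := hL.bc
      obtain ⟨-, -, -, -, h5, -⟩ := hL.cr_eq
      have h6 : orient A B C = y * cr f (A - M) := by
        rw [cr_sub_right] at h5 ⊢
        rw [← orient_rotate, orient_eq_cr, hy, cr_smul_left, cr_sub_right]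
        rw [sub_eq_zero.1 h5]
      exact right_ne_zero_of_mul (h6 ▸ hL.area.ne')
    have hs : Tendsto (fun x => cr f (A - M) * cr (f' x)
        (meet P (d' x) Q (rotate ω (d' x)) - M)) l (𝓝 (cr f (A - M) * cr f (A - M))) :=
      tendsto_const_nhds.mul ((hc.tendsto (f, A - M)).comp
        (hf.prodMk_nhds (ta.sub tendsto_const_nhds)))
    have hs' := hs.eventually_const_lt (mul_self_pos.2 hA0)
    have hpos := (tendsto_orient ta tb tc).eventually_const_lt hL.area
    filter_upwards [n2, n3, hq', hs', hpos] with x m2 m3 m4 m5 m6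
    have k1 := cr_meet_right (a := P) (b := M) m2
    have k2 := cr_meet_right (a := Q) (b := M) m3
    generalize meet P (d' x) Q (rotate ω (d' x)) = a at *
    generalize meet P (d' x) M (f' x) = b at *
    generalize meet Q (rotate ω (d' x)) M (f' x) = c at *
    have k3 : cr (c - b) (f' x) = 0 := by
      rw [cr_swap, cr_sub_right]
      rw [cr_sub_right] at k1 k2
      linarith
    -- Since `c - b` is parallel to `f' x`, the relation expresses `orient b c q` through the
    -- position of `q` relative to the line through `M`. The factor `cr f (A - M)` settles on which
    -- side of that line A lies, whatever the sign of `f`.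
    have k4 := cr_plucker (c - b) (q - b) (f' x) (a - b)
    rw [k3, zero_mul, sub_zero] at k4
    have k5 : cr (f' x) (a - b) = cr (f' x) (a - M) := by
      rw [cr_sub_right] at k1 ⊢
      rw [cr_sub_right]
      linarith
    have k6 : cr (q - b) (f' x) = - cr (f' x) (q - M) := by
      rw [cr_swap, cr_sub_right]
      rw [cr_sub_right] at k1
      rw [cr_sub_right]
      linarith
    rw [k5, k6, ← orient_eq_cr, ← orient_eq_cr, orient_rotate a b c] at k4
    have k7 : 0 ≤ orient b c q * (cr f (A - M) * cr (f' x) (a - M)) := by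
      have := mul_nonneg m6.le m4
      linear_combination this - (cr f (A - M)) * k4
    exact nonneg_of_mul_nonneg_left k7 m5
  · intro q hq
    refine (hQ q hq).imp id ?_
    rintro rfl
    filter_upwards [n1] with x m1
    exact (hzero (hne m1).2 (cr_meet_left q (rotate ω (d' x)) M (f' x))
      (cr_meet_right m1)).ge

end SideLines

/-- The direction of the segment with midpoint `M` that connects the line through `P` of direction
`d` to the line through `Q` of direction `d'`. -/
noncomputable def midDir (d d' P Q M : Plane) : Plane :=
  cr d (M - P) • d' - cr (M - Q) d' • d

/-- As `M - A` is half of `x • d + y • d'`, the coefficients `x` and `y` are read off by cross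
products with `d` and `d'`; `P` and `Q` may replace A there, since they lie on its sides. -/
theorem midDir_eq {A B C d d' P Q M : Plane} {x y : ℝ} (hd : cr d d' ≠ 0) (hx : B - A = x • d)
    (hy : C - A = y • d') (hP : cr d (A - P) = 0) (hQ : cr d' (A - Q) = 0)
    (hM : B + C = (2 : ℝ) • M) : C - B = (2 / cr d d') • midDir d d' P Q M := by
  have e0 : M - A = (1 / 2 : ℝ) • (x • d + y • d') := by
    rw [← hx, ← hy]
    have : M = (1 / 2 : ℝ) • (B + C) := by rw [hM, smul_smul]; norm_num
    rw [this]
    apply plane_ext <;> simp <;> ring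
  have e1 : cr d (M - P) = y / 2 * cr d d' := by
    have : M - P = (M - A) + (A - P) := by abel
    rw [this, cr_add_right, hP, e0, cr_smul_right, cr_add_right, cr_smul_right, cr_smul_right,
      cr_self]
    ring
  have e2 : cr (M - Q) d' = x / 2 * cr d d' := by
    have : M - Q = (M - A) + (A - Q) := by abel
    rw [this, cr_add_left, cr_swap (A - Q), hQ, e0, cr_smul_left, cr_add_left, cr_smul_left,
      cr_smul_left, cr_self]
    ring
  have e3 : C - B = y • d' - x • d := by rw [← hx, ← hy]; abel
  rw [e3, midDir, e1, e2]
  apply plane_ext <;> simp <;> field_simp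

theorem orient_midDir {d d' P Q M : Plane} (hd : cr d d' ≠ 0) (h1 : cr d (M - P) ≠ 0)
    (h2 : cr (M - Q) d' ≠ 0) :
    orient (meet P d Q d') (meet P d M (midDir d d' P Q M)) (meet Q d' M (midDir d d' P Q M)) =
      4 * cr d (M - P) * cr (M - Q) d' / cr d d' := by
  set A := meet P d Q d' with hA
  have hP : cr d (A - P) = 0 := cr_meet_left _ _ _ _
  have hQ : cr d' (A - Q) = 0 := cr_meet_right hd
  have g1 : cr d (M - P) = cr d (M - A) := by
    rw [cr_sub_right] at hP ⊢
    rw [cr_sub_right]; linarith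
  have g2 : cr (M - Q) d' = cr (M - A) d' := by
    rw [cr_sub_right] at hQ
    rw [cr_sub_left, cr_sub_left, cr_swap A, cr_swap Q]; linarith
  have hf : midDir d d' P Q M = cr d (M - A) • d' - cr (M - A) d' • d := by
    rw [midDir, g1, g2]
  rw [g1] at h1 ⊢
  rw [g2] at h2 ⊢
  have hM : cr d d' • (M - A) = cr (M - A) d' • d + cr d (M - A) • d' := by
    apply plane_ext <;> simp [cr] <;> ring
  rw [hf]
  generalize hx : cr (M - A) d' = x at *
  generalize hy : cr d (M - A) = y at *
  generalize hz : cr d d' = z at *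
  have hM' : M = A + (x / z) • d + (y / z) • d' := by
    have : M - A = z⁻¹ • (z • (M - A)) := by rw [smul_smul, inv_mul_cancel₀ hd, one_smul]
    rw [hM] at this
    rw [← sub_add_cancel M A, this]
    apply plane_ext <;> simp <;> ring
  have hB : meet P d M (y • d' - x • d) = A + (2 * x / z) • d := by
    apply meet_eq
    · rw [cr_sub_right, cr_smul_right, cr_smul_right, cr_self, hz]; simp [h1, hd]
    · rw [show A + (2 * x / z) • d - P = (A - P) + (2 * x / z) • d by abel, cr_add_right, hP,
        cr_smul_right, cr_self]; simp
    · rw [hM', show A + (2 * x / z) • d - (A + (x / z) • d + (y / z) • d') =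
        (-1 / z) • (y • d' - x • d) by apply plane_ext <;> simp <;> ring, cr_smul_right, cr_self]
      simp
  have hC : meet Q d' M (y • d' - x • d) = A + (2 * y / z) • d' := by
    apply meet_eq
    · rw [cr_sub_right, cr_smul_right, cr_smul_right, cr_self, cr_swap, hz]; simp [h2, hd]
    · rw [show A + (2 * y / z) • d' - Q = (A - Q) + (2 * y / z) • d' by abel, cr_add_right, hQ,
        cr_smul_right, cr_self]; simp
    · rw [hM', show A + (2 * y / z) • d' - (A + (x / z) • d + (y / z) • d') =
        (1 / z) • (y • d' - x • d) by apply plane_ext <;> simp <;> ring, cr_smul_right, cr_self]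
      simp
  rw [hB, hC, orient_eq_cr, add_sub_cancel_left, add_sub_cancel_left, cr_smul_left, cr_smul_right,
    hz]
  field_simp
  ring

theorem tendsto_add_smul_perp (d : Plane) {l : Filter ℝ} {s : ℝ → ℝ} (hs : Tendsto s l (𝓝 0)) :
    Tendsto (fun x => d + s x • perp d) l (𝓝 d) := by
  have := (tendsto_const_nhds (x := d)).add (hs.smul (tendsto_const_nhds (x := perp d)))
  simpa using this

/-- A minimum triangle has a side with more than one point of the set. -/
theorem SideLines.false_of_touch {ω : ℝ} {A B C d P Q M : Plane}
    (hL : SideLines ω A B C d (midDir d (rotate ω d) P Q M) P Q M) {S : Set Plane} (hS : S.Finite)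
    (h : Minimal ω S A B C) (hP : ∀ q ∈ S, 0 < orient A B q ∨ q = P)
    (hQ : ∀ q ∈ S, 0 < orient C A q ∨ q = Q) (hM : ∀ q ∈ S, 0 < orient B C q ∨ q = M) : False := by
  set D : ℝ → Plane := fun x => d + x • perp d with hD
  -- With BC kept bisected by `M`, twice the area is `4 g₁ g₂` over `cr (D x) (rotate ω (D x))`.
  -- Both `g₁` and `g₂` are affine in `x`, while the denominator gains the factor `1 + x²`.
  set g₁ : ℝ → ℝ := fun x => cr (D x) (M - P) with hg₁
  set g₂ : ℝ → ℝ := fun x => cr (M - Q) (rotate ω (D x)) with hg₂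
  have tD : ∀ {l : Filter ℝ} {s : ℝ → ℝ}, Tendsto s l (𝓝 0) →
      Tendsto (fun x => D (s x)) l (𝓝 d) := tendsto_add_smul_perp d
  obtain ⟨n1, n2, n3⟩ := hL.cr_ne
  have hlin1 : ∀ x, g₁ x = g₁ 0 + x * cr (perp d) (M - P) := by
    intro x; simp [hg₁, hD, cr]; ring
  have hlin2 : ∀ x, g₂ x = g₂ 0 + x * cr (M - Q) (rotate ω (perp d)) := by
    intro x; simp [hg₂, hD, cr, rotate, rot]; ring
  have hden : ∀ x, cr (D x) (rotate ω (D x)) = (1 + x ^ 2) * cr d (rotate ω d) := by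
    intro x; simp [hD, cr, rotate, rot, perp]; ring
  have hD0 : D 0 = d := by simp [hD]
  have hg10 : g₁ 0 ≠ 0 := by
    intro h0
    apply n2
    simp only [hg₁, hD0] at h0
    rw [midDir, h0, cr_sub_right, cr_smul_right, cr_smul_right, cr_self]; simp
  have hg20 : g₂ 0 ≠ 0 := by
    intro h0
    apply n3
    simp only [hg₂, hD0] at h0
    rw [midDir, h0, cr_sub_right, cr_smul_right, cr_smul_right, cr_self]; simp
  have c1 : Continuous g₁ := by
    rw [show g₁ = _ from funext hlin1]; fun_prop
  have c2 : Continuous g₂ := by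
    rw [show g₂ = _ from funext hlin2]; fun_prop
  have key : ∀ s : ℝ → ℝ, Tendsto s (𝓝 0) (𝓝 0) → ∀ᶠ x in 𝓝 (0 : ℝ),
      orient A B C ≤ 4 * g₁ (s x) * g₂ (s x) / ((1 + s x ^ 2) * cr d (rotate ω d)) := by
    intro s hs
    have hm : Tendsto (fun x => midDir (D (s x)) (rotate ω (D (s x))) P Q M) (𝓝 0)
        (𝓝 (midDir d (rotate ω d) P Q M)) := by
      have : Continuous fun v => midDir v (rotate ω v) P Q M := by
        unfold midDir cr rotate rot pt; fun_prop
      exact (this.tendsto d).comp (tD hs)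
    have k := hL.eventually_le hS h (tD hs) hm hP hQ fun q hq => (hM q hq).imp id fun he => by
      rw [he]
      exact Eventually.of_forall fun x => by simp [cr]
    have k1 := ((c1.tendsto 0).comp hs).eventually_ne hg10
    have k2 := ((c2.tendsto 0).comp hs).eventually_ne hg20
    filter_upwards [k, k1, k2] with x hx h1 h2
    rw [orient_midDir] at hx
    · rw [← hden]; exact hx
    · rw [hden]; exact mul_ne_zero (by positivity) n1
    · exact h1
    · exact h2
  have h0 : orient A B C = 4 * g₁ 0 * g₂ 0 / cr d (rotate ω d) := by
    obtain ⟨e1, e2, e3⟩ := hL.eq_meet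
    conv_lhs => rw [← e1, ← e2, ← e3]
    simp only [hg₁, hg₂, hD0]
    apply orient_midDir n1
    · simpa only [hg₁, hD0] using hg10
    · simpa only [hg₂, hD0] using hg20
  have tneg : Tendsto (fun x : ℝ => -x) (𝓝 0) (𝓝 0) := by
    simpa using (continuous_neg (G := ℝ)).tendsto 0
  have p1 : ∀ᶠ x in 𝓝 (0 : ℝ), 0 < g₁ x * g₁ (-x) := by
    have : Tendsto (fun x => g₁ x * g₁ (-x)) (𝓝 0) (𝓝 (g₁ 0 * g₁ 0)) :=
      (c1.tendsto 0).mul ((c1.tendsto 0).comp tneg)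
    exact this.eventually_const_lt (mul_self_pos.2 hg10)
  have p2 : ∀ᶠ x in 𝓝 (0 : ℝ), 0 < g₂ x * g₂ (-x) := by
    have : Tendsto (fun x => g₂ x * g₂ (-x)) (𝓝 0) (𝓝 (g₂ 0 * g₂ 0)) :=
      (c2.tendsto 0).mul ((c2.tendsto 0).comp tneg)
    exact this.eventually_const_lt (mul_self_pos.2 hg20)
  have hall := (((key id tendsto_id).and (key _ tneg)).and (p1.and p2)).filter_mono
    (nhdsWithin_le_nhds (s := {0}ᶜ))
  obtain ⟨x, ⟨⟨k1, k2⟩, k3, k4⟩, hx⟩ := (hall.and self_mem_nhdsWithin).exists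
  have hx0 : x ≠ 0 := hx
  have hpos := hL.area
  simp only [id] at k1
  rw [neg_sq] at k2
  have hΔ : orient A B C * cr d (rotate ω d) = 4 * g₁ 0 * g₂ 0 := by rw [h0]; field_simp
  set K := cr d (rotate ω d) with hK
  set Δ := orient A B C with hΔdef
  have q1 : 0 < 1 + x ^ 2 := by positivity
  have e1 : Δ * (1 + x ^ 2) ≤ 4 * g₁ x * g₂ x / K := by
    have : 4 * g₁ x * g₂ x / ((1 + x ^ 2) * K) * (1 + x ^ 2) = 4 * g₁ x * g₂ x / K := by
      field_simp
    rw [← this]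
    exact mul_le_mul_of_nonneg_right k1 q1.le
  have e2 : Δ * (1 + x ^ 2) ≤ 4 * g₁ (-x) * g₂ (-x) / K := by
    have : 4 * g₁ (-x) * g₂ (-x) / ((1 + x ^ 2) * K) * (1 + x ^ 2) =
        4 * g₁ (-x) * g₂ (-x) / K := by
      field_simp
    rw [← this]
    exact mul_le_mul_of_nonneg_right k2 q1.le
  -- Multiply the inequalities for `x` and `-x`. The values of an affine function at `x` and `-x`
  -- have a product of at most the square of its value at 0, so `(1 + x²)²` would have to be at most
  -- 1.
  have e3 := mul_le_mul e1 e2 (by positivity) ((by positivity : 0 ≤ Δ * (1 + x ^ 2)).trans e1)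
  have e4 : g₁ x * g₁ (-x) ≤ g₁ 0 ^ 2 := by
    rw [hlin1 x, hlin1 (-x)]
    nlinarith [sq_nonneg (x * cr (perp d) (M - P))]
  have e5 : g₂ x * g₂ (-x) ≤ g₂ 0 ^ 2 := by
    rw [hlin2 x, hlin2 (-x)]
    nlinarith [sq_nonneg (x * cr (M - Q) (rotate ω (perp d)))]
  have e6 := mul_le_mul e4 e5 k4.le (sq_nonneg _)
  have hK2 : 0 < K ^ 2 := by positivity
  have e7 : 4 * g₁ x * g₂ x / K * (4 * g₁ (-x) * g₂ (-x) / K) =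
      16 * (g₁ x * g₁ (-x) * (g₂ x * g₂ (-x))) / K ^ 2 := by field_simp; ring
  rw [e7, le_div_iff₀ hK2] at e3
  have e8 : Δ ^ 2 * K ^ 2 * (1 + x ^ 2) ^ 2 ≤ Δ ^ 2 * K ^ 2 := by
    have : Δ ^ 2 * K ^ 2 = 16 * (g₁ 0 ^ 2 * g₂ 0 ^ 2) := by
      rw [← mul_pow, hΔ]; ring
    calc _ = Δ * (1 + x ^ 2) * (Δ * (1 + x ^ 2)) * K ^ 2 := by ring
      _ ≤ _ := e3
      _ ≤ 16 * (g₁ 0 ^ 2 * g₂ 0 ^ 2) := by linarith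
      _ = _ := this.symm
  have e9 : 0 < Δ ^ 2 * K ^ 2 := by positivity
  have e10 : 0 < x ^ 2 := by positivity
  nlinarith [mul_pos e9 e10, mul_pos e9 (mul_pos e10 e10)]

end FixedAngleTriangle

/-! ### The candidates for triangles of minimum area -/

namespace FixedAngleTriangle

open Real Filter Topology RealRAM

/-- The zeros of the derivative of `(n₂ t² + n₁ t + n₀)² / ((t² + 1) (t + κ))`. -/
noncomputable def criticalRoot (k : Fin 4) (κ n₂ n₁ n₀ : ℝ) : ℝ :=
  rootOfQuartic k (2 * κ * n₁ - n₀) (4 * κ * n₂ + n₁ - 2 * κ * n₀) (3 * n₂ - 3 * n₀)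
    (2 * κ * n₂ - n₁) n₂

/-- The directions of the side `AB` for which the area of the triangle with sides through `P`, `Q`
and with its third side on the line through `M` of direction `e` is stationary. -/
noncomputable def criticalDir (ω : ℝ) (k : Fin 4) (e P Q M : Plane) : Plane :=
  criticalRoot k (cos ω / sin ω) (cr e (P - M)) (dt e (Q - P) + cos ω / sin ω * cr e (P - Q))
    (cos ω / sin ω * dt e (Q - P) + cr e (Q - M)) • e + perp e

/-- The numerator of the derivative is the nonzero value of the quadratic times the quartic of
`criticalRoot`. That quartic vanishes identically only if the quadratic does, so root extraction
applies. -/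
theorem exists_criticalRoot {κ n₂ n₁ n₀ t K : ℝ} (hκ : t + κ ≠ 0) (hK : K ≠ 0)
    (hN : n₂ * t ^ 2 + n₁ * t + n₀ ≠ 0)
    (hmin : IsLocalMin
      (fun t => (n₂ * t ^ 2 + n₁ * t + n₀) ^ 2 / (K * ((t ^ 2 + 1) * (t + κ)))) t) :
    ∃ k, criticalRoot k κ n₂ n₁ n₀ = t := by
  apply exists_rootOfQuartic_eq
  · rintro ⟨-, -, h2, h3, h4⟩
    apply hN
    subst h4
    have h1 : n₁ = 0 := by linarith
    subst h1
    have h0 : n₀ = 0 := by linarith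
    subst h0
    ring
  · have hid := hasDerivAt_id t
    have d1 : HasDerivAt (fun t : ℝ => n₂ * t ^ 2 + n₁ * t + n₀) (n₂ * (2 * t) + n₁) t := by
      have := (((hid.pow 2).const_mul n₂).add (hid.const_mul n₁)).add_const n₀
      exact this.congr_deriv (by simp)
    have d2 : HasDerivAt (fun t : ℝ => K * ((t ^ 2 + 1) * (t + κ)))
        (K * (2 * t * (t + κ) + (t ^ 2 + 1))) t := by
      have := (((hid.pow 2).add_const 1).mul (hid.add_const κ)).const_mul K
      exact this.congr_deriv (by simp)
    have hD : K * ((t ^ 2 + 1) * (t + κ)) ≠ 0 :=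
      mul_ne_zero hK (mul_ne_zero (by positivity) hκ)
    have d3 := (d1.pow 2).div d2 hD
    have h0 := hmin.hasDerivAt_eq_zero d3
    rw [div_eq_zero_iff] at h0
    have h1 := h0.resolve_right (pow_ne_zero 2 hD)
    have h2 : (n₂ * t ^ 2 + n₁ * t + n₀) * K * (2 * (n₂ * (2 * t) + n₁) * ((t ^ 2 + 1) * (t + κ)) -
        (n₂ * t ^ 2 + n₁ * t + n₀) * (2 * t * (t + κ) + (t ^ 2 + 1))) = 0 := by
      rw [← h1]
      simp only [Pi.pow_apply]
      push_cast
      ring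
    have h3 := (mul_eq_zero.1 h2).resolve_left (mul_ne_zero hN hK)
    rw [← h3]
    ring

theorem cr_smul_add_smul_perp (a b : ℝ) (e v : Plane) :
    cr (a • e + b • perp e) v = a * cr e v - b * dt e v := by
  simp [cr, dt, perp]; ring

/-- The area of a triangle with two sides through `P`, `Q` and with its third side on a given
line. -/
theorem orient_meet {ω t : ℝ} {e P Q M : Plane} (he : e ≠ 0) (hω : sin ω ≠ 0)
    (ht : t + cos ω / sin ω ≠ 0) :
    orient (meet P (t • e + perp e) Q (rotate ω (t • e + perp e)))
      (meet P (t • e + perp e) M e) (meet Q (rotate ω (t • e + perp e)) M e) =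
    (cr e (P - M) * t ^ 2 + (dt e (Q - P) + cos ω / sin ω * cr e (P - Q)) * t +
      (cos ω / sin ω * dt e (Q - P) + cr e (Q - M))) ^ 2 /
      (dt e e * ((t ^ 2 + 1) * (t + cos ω / sin ω))) := by
  set κ := cos ω / sin ω with hκ
  have hE := (dt_self_pos he).ne'
  set E := dt e e with hEdef
  have hκ' : cos ω = κ * sin ω := by rw [hκ]; field_simp
  -- In the orthogonal basis `e`, `perp e`, with κ the cotangent of ω, both sides at A have
  -- directions that are affine in `t`.
  have hR : rotate ω (t • e + perp e) = sin ω • ((t * κ - 1) • e + (t + κ) • perp e) := by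
    apply plane_ext <;> simp [rotate, rot, perp, hκ'] <;> ring
  have hd : t • e + perp e = t • e + (1 : ℝ) • perp e := by simp
  have eQP : dt e (Q - P) = dt e (Q - M) - dt e (P - M) := by simp [dt]; ring
  have ePQ : cr e (P - Q) = cr e (P - M) - cr e (Q - M) := by simp [cr]; ring
  rw [hR, hd, eQP, ePQ]
  set w := (t * κ - 1) • e + (t + κ) • perp e with hw
  set d := t • e + (1 : ℝ) • perp e with hd'
  have crd : ∀ v, cr d v = t * cr e v - dt e v := by
    intro v; rw [hd', cr_smul_add_smul_perp]; ring
  have crw : ∀ v, cr w v = (t * κ - 1) * cr e v - (t + κ) * dt e v := by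
    intro v; rw [hw, cr_smul_add_smul_perp]
  have cee : cr e e = 0 := cr_self e
  have hdtd : dt e d = t * E := by simp [hd', hEdef, dt, perp]; ring
  have hcrd : cr e d = E := by simp [hd', hEdef, cr, dt, perp]; ring
  have hdtw : dt e w = (t * κ - 1) * E := by simp [hw, hEdef, dt, perp]; ring
  have hcrw : cr e w = (t + κ) * E := by simp [hw, hEdef, cr, dt, perp]; ring
  have dadd : ∀ v z, dt e (v + z) = dt e v + dt e z := by intro v z; simp [dt]; ring
  have dsub : ∀ v z, dt e (v - z) = dt e v - dt e z := by intro v z; simp [dt]; ring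
  have dsmul : ∀ (x : ℝ) v, dt e (x • v) = x * dt e v := by intro x v; simp [dt]; ring
  set yP := cr e (P - M) with hyP
  set yQ := cr e (Q - M) with hyQ
  set xP := dt e (P - M) with hxP
  set xQ := dt e (Q - M) with hxQ
  -- `H` is proportional to the height of the apex over the fixed line, and `b` and `c` below are
  -- the positions of B and C on that line. The length of the base is proportional to `H` as well,
  -- whence the square.
  set H := (yP * t ^ 2 + (xQ - xP + κ * (yP - yQ)) * t + (κ * (xQ - xP) + yQ)) / (t ^ 2 + 1)
    with hH
  have ht1 : t ^ 2 + 1 ≠ 0 := by positivity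
  set b := (xP - t * yP) / E with hb
  set c := (xQ + yQ * (1 - κ * t) / (t + κ)) / E with hc
  have hB : meet P d M e = M + b • e := by
    apply meet_eq
    · rw [crd, cee, ← hEdef]; simpa using hE
    · rw [show M + b • e - P = b • e - (P - M) by abel, crd, cr_sub_right, dsub, cr_smul_right,
        dsmul, cee, ← hEdef, ← hyP, ← hxP, hb]
      field_simp
      ring
    · rw [add_sub_cancel_left, cr_smul_right, cee, mul_zero]
  have hC : meet Q (sin ω • w) M e = M + c • e := by
    apply meet_eq
    · rw [cr_smul_left, crw, cee, ← hEdef]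
      have := mul_ne_zero hω (mul_ne_zero ht hE)
      simpa using this
    · rw [show M + c • e - Q = c • e - (Q - M) by abel, cr_smul_left, crw, cr_sub_right, dsub,
        cr_smul_right, dsmul, cee, ← hEdef, ← hyQ, ← hxQ, hc]
      field_simp
      ring
    · rw [add_sub_cancel_left, cr_smul_right, cee, mul_zero]
  have hA : meet P d Q (sin ω • w) = M + b • e + (H / E) • d := by
    apply meet_eq
    · rw [cr_smul_right, crd, hcrw, hdtw]
      have : sin ω * (t * ((t + κ) * E) - (t * κ - 1) * E) = sin ω * ((t ^ 2 + 1) * E) := by ring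
      rw [this]
      exact mul_ne_zero hω (mul_ne_zero ht1 hE)
    · rw [show M + b • e + (H / E) • d - P = b • e + (H / E) • d - (P - M) by abel, crd,
        cr_sub_right, dsub, cr_add_right, dadd, cr_smul_right, cr_smul_right,
        dsmul, dsmul, cee, ← hEdef, ← hyP, ← hxP, hcrd, hdtd, hb]
      field_simp
      ring
    · rw [show M + b • e + (H / E) • d - Q = b • e + (H / E) • d - (Q - M) by abel, cr_smul_left,
        crw, cr_sub_right, dsub, cr_add_right, dadd, cr_smul_right, cr_smul_right,
        dsmul, dsmul, cee, ← hEdef, ← hyQ, ← hxQ, hcrd, hdtd, hb, hH]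
      field_simp
      ring
  rw [hA, hB, hC]
  have hor : ∀ a : Plane, orient (M + b • e + a) (M + b • e) (M + c • e) = (c - b) * cr e a := by
    intro a; simp [orient, cr]; ring
  rw [hor, cr_smul_right, hcrd, hH, hb, hc]
  field_simp
  ring

/-- Keep the line of BC and turn the other two sides around their single contacts. The triangles
stay admissible for nearby directions, so the rational function of `orient_meet` has a local minimum
at `t`. -/
theorem SideLines.exists_criticalRoot {ω t : ℝ} {A B C e P Q M : Plane}
    (hL : SideLines ω A B C (t • e + perp e) e P Q M) (hω : sin ω ≠ 0) {S : Set Plane}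
    (hS : S.Finite) (h : Minimal ω S A B C) (hP : ∀ q ∈ S, 0 < orient A B q ∨ q = P)
    (hQ : ∀ q ∈ S, 0 < orient C A q ∨ q = Q) :
    ∃ k, criticalDir ω k e P Q M = t • e + perp e := by
  obtain ⟨n1, n2, n3⟩ := hL.cr_ne
  have he : e ≠ 0 := by rintro rfl; simp [cr] at n2
  have hE := (dt_self_pos he).ne'
  have ht : t + cos ω / sin ω ≠ 0 := by
    intro h0
    apply n3
    have : cr (rotate ω (t • e + perp e)) e = -(sin ω * (t + cos ω / sin ω) * dt e e) := by
      simp [rotate, rot, cr, dt, perp]; field_simp; ring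
    rw [this, h0]; simp
  obtain ⟨e1, e2, e3⟩ := hL.eq_meet
  have h0 := orient_meet (P := P) (Q := Q) (M := M) he hω ht
  rw [e1, e2, e3] at h0
  obtain ⟨z, hz⟩ := hL.bc
  obtain ⟨-, -, -, -, hBM, -⟩ := hL.cr_eq
  have hbc : ∀ q, orient B C q = z * cr e (q - M) := by
    intro q
    rw [orient_eq_cr, hz, cr_smul_left, cr_sub_right, cr_sub_right]
    rw [cr_sub_right] at hBM
    rw [sub_eq_zero.1 hBM]
  have hz0 : z ≠ 0 := by
    rintro rfl
    have := hL.area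
    rw [← orient_rotate, hbc] at this
    simp at this
  have key := hL.eventually_le hS h (l := 𝓝 t) (d' := fun x => x • e + perp e) (f' := fun _ => e)
    (by
      have : Continuous fun x : ℝ => x • e + perp e := by fun_prop
      exact this.tendsto t) tendsto_const_nhds hP hQ (fun q hq => Or.inr (Eventually.of_forall
        fun _ => by
          have h1 := (h.1.2 q hq).2.1
          have h2 := hL.area
          rw [← orient_rotate] at h2
          rw [hbc] at h1 h2
          have h3 := mul_nonneg h2.le h1
          have h4 : 0 < z ^ 2 := by positivity
          refine nonneg_of_mul_nonneg_right (a := z ^ 2) ?_ h4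
          linarith))
  have hcont : ∀ᶠ x in 𝓝 t, x + cos ω / sin ω ≠ 0 := by
    have : Continuous fun x : ℝ => x + cos ω / sin ω := by fun_prop
    exact (this.tendsto t).eventually_ne ht
  obtain ⟨k, hk⟩ := FixedAngleTriangle.exists_criticalRoot ht hE
    (n₂ := cr e (P - M)) (n₁ := dt e (Q - P) + cos ω / sin ω * cr e (P - Q))
    (n₀ := cos ω / sin ω * dt e (Q - P) + cr e (Q - M))
    (by
      intro hN
      have := hL.area
      rw [h0, hN] at this
      simp at this)
    (by
      filter_upwards [key, hcont] with x h1 h2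
      rw [orient_meet he hω h2] at h1
      rw [← h0]
      exact h1)
  exact ⟨k, by rw [criticalDir, hk]⟩

/-- The directions `d` of the side `AB` and `f` of the side `BC` of the candidates that touch the
polygon at the vertices number `i`, `j`, `k`. -/
def IsCandidate (ω : ℝ) (p : ℕ → Plane) (i j k : ℕ) (d f : Plane) : Prop :=
  ((d = p i - p (i - 1) ∨ d = rot (cos ω) (-sin ω) (p j - p (j - 1))) ∧
    (f = p (k + 1) - p k ∨ f = midDir d (rotate ω d) (p i) (p j) (p k))) ∨
  ∃ r, d = criticalDir ω r (p (k + 1) - p k) (p i) (p j) (p k) ∧ f = p (k + 1) - p k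

end FixedAngleTriangle

/-! ### Every minimum triangle is a candidate -/

namespace FixedAngleTriangle

open Real

theorem orient_of_sub_eq {X Y : Plane} {x θ : ℝ} (h : Y - X = x • unit θ) (q : Plane) :
    orient X Y q = x * (cr (unit θ) q - cr (unit θ) X) := by
  rw [orient_eq_cr, h, cr_smul_left, cr_sub_right]

/-- The directions of the sides of a triangle with the angle `ω`. -/
theorem IsAngleTriangle.exists_directions {ω : ℝ} (h0 : 0 < ω) (hπ : ω < π) {A B C : Plane}
    (h : IsAngleTriangle ω A B C) (a : ℝ) :
    ∃ φ ψ b c z : ℝ, a ≤ φ ∧ φ < a + 2 * π ∧ φ + ω < ψ ∧ ψ < φ + π ∧ 0 < b ∧ 0 < c ∧ 0 < z ∧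
      B - A = b • unit φ ∧ C - A = c • unit (φ + ω) ∧ C - B = z • unit ψ := by
  obtain ⟨hpos, hang⟩ := h
  have hs : 0 < sin ω := sin_pos_of_pos_of_lt_pi h0 hπ
  have hBA : B - A ≠ 0 := by
    intro he
    rw [orient_eq_cr, he] at hpos
    simp [cr] at hpos
  have hCB : C - B ≠ 0 := by
    intro he
    rw [sub_eq_zero] at he
    subst he
    have : orient A C C = 0 := by simp only [orient]; ring
    linarith
  obtain ⟨b, φ, hb, h1, h2, hB⟩ := exists_smul_unit hBA a
  obtain ⟨z, ψ, hz, h3, h4, hC⟩ := exists_smul_unit hCB φ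
  have hor : orient A B C = b * cr (unit φ) (C - A) := by rw [orient_eq_cr, hB, cr_smul_left]
  have hdt : dt (B - A) (C - A) = b * dt (unit φ) (C - A) := by
    rw [hB]; simp [dt]; ring
  set c := cr (unit φ) (C - A) / sin ω with hc
  have hcpos : 0 < c := by
    rw [hor] at hpos
    exact div_pos ((pos_iff_pos_of_mul_pos hpos).1 hb) hs
  have hdt' : dt (unit φ) (C - A) = c * cos ω := by
    rw [hor, hdt] at hang
    rw [hc]
    field_simp
    have : b * (dt (unit φ) (C - A) * sin ω) = b * (cr (unit φ) (C - A) * cos ω) := by linarith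
    exact mul_left_cancel₀ hb.ne' this
  have hcr' : cr (unit φ) (C - A) = c * sin ω := by rw [hc]; field_simp
  have hC' : C - A = c • unit (φ + ω) := by
    have e1 : (C - A) 0 = dt (unit φ) (C - A) * cos φ - cr (unit φ) (C - A) * sin φ := by
      simp only [dt, cr, unit, pt_zero, pt_one]
      linear_combination -((C - A) 0) * sin_sq_add_cos_sq φ
    have e2 : (C - A) 1 = dt (unit φ) (C - A) * sin φ + cr (unit φ) (C - A) * cos φ := by
      simp only [dt, cr, unit, pt_zero, pt_one]
      linear_combination -((C - A) 1) * sin_sq_add_cos_sq φ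
    rw [hdt', hcr'] at e1 e2
    apply plane_ext
    · rw [e1]; simp only [PiLp.smul_apply, smul_eq_mul, unit, pt_zero, cos_add]; ring
    · rw [e2]; simp only [PiLp.smul_apply, smul_eq_mul, unit, pt_one, sin_add]; ring
  have hs1 : 0 < sin (ψ - φ) := by
    have : orient A B C = b * z * sin (ψ - φ) := by
      rw [show orient A B C = cr (B - A) (C - B) by
        simp only [orient, cr, PiLp.sub_apply]; ring, hB, hC, cr_smul_left, cr_smul_right,
        cr_unit_unit]
      ring
    rw [this] at hpos
    exact (pos_iff_pos_of_mul_pos hpos).1 (mul_pos hb hz)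
  have hs2 : 0 < sin (ψ - (φ + ω)) := by
    have : orient A B C = c * z * sin (ψ - (φ + ω)) := by
      rw [show orient A B C = cr (C - A) (C - B) by
        simp only [orient, cr, PiLp.sub_apply]; ring, hC', hC, cr_smul_left, cr_smul_right,
        cr_unit_unit]
      ring
    rw [this] at hpos
    exact (pos_iff_pos_of_mul_pos hpos).1 (mul_pos hcpos hz)
  have h5 : ψ < φ + π := by
    by_contra hge
    have : 0 ≤ sin (ψ - φ - π) := sin_nonneg_of_nonneg_of_le_pi (by linarith) (by linarith)
    rw [sin_sub_pi] at this
    linarith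
  refine ⟨φ, ψ, b, c, z, h1, h2, ?_, h5, hb, hcpos, hz, hB, hC', hC⟩
  by_contra hge
  have := sin_nonpos_of_nonpos_of_neg_pi_le (x := ψ - (φ + ω)) (by linarith) (by linarith)
  linarith

/-- The barycentric coordinates of `q` are 0, 1/2 and 1/2. -/
theorem add_eq_two_smul {A B C q : Plane} (h : 0 < orient A B C) (h1 : orient B C q = 0)
    (h2 : orient A B q = orient C A q) : B + C = (2 : ℝ) • q := by
  have key : ∀ c : Fin 2, orient A B C * q c =
      orient B C q * A c + orient C A q * B c + orient A B q * C c := by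
    intro c; fin_cases c <;> simp [orient] <;> ring
  have h3 := orient_add_orient A B C q
  have h4 : orient A B q = orient A B C / 2 := by linarith
  rw [h1, ← h2, h4] at key
  have h5 : ∀ c : Fin 2, B c + C c = 2 * q c := by
    intro c
    have : orient A B C * (2 * q c - (B c + C c)) = 0 := by linear_combination 2 * key c
    linarith [(mul_eq_zero.1 this).resolve_left h.ne']
  exact plane_ext (by simpa using h5 0) (by simpa using h5 1)

theorem finite_range_of_isPolygon {N : ℕ} {p : ℕ → Plane} (hP : IsPolygon N p) :
    (Set.range p).Finite := by
  have := hP.three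
  refine ((Finset.range N).finite_toSet.image p).subset ?_
  rintro _ ⟨m, rfl⟩
  exact ⟨m % N, by simpa using Nat.mod_lt _ (by omega), hP.congr (Nat.mod_modEq m N)⟩

/-- Every triangle of minimum area is among the candidates. -/
theorem Minimal.exists_candidate {N : ℕ} {p : ℕ → Plane} {α r : ℕ → ℝ} (hα : IsLift N p α r)
    (hP : IsPolygon N p) {ω : ℝ} (h0 : 0 < ω) (hπ : ω < π) {A B C : Plane}
    (h : Minimal ω (Set.range p) A B C) (m₀ : ℕ) :
    ∃ φ i j k, α m₀ ≤ φ ∧ φ < α m₀ + 2 * π ∧ α i ≤ φ ∧ φ < α (i + 1) ∧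
      α j ≤ φ + ω + π ∧ φ + ω + π < α (j + 1) ∧ IsBase ω p α φ k ∧
      ∃ d f, IsCandidate ω p (i + 1) (j + 1) k d f ∧
        SideLines ω A B C d f (p (i + 1)) (p (j + 1)) (p k) := by
  have hS := finite_range_of_isPolygon hP
  have hs : 0 < sin ω := sin_pos_of_pos_of_lt_pi h0 hπ
  obtain ⟨φ, ψ, b, c, z, hφ1, hφ2, hψ1, hψ2, hb, hc, hz, hB, hC, hCB⟩ :=
    h.1.1.exists_directions h0 hπ (α m₀)
  have hA : A - C = c • unit (φ + ω + π) := by rw [unit_add_pi, smul_neg, ← hC]; abel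
  obtain ⟨i, -, hi1, hi2⟩ := hα.exists_index hφ1
  obtain ⟨j, -, hj1, hj2⟩ := hα.exists_index (show α m₀ ≤ φ + ω + π by linarith)
  obtain ⟨m, -, hm1, hm2⟩ := hα.exists_index (show α m₀ ≤ ψ by linarith)
  have ci := hα.contact hP hi1 hi2.le
  have cj := hα.contact hP hj1 hj2.le
  have cm := hα.contact hP hm1 hm2.le
  obtain ⟨⟨_, ⟨l1, rfl⟩, t1⟩, ⟨_, ⟨l2, rfl⟩, t2⟩, ⟨_, ⟨l3, rfl⟩, t3⟩⟩ := h.exists_touch hS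
  have inside := fun q => h.1.2 (p q) ⟨q, rfl⟩
  have hpos := h.1.1.1
  have touch : ∀ {X Y : Plane} {x θ : ℝ} {l l' : ℕ}, 0 < x → Y - X = x • unit θ →
      0 ≤ orient X Y (p l') → orient X Y (p l) = 0 →
      (∀ l, cr (unit θ) (p l') ≤ cr (unit θ) (p l)) → orient X Y (p l') = 0 := by
    intro X Y x θ l l' hx hXY h1 h2 h3
    refine le_antisymm ?_ h1
    rw [← h2, orient_of_sub_eq hXY, orient_of_sub_eq hXY]
    exact mul_le_mul_of_nonneg_left (by linarith [h3 l]) hx.le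
  have oi := touch hb hB (inside (i + 1)).1 t1 ci
  have oj := touch hc hA (inside (j + 1)).2.2 t3 cj
  have om := touch hz hCB (inside (m + 1)).2.1 t2 cm
  have strict : ∀ {X Y : Plane} {x θ : ℝ} {l : ℕ}, 0 < x → Y - X = x • unit θ → α l < θ →
      θ < α (l + 1) → orient X Y (p (l + 1)) = 0 →
      ∀ q ∈ Set.range p, 0 < orient X Y q ∨ q = p (l + 1) := by
    rintro X Y x θ l hx hXY h1 h2 h3 _ ⟨q, rfl⟩
    by_cases hq : q ≡ l + 1 [MOD N]
    · exact Or.inr (hP.congr hq)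
    · left
      rw [← h3, orient_of_sub_eq hXY, orient_of_sub_eq hXY]
      exact mul_lt_mul_of_pos_left (by linarith [hα.contact_lt hP h1 h2 hq]) hx
  have w1 : ∀ q, width p φ q = orient A B q / b := by
    intro q
    rw [width_eq ci, eq_div_iff hb.ne', ← sub_zero (orient A B q), ← oi, orient_of_sub_eq hB,
      orient_of_sub_eq hB, cr_sub_right]
    ring
  have w2 : ∀ q, width p (φ + ω + π) q = orient C A q / c := by
    intro q
    rw [width_eq cj, eq_div_iff hc.ne', ← sub_zero (orient C A q), ← oj, orient_of_sub_eq hA,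
      orient_of_sub_eq hA, cr_sub_right]
    ring
  have s1 : sin (ψ - φ) = orient A B C / (b * z) := by
    rw [show orient A B C = cr (B - A) (C - B) by
        simp only [orient, cr, PiLp.sub_apply]; ring, hB, hCB, cr_smul_left, cr_smul_right,
        cr_unit_unit]
    field_simp
  have s2 : sin (ψ - (φ + ω)) = orient A B C / (c * z) := by
    rw [show orient A B C = cr (C - A) (C - B) by
        simp only [orient, cr, PiLp.sub_apply]; ring, hC, hCB, cr_smul_left, cr_smul_right,
        cr_unit_unit]
    field_simp
  have hK : 0 < orient A B C / (b * c * z) := by positivity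
  -- With `v2`, this turns the inequalities of `IsBase` into comparisons of barycentric coordinates,
  -- up to one common positive factor.
  have v1 : ∀ q, width p φ q * sin (ψ - (φ + ω)) =
      orient A B q * (orient A B C / (b * c * z)) := by
    intro q; rw [w1, s2]; field_simp
  have v2 : ∀ q, width p (φ + ω + π) q * sin (ψ - φ) =
      orient C A q * (orient A B C / (b * c * z)) := by
    intro q; rw [w2, s1]; field_simp
  obtain ⟨⟨_, ⟨q1, rfl⟩, m1, m2⟩, ⟨_, ⟨q2, rfl⟩, m3, m4⟩⟩ := h.exists_touch_midpoint hS
  have hflushA : ∀ {d : Plane}, (α i = φ ∧ d = p (i + 1) - p i) ∨ (α j = φ + ω + π ∧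
      d = rot (cos ω) (-sin ω) (p (j + 1) - p j)) → ∃ x : ℝ, unit φ = x • d := by
    rintro d (⟨he, rfl⟩ | ⟨he, rfl⟩)
    · have := (hα.pos i).ne'
      refine ⟨(r i)⁻¹, ?_⟩
      rw [hα.edge, he, smul_smul, inv_mul_cancel₀ this, one_smul]
    · have := (hα.pos j).ne'
      refine ⟨-(r j)⁻¹, ?_⟩
      have e1 : rot (cos ω) (-sin ω) (unit (φ + ω + π)) = - unit φ := by
        rw [← cos_neg, ← sin_neg, rot_unit, ← unit_add_pi]
        congr 1; ring
      rw [hα.edge, he, rot_smul, smul_smul, e1]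
      simp [this]
  have dirs : ∀ {d : Plane} {x : ℝ}, unit φ = x • d → (∃ x : ℝ, B - A = x • d) ∧
      ∃ x : ℝ, C - A = x • rotate ω d := by
    intro d x hd
    refine ⟨⟨b * x, by rw [hB, hd, smul_smul]⟩, ⟨c * x, ?_⟩⟩
    rw [hC, ← rot_unit, hd, rot_smul, smul_smul]
  -- Either BC contains the edge `m`, or it touches only the vertex `m + 1`.
  rcases hm1.eq_or_lt with hm | hm
  · have hxm : ∀ q, orient B C (p q) = 0 → q ≡ m [MOD N] ∨ q ≡ m + 1 [MOD N] := by
      intro q hq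
      by_contra! hne
      have := hα.contact_edge hP hne.1 hne.2
      rw [hm] at this
      rw [← om, orient_of_sub_eq hCB, orient_of_sub_eq hCB] at hq
      have := mul_left_cancel₀ hz.ne' hq
      linarith
    have om' : orient B C (p m) = 0 := by
      have := hα.cr_edge ψ m
      rw [hm, sub_self, sin_zero, mul_zero] at this
      rw [← om, orient_of_sub_eq hCB, orient_of_sub_eq hCB]
      rw [sub_eq_zero.1 this]
    have hlt : orient A B (p m) ≤ orient A B (p (m + 1)) := by
      have := hα.cr_edge φ m
      have h2 : 0 ≤ sin (ψ - φ) := by rw [s1]; positivity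
      rw [hm] at this
      have := mul_nonneg (hα.pos m).le h2
      rw [orient_of_sub_eq hB, orient_of_sub_eq hB]
      exact mul_le_mul_of_nonneg_left (by linarith) hb.le
    have sum1 := orient_add_orient A B C (p m)
    have sum2 := orient_add_orient A B C (p (m + 1))
    have low : orient A B (p m) ≤ orient C A (p m) := by
      rcases hxm q1 m1 with hq | hq
      · rwa [hP.congr hq] at m2
      · rw [hP.congr hq] at m2
        linarith
    have high : orient C A (p (m + 1)) ≤ orient A B (p (m + 1)) := by
      rcases hxm q2 m3 with hq | hq
      · rw [hP.congr hq] at m4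
        linarith
      · rwa [hP.congr hq] at m4
    have hf : ∃ x : ℝ, C - B = x • (p (m + 1) - p m) := by
      have := (hα.pos m).ne'
      refine ⟨z * (r m)⁻¹, ?_⟩
      rw [hCB, hα.edge, hm, smul_smul, mul_assoc, inv_mul_cancel₀ this, mul_one]
    refine ⟨φ, i, j, m, hφ1, hφ2, hi1, hi2, hj1, hj2, ⟨ψ, hψ1, hψ2,
      fun l hl => hm ▸ hα.strictMono hl, hm.ge, ?_, ?_, Or.inl ⟨hm.symm, ?_⟩⟩, ?_⟩
    · rw [w2]
      exact div_pos (by linarith) hc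
    · rw [v1, v2]
      exact mul_le_mul_of_nonneg_right low hK.le
    · rw [v1, v2]
      exact mul_le_mul_of_nonneg_right high hK.le
    by_cases hfl : α i = φ ∨ α j = φ + ω + π
    · rcases hfl with he | he
      · obtain ⟨x, hx⟩ := hflushA (Or.inl ⟨he, rfl⟩)
        exact ⟨_, _, Or.inl ⟨Or.inl rfl, Or.inl rfl⟩,
          ⟨hpos, (dirs hx).1, (dirs hx).2, hf, oi, oj, om'⟩⟩
      · obtain ⟨x, hx⟩ := hflushA (Or.inr ⟨he, rfl⟩)
        exact ⟨_, _, Or.inl ⟨Or.inr rfl, Or.inl rfl⟩,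
          ⟨hpos, (dirs hx).1, (dirs hx).2, hf, oi, oj, om'⟩⟩
    -- Only BC contains an edge, so the direction of AB is a critical one.
    · push Not at hfl
      set e := p (m + 1) - p m with he
      have he' : e = r m • unit ψ := by rw [he, hα.edge, hm]
      have hcr : cr e (unit φ) ≠ 0 := by
        rw [he', cr_smul_left, cr_unit_unit, ← neg_sub, sin_neg, s1]
        have := hα.pos m
        exact mul_ne_zero this.ne' (neg_ne_zero.2 (by positivity))
      have he0 : e ≠ 0 := by
        intro h0
        rw [h0] at hcr
        simp [cr] at hcr
      have hE := (dt_self_pos he0).ne'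
      have hx : unit φ = (cr e (unit φ) / dt e e) •
          ((dt e (unit φ) / cr e (unit φ)) • e + perp e) := by
        apply plane_ext <;> simp [perp] <;> field_simp <;> simp [dt, cr] <;> ring
      have hL : SideLines ω A B C ((dt e (unit φ) / cr e (unit φ)) • e + perp e) e (p (i + 1))
          (p (j + 1)) (p m) :=
        ⟨hpos, (dirs hx).1, (dirs hx).2, hf, oi, oj, om'⟩
      obtain ⟨k, hk⟩ := hL.exists_criticalRoot hs.ne' hS h
        (strict hb hB (lt_of_le_of_ne hi1 hfl.1) hi2 oi)
        (strict hc hA (lt_of_le_of_ne hj1 hfl.2) hj2 oj)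
      exact ⟨_, _, Or.inr ⟨k, rfl, rfl⟩, by rw [hk]; exact hL⟩
  -- The contacts on both sides of the midpoint coincide with this vertex, which is therefore the
  -- midpoint.
  · have ones : ∀ q, orient B C (p q) = 0 → p q = p (m + 1) := fun q hq =>
      (strict hz hCB hm hm2 om _ ⟨q, rfl⟩).resolve_left (by rw [hq]; exact lt_irrefl 0)
    rw [ones q1 m1] at m2
    rw [ones q2 m3] at m4
    have sum := orient_add_orient A B C (p (m + 1))
    have mid := add_eq_two_smul hpos om (le_antisymm m2 m4)
    refine ⟨φ, i, j, m + 1, hφ1, hφ2, hi1, hi2, hj1, hj2, ⟨ψ, hψ1, hψ2, fun l hl =>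
      (hα.strictMono.monotone (Nat.le_of_lt_succ hl)).trans_lt hm, hm2.le, ?_, ?_, Or.inr ?_⟩, ?_⟩
    · rw [w2]
      exact div_pos (by linarith) hc
    · rw [v1, v2]
      exact mul_le_mul_of_nonneg_right m2 hK.le
    · rw [v1, v2]
      exact mul_le_mul_of_nonneg_right m4 hK.le
    have lines : ∀ {d : Plane} {x : ℝ}, unit φ = x • d → SideLines ω A B C d
        (midDir d (rotate ω d) (p (i + 1)) (p (j + 1)) (p (m + 1))) (p (i + 1)) (p (j + 1))
        (p (m + 1)) := by
      intro d x hx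
      obtain ⟨⟨y, hy⟩, ⟨y', hy'⟩⟩ := dirs hx
      have hd0 : orient A B C = y * (y' * cr d (rotate ω d)) := by
        rw [orient_eq_cr, hy, hy', cr_smul_left, cr_smul_right]
      have hy0 : y ≠ 0 := by rintro rfl; rw [hd0] at hpos; simp at hpos
      have hy0' : y' ≠ 0 := by rintro rfl; rw [hd0] at hpos; simp at hpos
      have hcr0 : cr d (rotate ω d) ≠ 0 := by
        intro h0; rw [hd0, h0] at hpos; simp at hpos
      refine ⟨hpos, ⟨y, hy⟩, ⟨y', hy'⟩, ⟨_, midDir_eq hcr0 hy hy' ?_ ?_ mid⟩, oi, oj, om⟩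
      · have := oi
        rw [orient_eq_cr, hy, cr_smul_left] at this
        have := (mul_eq_zero.1 this).resolve_left hy0
        rw [cr_sub_right] at this ⊢
        linarith
      · have : orient A C (p (j + 1)) = 0 := by
          have := oj
          simp only [orient] at this ⊢
          linarith
        rw [orient_eq_cr, hy', cr_smul_left] at this
        have := (mul_eq_zero.1 this).resolve_left hy0'
        rw [cr_sub_right] at this ⊢
        linarith
    by_cases hfl : α i = φ ∨ α j = φ + ω + π
    · rcases hfl with he | he
      · obtain ⟨x, hx⟩ := hflushA (Or.inl ⟨he, rfl⟩)
        exact ⟨_, _, Or.inl ⟨Or.inl rfl, Or.inr rfl⟩, lines hx⟩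
      · obtain ⟨x, hx⟩ := hflushA (Or.inr ⟨he, rfl⟩)
        exact ⟨_, _, Or.inl ⟨Or.inr rfl, Or.inr rfl⟩, lines hx⟩
    -- No side contains an edge, which has been excluded.
    · push Not at hfl
      exact ((lines (one_smul ℝ (unit φ)).symm).false_of_touch hS h
        (strict hb hB (lt_of_le_of_ne hi1 hfl.1) hi2 oi)
        (strict hc hA (lt_of_le_of_ne hj1 hfl.2) hj2 oj) (strict hz hCB hm hm2 om)).elim

end FixedAngleTriangle

/-! ### Existence and non-existence of triangles of minimum area -/

namespace FixedAngleTriangle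

open Real

/-- In the oblique coordinates with axes of directions 0 and ω, the points satisfy `|x| + |y| ≤ M`.
The triangle with `-M ≤ x`, `-M ≤ y` and `x + y ≤ 2 M` contains them. -/
theorem exists_admissible {ω : ℝ} (h0 : 0 < ω) (hπ : ω < π) {S : Set Plane} (hS : S.Finite) :
    ∃ A B C, Admissible ω S A B C := by
  have hs : 0 < sin ω := sin_pos_of_pos_of_lt_pi h0 hπ
  set d := unit 0 with hd
  set w := unit (0 + ω) with hw
  have hdw : cr d w = sin ω := by rw [hd, hw, cr_unit_unit]; congr 1; ring
  obtain ⟨K, hK⟩ := (hS.image fun q => |cr d q| + |cr q w|).bddAbove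
  obtain ⟨M, hM0, hM⟩ : ∃ M : ℝ, 0 < M ∧ ∀ q ∈ S, |cr d q| + |cr q w| ≤ M * sin ω := by
    refine ⟨max 1 (K / sin ω), by positivity, fun q hq => (hK ⟨q, hq, rfl⟩).trans ?_⟩
    rw [← div_le_iff₀ hs]
    exact le_max_right _ _
  set A := (-M) • (d + w) with hA
  set B := A + (4 * M) • d with hB
  set C := A + (4 * M) • w with hC
  have e0 : orient A B C = 16 * M ^ 2 * sin ω := by
    rw [orient_eq_cr, hB, hC, add_sub_cancel_left, add_sub_cancel_left, cr_smul_left,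
      cr_smul_right, hdw]
    ring
  have e1 : ∀ q, orient A B q = 4 * M * (cr d q + M * sin ω) := by
    intro q
    rw [orient_eq_cr, hB, add_sub_cancel_left, cr_smul_left, cr_sub_right, hA, cr_smul_right,
      cr_add_right, cr_self, hdw]
    ring
  have e2 : ∀ q, orient C A q = 4 * M * (cr q w + M * sin ω) := by
    intro q
    have : orient C A q = - cr (C - A) (q - A) := by simp only [orient, cr, PiLp.sub_apply]; ring
    rw [this, hC, add_sub_cancel_left, cr_smul_left, cr_sub_right, hA, cr_smul_right,
      cr_add_right, cr_self, cr_swap w d, hdw, cr_swap w q]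
    ring
  refine ⟨A, B, C, ⟨by rw [e0]; positivity, ?_⟩, fun q hq => ?_⟩
  · have : dt (B - A) (C - A) = 16 * M ^ 2 * cos ω := by
      rw [hB, hC, add_sub_cancel_left, add_sub_cancel_left, hd, hw]
      simp [dt, unit]
      ring
    rw [this, e0]; ring
  · have hq' := hM q hq
    have a1 := abs_le.1 (le_refl |cr d q|)
    have a2 := abs_le.1 (le_refl |cr q w|)
    have a3 := abs_nonneg (cr d q)
    have a4 := abs_nonneg (cr q w)
    have e3 := orient_add_orient A B C q
    have e4 : orient B C q = 4 * M * (2 * (M * sin ω) - (cr d q + cr q w)) := by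
      rw [e0, e1, e2] at e3
      linear_combination e3
    rw [e1, e2, e4]
    refine ⟨mul_nonneg (by positivity) (by linarith), mul_nonneg (by positivity) ?_,
      mul_nonneg (by positivity) (by linarith)⟩
    have := mul_pos hM0 hs
    linarith

/-- The signed area is affine in each of the three points separately, so its maximum is attained at
vertices. -/
theorem orient_le_of_mem {A B C x y z : Plane} (h : 0 < orient A B C)
    (hx : x ∈ convexHull ℝ {A, B, C}) (hy : y ∈ convexHull ℝ {A, B, C})
    (hz : z ∈ convexHull ℝ {A, B, C}) : orient x y z ≤ orient A B C := by
  have aux : ∀ y z : Plane, (∀ x ∈ ({A, B, C} : Set Plane), orient x y z ≤ orient A B C) →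
      ∀ x ∈ convexHull ℝ {A, B, C}, orient x y z ≤ orient A B C := by
    intro y z hv x hx
    have hconv : Convex ℝ {x | orient x y z ≤ orient A B C} := by
      intro a ha b hb s t hs ht hst
      simp only [Set.mem_ofPred_eq] at ha hb ⊢
      have : orient (s • a + t • b) y z = s * orient a y z + t * orient b y z := by
        obtain rfl : s = 1 - t := by linarith
        simp [orient]; ring
      rw [this]
      have e1 := mul_le_mul_of_nonneg_left ha hs
      have e2 := mul_le_mul_of_nonneg_left hb ht
      have e3 : s * orient A B C + t * orient A B C = orient A B C := by
        rw [← add_mul, hst, one_mul]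
      linarith
    exact convexHull_min hv hconv hx
  have hvert : ∀ x ∈ ({A, B, C} : Set Plane), ∀ y ∈ ({A, B, C} : Set Plane),
      ∀ z ∈ ({A, B, C} : Set Plane), orient x y z ≤ orient A B C := by
    rintro x (rfl | rfl | rfl) y (rfl | rfl | rfl) z (rfl | rfl | rfl) <;>
      simp only [orient] at h ⊢ <;> linarith
  refine aux y z (fun x hx => ?_) x hx
  rw [← orient_rotate]
  refine aux z x (fun y hy => ?_) y hy
  rw [← orient_rotate]
  refine aux x y (fun z hz => ?_) z hz
  rw [← orient_rotate]
  exact hvert x hx y hy z hz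

/-- Cramer's rule expresses `q - x` through `y - x` and `z - x`, with coefficients bounded by a
ratio of areas. A triangle of bounded area around three fixed noncollinear points is therefore
bounded, which gives compactness. -/
theorem norm_sub_le_of_mem {A B C x y z q : Plane} (h : 0 < orient A B C)
    (hx : x ∈ convexHull ℝ {A, B, C}) (hy : y ∈ convexHull ℝ {A, B, C})
    (hz : z ∈ convexHull ℝ {A, B, C}) (hq : q ∈ convexHull ℝ {A, B, C})
    (hxyz : 0 < orient x y z) :
    ‖q - x‖ ≤ orient A B C * (‖y - x‖ + ‖z - x‖) / orient x y z := by
  have e : orient x y z • (q - x) = orient x q z • (y - x) + orient x y q • (z - x) := by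
    apply plane_ext <;> simp [orient] <;> ring
  have b1 : |orient x q z| ≤ orient A B C := abs_le.2
    ⟨by linarith [orient_le_of_mem h hx hz hq, orient_swap x z q], orient_le_of_mem h hx hq hz⟩
  have b2 : |orient x y q| ≤ orient A B C := abs_le.2
    ⟨by linarith [orient_le_of_mem h hx hq hy, orient_swap x y q], orient_le_of_mem h hx hy hq⟩
  rw [le_div_iff₀ hxyz]
  calc ‖q - x‖ * orient x y z = ‖orient x y z • (q - x)‖ := by
        rw [norm_smul, Real.norm_of_nonneg hxyz.le, mul_comm]
    _ ≤ ‖orient x q z • (y - x)‖ + ‖orient x y q • (z - x)‖ := by rw [e]; exact norm_add_le _ _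
    _ = |orient x q z| * ‖y - x‖ + |orient x y q| * ‖z - x‖ := by
        rw [norm_smul, norm_smul, Real.norm_eq_abs, Real.norm_eq_abs]
    _ ≤ orient A B C * ‖y - x‖ + orient A B C * ‖z - x‖ :=
        add_le_add (mul_le_mul_of_nonneg_right b1 (norm_nonneg _))
          (mul_le_mul_of_nonneg_right b2 (norm_nonneg _))
    _ = _ := by ring

/-- A finite set that is not contained in a line has an enclosing triangle of minimum area. -/
theorem exists_minimal {ω : ℝ} (h0 : 0 < ω) (hπ : ω < π) {S : Set Plane} (hS : S.Finite)
    {x y z : Plane} (hx : x ∈ S) (hy : y ∈ S) (hz : z ∈ S) (hxyz : 0 < orient x y z) :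
    ∃ A B C, Minimal ω S A B C := by
  obtain ⟨A₀, B₀, C₀, hadm⟩ := exists_admissible h0 hπ hS
  -- The lower bound `orient x y z` holds for every admissible triangle and replaces the strict
  -- inequality in `IsAngleTriangle`, so that `K` is closed.
  set K : Set (Plane × Plane × Plane) := {T |
    dt (T.2.1 - T.1) (T.2.2 - T.1) * sin ω = orient T.1 T.2.1 T.2.2 * cos ω ∧
    orient x y z ≤ orient T.1 T.2.1 T.2.2 ∧ orient T.1 T.2.1 T.2.2 ≤ orient A₀ B₀ C₀ ∧
    ∀ q ∈ S, 0 ≤ orient T.1 T.2.1 q ∧ 0 ≤ orient T.2.1 T.2.2 q ∧ 0 ≤ orient T.2.2 T.1 q} with hK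
  have hmem : ∀ {A B C}, Admissible ω S A B C → ∀ q ∈ S, q ∈ convexHull ℝ {A, B, C} :=
    fun h q hq => (mem_convexHull_triangle h.1.1 q).2 (h.2 q hq)
  have hKadm : ∀ A B C, (A, B, C) ∈ K ↔
      Admissible ω S A B C ∧ orient A B C ≤ orient A₀ B₀ C₀ := by
    intro A B C
    constructor
    · rintro ⟨h1, h2, h3, h4⟩
      exact ⟨⟨⟨hxyz.trans_le h2, h1⟩, h4⟩, h3⟩
    · rintro ⟨h1, h2⟩
      exact ⟨h1.1.2, orient_le_of_mem h1.1.1 (hmem h1 x hx) (hmem h1 y hy) (hmem h1 z hz), h2, h1.2⟩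
  have hclosed : IsClosed K := by
    have c1 : Continuous fun T : Plane × Plane × Plane => orient T.1 T.2.1 T.2.2 :=
      continuous_orient
    have c2 : Continuous fun T : Plane × Plane × Plane => dt (T.2.1 - T.1) (T.2.2 - T.1) := by
      unfold dt; fun_prop
    have c3 : ∀ q, Continuous fun T : Plane × Plane × Plane => orient T.1 T.2.1 q := by
      intro q; unfold orient; fun_prop
    have c4 : ∀ q, Continuous fun T : Plane × Plane × Plane => orient T.2.1 T.2.2 q := by
      intro q; unfold orient; fun_prop
    have c5 : ∀ q, Continuous fun T : Plane × Plane × Plane => orient T.2.2 T.1 q := by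
      intro q; unfold orient; fun_prop
    simp only [hK, Set.ofPred_and, Set.ofPred_forall]
    refine (isClosed_eq (c2.mul continuous_const) (c1.mul continuous_const)).inter
      ((isClosed_le continuous_const c1).inter ((isClosed_le c1 continuous_const).inter
        (isClosed_iInter fun q => isClosed_iInter fun _ => ?_)))
    exact (isClosed_le continuous_const (c3 q)).inter
      ((isClosed_le continuous_const (c4 q)).inter (isClosed_le continuous_const (c5 q)))
  have hbdd : Bornology.IsBounded K := by
    set R := orient A₀ B₀ C₀ * (‖y - x‖ + ‖z - x‖) / orient x y z with hR
    have hb : Bornology.IsBounded (Metric.closedBall x R) := Metric.isBounded_closedBall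
    refine (hb.prod (hb.prod hb)).subset ?_
    rintro ⟨A, B, C⟩ hT
    obtain ⟨h1, h2⟩ := (hKadm A B C).1 hT
    have : ∀ q ∈ ({A, B, C} : Set Plane), q ∈ Metric.closedBall x R := by
      intro q hq
      rw [mem_closedBall_iff_norm]
      refine (norm_sub_le_of_mem h1.1.1 (hmem h1 x hx) (hmem h1 y hy) (hmem h1 z hz)
        (subset_convexHull ℝ _ hq) hxyz).trans ?_
      rw [hR]
      gcongr
    exact ⟨this A (by simp), this B (by simp), this C (by simp)⟩
  obtain ⟨⟨A, B, C⟩, hT, hmin⟩ := (Metric.isCompact_of_isClosed_isBounded hclosed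
    hbdd).exists_isMinOn ⟨(A₀, B₀, C₀), (hKadm _ _ _).2 ⟨hadm, le_rfl⟩⟩
    continuous_orient.continuousOn
  obtain ⟨h1, h2⟩ := (hKadm A B C).1 hT
  refine ⟨A, B, C, h1, fun A' B' C' h' => ?_⟩
  rcases le_total (orient A' B' C') (orient A₀ B₀ C₀) with hle | hle
  · exact hmin ((hKadm _ _ _).2 ⟨h', hle⟩)
  · exact h2.trans hle

/-- A finite set of collinear points has no enclosing triangle of minimum area. -/
theorem not_minimal_of_subset_segment {ω : ℝ} (h0 : 0 < ω) (hπ : ω < π) {S : Set Plane}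
    {x y : Plane} (hxy : S ⊆ convexHull ℝ {x, y}) (A B C : Plane) : ¬ Minimal ω S A B C := by
  rintro ⟨⟨⟨hpos, -⟩, -⟩, hmin⟩
  have hs : 0 < sin ω := sin_pos_of_pos_of_lt_pi h0 hπ
  set θ := direction (y - x) with hθ
  set l := ‖(⟨(y - x) 0, (y - x) 1⟩ : ℂ)‖ with hl
  have hl0 : 0 ≤ l := norm_nonneg _
  have hyx : y - x = l • unit θ := eq_smul_unit_direction _
  have hq : ∀ q ∈ S, ∃ t, 0 ≤ t ∧ t ≤ l ∧ q = x + t • unit θ := by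
    intro q hq
    have := hxy hq
    rw [convexHull_pair, segment_eq_image'] at this
    obtain ⟨t, ⟨ht0, ht1⟩, rfl⟩ := this
    refine ⟨t * l, by positivity, ?_, ?_⟩
    · nlinarith
    · change x + t • (y - x) = _
      rw [hyx, smul_smul]
  -- The side along the segment is longer than the segment, hence positive even if `x = y`; ε is
  -- chosen so that the new triangle has half the area of the given one.
  set M := l + 1 with hM
  have hM0 : 0 < M := by positivity
  set ε := orient A B C / (2 * M * sin ω) with hε
  have hε0 : 0 < ε := by positivity
  set v := unit θ with hv
  set w := unit (θ + ω) with hw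
  have hvw : cr v w = sin ω := by rw [hv, hw, cr_unit_unit]; congr 1; ring
  have e0 : orient x (x + M • v) (x + ε • w) = M * ε * sin ω := by
    rw [orient_eq_cr, add_sub_cancel_left, add_sub_cancel_left, cr_smul_left, cr_smul_right, hvw]
    ring
  have h1 := hmin x (x + M • v) (x + ε • w) ⟨⟨by rw [e0]; positivity, ?_⟩, ?_⟩
  · rw [e0] at h1
    have : M * ε * sin ω = orient A B C / 2 := by rw [hε]; field_simp
    linarith
  · have : dt (M • v) (ε • w) = M * ε * dt v w := by simp [dt]; ring
    rw [e0, add_sub_cancel_left, add_sub_cancel_left, this, hv, hw, dt_unit_unit,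
      add_sub_cancel_left]
    ring
  · intro q hqS
    obtain ⟨t, ht0, ht1, rfl⟩ := hq q hqS
    have e1 : orient x (x + M • v) (x + t • v) = 0 := by
      rw [orient_eq_cr, add_sub_cancel_left, add_sub_cancel_left, cr_smul_left, cr_smul_right,
        cr_self]
      ring
    have e2 : orient (x + ε • w) x (x + t • v) = ε * t * sin ω := by
      rw [← orient_rotate, orient_eq_cr, add_sub_cancel_left, add_sub_cancel_left, cr_smul_left,
        cr_smul_right, hvw]
      ring
    have e3 := orient_add_orient x (x + M • v) (x + ε • w) (x + t • v)
    refine ⟨e1.ge, ?_, by rw [e2]; positivity⟩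
    have e4 : orient (x + M • v) (x + ε • w) (x + t • v) = ε * sin ω * (M - t) := by
      linear_combination e3 - e1 - e2 + e0
    rw [e4]
    exact mul_nonneg (by positivity) (by linarith)

end FixedAngleTriangle

/-! ### Programs that test candidates -/

namespace FixedAngleTriangle

open Real RealRAM

/-- Expressions for vectors of the plane. -/
abbrev VecExpr : Type := RealExpr × RealExpr

namespace VecExpr

noncomputable def eval (s : State) (v : VecExpr) : Plane := pt (v.1.eval s) (v.2.eval s)

def sub (v w : VecExpr) : VecExpr := (v.1 - w.1, v.2 - w.2)
def add (v w : VecExpr) : VecExpr := (v.1 + w.1, v.2 + w.2)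
def smul (r : RealExpr) (v : VecExpr) : VecExpr := (r * v.1, r * v.2)
def cr (v w : VecExpr) : RealExpr := v.1 * w.2 - v.2 * w.1
def dt (v w : VecExpr) : RealExpr := v.1 * w.1 + v.2 * w.2
def rot (c s : RealExpr) (v : VecExpr) : VecExpr := (c * v.1 - s * v.2, s * v.1 + c * v.2)
def perp (v : VecExpr) : VecExpr := (.const 0 - v.2, v.1)
def orient (a b c : VecExpr) : RealExpr := cr (sub b a) (sub c a)
def meet (a v b w : VecExpr) : VecExpr := add a (smul (cr (sub b a) w / cr v w) v)
def midDir (d d' P Q M : VecExpr) : VecExpr :=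
  sub (smul (cr d (sub M P)) d') (smul (cr (sub M Q) d') d)
def rotate (v : VecExpr) : VecExpr := rot (.reg 0) (.reg 1) v

def criticalRoot (k : Fin 4) (κ n₂ n₁ n₀ : RealExpr) : RealExpr :=
  .root k (.const 2 * κ * n₁ - n₀) (.const 4 * κ * n₂ + n₁ - .const 2 * κ * n₀)
    (.const 3 * n₂ - .const 3 * n₀) (.const 2 * κ * n₂ - n₁) n₂

def criticalDir (k : Fin 4) (e P Q M : VecExpr) : VecExpr :=
  add (smul (criticalRoot k (.reg 0 / .reg 1) (cr e (sub P M))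
    (dt e (sub Q P) + .reg 0 / .reg 1 * cr e (sub P Q))
    (.reg 0 / .reg 1 * dt e (sub Q P) + cr e (sub Q M))) e) (perp e)

variable (s : State) (v w a b c d d' P Q M : VecExpr) (r : RealExpr)

@[simp] theorem eval_sub : (sub v w).eval s = v.eval s - w.eval s := by
  apply plane_ext <;> simp [eval, sub]
@[simp] theorem eval_add : (add v w).eval s = v.eval s + w.eval s := by
  apply plane_ext <;> simp [eval, add]
@[simp] theorem eval_smul : (smul r v).eval s = r.eval s • v.eval s := by
  apply plane_ext <;> simp [eval, smul]
@[simp] theorem eval_cr : (cr v w).eval s = FixedAngleTriangle.cr (v.eval s) (w.eval s) := by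
  simp [eval, cr, FixedAngleTriangle.cr]
@[simp] theorem eval_dt : (dt v w).eval s = FixedAngleTriangle.dt (v.eval s) (w.eval s) := by
  simp [eval, dt, FixedAngleTriangle.dt]
@[simp] theorem eval_rot (e f : RealExpr) :
    (rot e f v).eval s = FixedAngleTriangle.rot (e.eval s) (f.eval s) (v.eval s) := by
  apply plane_ext <;> simp [eval, rot, FixedAngleTriangle.rot]
@[simp] theorem eval_perp : (perp v).eval s = FixedAngleTriangle.perp (v.eval s) := by
  apply plane_ext <;> simp [eval, perp, FixedAngleTriangle.perp]
@[simp] theorem eval_orient : (orient a b c).eval s =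
    FixedAngleTriangle.orient (a.eval s) (b.eval s) (c.eval s) := by
  simp [orient, orient_eq_cr]
@[simp] theorem eval_meet : (meet a v b w).eval s =
    FixedAngleTriangle.meet (a.eval s) (v.eval s) (b.eval s) (w.eval s) := by
  simp [meet, FixedAngleTriangle.meet]
@[simp] theorem eval_midDir : (midDir d d' P Q M).eval s =
    FixedAngleTriangle.midDir (d.eval s) (d'.eval s) (P.eval s) (Q.eval s) (M.eval s) := by
  simp [midDir, FixedAngleTriangle.midDir]
@[simp] theorem eval_mk : eval s (r, e) = pt (r.eval s) (e.eval s) := rfl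

theorem eval_fst : v.1.eval s = v.eval s 0 := rfl
theorem eval_snd : v.2.eval s = v.eval s 1 := rfl

theorem eval_criticalDir (k : Fin 4) {ω : ℝ} (h0 : s.real 0 = cos ω) (h1 : s.real 1 = sin ω) :
    (criticalDir k a P Q M).eval s =
      FixedAngleTriangle.criticalDir ω k (a.eval s) (P.eval s) (Q.eval s) (M.eval s) := by
  simp [criticalDir, criticalRoot, FixedAngleTriangle.criticalDir,
    FixedAngleTriangle.criticalRoot, h0, h1]

end VecExpr

/-- The vertex of the polygon that is stored at an index. -/
def vertexExpr (i : NatExpr) : VecExpr := (.read 6 i, .read 7 i)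

/-- The test that the line through `X` and `Y` supports the polygon at the vertex number `i`. -/
def supportTest (X Y : VecExpr) (i : NatExpr) : Test :=
  .and (.not (.realLt (VecExpr.orient X Y (vertexExpr i)) (.const 0)))
    (.and (.not (.realLt (VecExpr.orient X Y (vertexExpr (i - .const 1))) (VecExpr.orient X Y (vertexExpr i))))
      (.not (.realLt (VecExpr.orient X Y (vertexExpr (i + .const 1))) (VecExpr.orient X Y (vertexExpr i)))))

/-- The vertices of the current candidate are kept in registers. -/
def regA : VecExpr := (.reg 3, .reg 4)
def regB : VecExpr := (.reg 5, .reg 6)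
def regC : VecExpr := (.reg 7, .reg 8)
def regD : VecExpr := (.reg 9, .reg 10)
def regF : VecExpr := (.reg 11, .reg 12)

/-- The test that the current candidate is admissible. -/
def admissibleTest : Test :=
  .and (.realLt (.const 0) (VecExpr.orient regA regB regC))
    (.and (.realEq (VecExpr.dt (VecExpr.sub regB regA) (VecExpr.sub regC regA) * .reg 1)
        (VecExpr.orient regA regB regC * .reg 0))
      (.and (supportTest regA regB (.reg 2))
        (.and (supportTest regB regC (.reg 4)) (supportTest regC regA (.reg 3)))))

/-- Assign a vector to two registers. -/
def setVec (x y : ℕ) (v : VecExpr) : Program := .seq (.setReal x v.1) (.setReal y v.2)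

/-- Compute the current candidate. -/
def computeCandidate : Program :=
  .seq (setVec 3 4 (VecExpr.meet (vertexExpr (.reg 2)) regD (vertexExpr (.reg 3)) (VecExpr.rotate regD)))
    (.seq (setVec 5 6 (VecExpr.meet (vertexExpr (.reg 2)) regD (vertexExpr (.reg 4)) regF))
      (setVec 7 8 (VecExpr.meet (vertexExpr (.reg 3)) (VecExpr.rotate regD) (vertexExpr (.reg 4)) regF)))

/-- Forget the recorded triangles if the current candidate is smaller. -/
def resetIfSmaller : Program :=
  .ite (.or (.natEq (.reg 5) (.const 0)) (.realLt (VecExpr.orient regA regB regC) (.reg 2)))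
    (.seq (.setReal 2 (VecExpr.orient regA regB regC)) (.setNat 5 (.const 0))) .skip

/-- Record the current candidate. -/
def append : Program :=
  .seq (.writeReal 0 (.reg 5) (.reg 3)) (.seq (.writeReal 1 (.reg 5) (.reg 4))
    (.seq (.writeReal 2 (.reg 5) (.reg 5)) (.seq (.writeReal 3 (.reg 5) (.reg 6))
      (.seq (.writeReal 4 (.reg 5) (.reg 7)) (.seq (.writeReal 5 (.reg 5) (.reg 8))
        (.setNat 5 (.reg 5 + .const 1)))))))

/-- Record the current candidate if it is admissible and at most as large as those recorded. -/
def tryCandidate : Program :=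
  .seq computeCandidate (.ite admissibleTest
    (.seq resetIfSmaller (.ite (.realEq (VecExpr.orient regA regB regC) (.reg 2)) append .skip)) .skip)

/-! ### Soundness and completeness of the record of triangles -/

/-- The data of the sweep: the polygon, the angle, and the current vertices. -/
structure Context (N : ℕ) (p : ℕ → Plane) (ω : ℝ) (i j k : ℕ) (s : State) : Prop where
  size : s.nat 1 = N
  i_eq : s.nat 2 = i
  j_eq : s.nat 3 = j
  k_eq : s.nat 4 = k
  x_eq : ∀ m < 5 * N, s.realArr 6 m = p m 0
  y_eq : ∀ m < 5 * N, s.realArr 7 m = p m 1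
  cos_eq : s.real 0 = cos ω
  sin_eq : s.real 1 = sin ω

theorem Context.vertex {N : ℕ} {p : ℕ → Plane} {ω : ℝ} {i j k : ℕ} {s : State}
    (h : Context N p ω i j k s) {e : NatExpr} (he : e.eval s < 5 * N) :
    (vertexExpr e).eval s = p (e.eval s) :=
  plane_ext (h.x_eq _ he) (h.y_eq _ he)

/-- The `j`-th recorded triangle. -/
noncomputable def outA (s : State) (j : ℕ) : Plane := pt (s.realArr 0 j) (s.realArr 1 j)
noncomputable def outB (s : State) (j : ℕ) : Plane := pt (s.realArr 2 j) (s.realArr 3 j)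
noncomputable def outC (s : State) (j : ℕ) : Plane := pt (s.realArr 4 j) (s.realArr 5 j)

/-- All recorded triangles are admissible and have the same area. -/
def Sound (ω : ℝ) (S : Set Plane) (s : State) : Prop :=
  ∀ j < s.nat 5, Admissible ω S (outA s j) (outB s j) (outC s j) ∧
    orient (outA s j) (outB s j) (outC s j) = s.real 2

/-- The triangle `A B C` is recorded. -/
def Recorded (s : State) (A B C : Plane) : Prop :=
  ∃ j < s.nat 5, outA s j = A ∧ outB s j = B ∧ outC s j = C

/-- The new configuration `s'` is sound and has all triangles of minimum area that `s` has. -/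
def Extends (ω : ℝ) (S : Set Plane) (s s' : State) : Prop :=
  Sound ω S s' ∧ ∀ A B C, Minimal ω S A B C → Recorded s A B C → Recorded s' A B C

section

variable {N : ℕ} {p : ℕ → Plane} {ω : ℝ} {i j k : ℕ} {s : State} {S : Set Plane}

theorem Extends.trans {s' s'' : State} (h : Extends ω S s s') (h' : Extends ω S s' s'') :
    Extends ω S s s'' :=
  ⟨h'.1, fun A B C hm hr => h'.2 A B C hm (h.2 A B C hm hr)⟩

theorem Extends.of_eq {s' : State} (hs : Sound ω S s) (h1 : s'.nat 5 = s.nat 5)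
    (h2 : s'.real 2 = s.real 2) (h3 : ∀ a < 6, s'.realArr a = s.realArr a) :
    Extends ω S s s' := by
  have hA : outA s' = outA s := by funext j; simp [outA, h3]
  have hB : outB s' = outB s := by funext j; simp [outB, h3]
  have hC : outC s' = outC s := by funext j; simp [outC, h3]
  exact ⟨by simpa [Sound, hA, hB, hC, h1, h2] using hs, by simp [Recorded, hA, hB, hC, h1]⟩

theorem append_spec (s : State) :
    (append.exec s).nat = Function.update s.nat 5 (s.nat 5 + 1) ∧ (append.exec s).real = s.real ∧
    (∀ a, 6 ≤ a → (append.exec s).realArr a = s.realArr a) ∧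
    (∀ j, j ≠ s.nat 5 → outA (append.exec s) j = outA s j ∧ outB (append.exec s) j = outB s j ∧
      outC (append.exec s) j = outC s j) ∧
    outA (append.exec s) (s.nat 5) = regA.eval s ∧ outB (append.exec s) (s.nat 5) = regB.eval s ∧
      outC (append.exec s) (s.nat 5) = regC.eval s := by
  refine ⟨?_, ?_, ?_, ?_, ?_, ?_, ?_⟩
  · simp [append, Program.exec]
  · simp [append, Program.exec]
  · intro a ha
    simp [append, Program.exec, show a ≠ 0 by omega, show a ≠ 1 by omega, show a ≠ 2 by omega, show a ≠ 3 by omega,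
      show a ≠ 4 by omega, show a ≠ 5 by omega]
  · intro j hj
    simp [append, Program.exec, outA, outB, outC, hj]
  · simp [append, Program.exec, outA, regA]
  · simp [append, Program.exec, outB, regB]
  · simp [append, Program.exec, outC, regC]

/-- If the list is emptied, the new admissible triangle is smaller than everything dropped, so
nothing minimal is lost. If the new triangle is rejected, it is larger than a recorded one and not
minimal. The real register 2 is meaningful only for a nonempty list, which explains the separate
test for zero. -/
theorem record_spec (hs : Sound ω S s)
    (hadm : Admissible ω S (regA.eval s) (regB.eval s) (regC.eval s)) :
    let s' := (Program.seq resetIfSmaller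
      (.ite (.realEq (VecExpr.orient regA regB regC) (.reg 2)) append .skip)).exec s
    Extends ω S s s' ∧
      (Minimal ω S (regA.eval s) (regB.eval s) (regC.eval s) →
        Recorded s' (regA.eval s) (regB.eval s) (regC.eval s)) := by
  intro s'
  set Δ := orient (regA.eval s) (regB.eval s) (regC.eval s) with hΔ
  by_cases h1 : s.nat 5 = 0 ∨ Δ < s.real 2
  · set s1 : State := (Program.seq (.setReal 2 (VecExpr.orient regA regB regC))
      (.setNat 5 (.const 0))).exec s with hs1
    have e1 : resetIfSmaller.exec s = s1 := by
      rw [resetIfSmaller, Program.exec, if_pos]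
      simpa [Test.Holds, ← hΔ] using h1
    have r1 : regA.eval s1 = regA.eval s ∧ regB.eval s1 = regB.eval s ∧
        regC.eval s1 = regC.eval s := by
      simp [regA, regB, regC, hs1, Program.exec]
    have r2 : s1.real 2 = Δ := by simp [hs1, Program.exec, hΔ]
    have r3 : s1.nat 5 = 0 := by simp [hs1, Program.exec]
    have e2 : s' = append.exec s1 := by
      change Program.exec _ (resetIfSmaller.exec s) = _
      rw [e1, Program.exec, if_pos]
      simp [Test.Holds, r1, r2, ← hΔ]
    obtain ⟨a1, a2, -, -, a4, a5, a6⟩ := append_spec s1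
    rw [r1.1, r3] at a4
    rw [r1.2.1, r3] at a5
    rw [r1.2.2, r3] at a6
    have hrec : Recorded s' (regA.eval s) (regB.eval s) (regC.eval s) :=
      ⟨0, by rw [e2, a1, r3]; simp, by rw [e2, a4], by rw [e2, a5], by rw [e2, a6]⟩
    refine ⟨⟨fun j hj => ?_, ?_⟩, fun _ => hrec⟩
    · rw [e2, a1, r3] at hj
      obtain rfl : j = 0 := by simpa using hj
      rw [e2, a4, a5, a6, a2, r2]
      exact ⟨hadm, rfl⟩
    · rintro A B C hm ⟨j, hj, rfl, rfl, rfl⟩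
      rcases h1 with h1 | h1
      · omega
      · have := hm.2 _ _ _ hadm
        rw [(hs j hj).2] at this
        linarith
  · have e1 : resetIfSmaller.exec s = s := by
      rw [resetIfSmaller, Program.exec, if_neg]
      · rfl
      · simpa [Test.Holds, ← hΔ] using h1
    push Not at h1
    by_cases h2 : Δ = s.real 2
    · have e2 : s' = append.exec s := by
        change Program.exec _ (resetIfSmaller.exec s) = _
        rw [e1, Program.exec, if_pos]
        simpa [Test.Holds, ← hΔ] using h2
      obtain ⟨a1, a2, -, a3, a4, a5, a6⟩ := append_spec s
      have hn : s'.nat 5 = s.nat 5 + 1 := by rw [e2, a1]; simp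
      refine ⟨⟨fun j hj => ?_, ?_⟩, fun _ => ⟨s.nat 5, by omega, by rw [e2, a4],
        by rw [e2, a5], by rw [e2, a6]⟩⟩
      · rcases Nat.lt_succ_iff_lt_or_eq.1 (hn ▸ hj) with hj' | rfl
        · rw [e2, (a3 j hj'.ne).1, (a3 j hj'.ne).2.1, (a3 j hj'.ne).2.2, a2]
          exact hs j hj'
        · rw [e2, a4, a5, a6, a2]
          exact ⟨hadm, h2⟩
      · rintro A B C hm ⟨j, hj, rfl, rfl, rfl⟩
        exact ⟨j, by omega, by rw [e2, (a3 j hj.ne).1], by rw [e2, (a3 j hj.ne).2.1],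
          by rw [e2, (a3 j hj.ne).2.2]⟩
    · have e2 : s' = s := by
        change Program.exec _ (resetIfSmaller.exec s) = _
        rw [e1, Program.exec, if_neg]
        · rfl
        · simpa [Test.Holds, ← hΔ] using h2
      rw [e2]
      refine ⟨⟨hs, fun _ _ _ _ h => h⟩, fun hm => ?_⟩
      have h3 := (hs 0 (Nat.pos_of_ne_zero h1.1))
      have h4 := hm.2 _ _ _ h3.1
      rw [h3.2] at h4
      exact absurd (le_antisymm h4 h1.2) h2

theorem loopFree_tryCandidate : tryCandidate.LoopFree := by
  simp [tryCandidate, computeCandidate, resetIfSmaller, append, setVec, Program.LoopFree]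

theorem Context.of_eq {s' : State} (h : Context N p ω i j k s) (h1 : ∀ x < 5, s'.nat x = s.nat x)
    (h2 : ∀ x < 2, s'.real x = s.real x) (h3 : s'.realArr 6 = s.realArr 6)
    (h4 : s'.realArr 7 = s.realArr 7) : Context N p ω i j k s' :=
  ⟨by rw [h1 1 (by norm_num), h.size], by rw [h1 2 (by norm_num), h.i_eq],
    by rw [h1 3 (by norm_num), h.j_eq], by rw [h1 4 (by norm_num), h.k_eq],
    by rw [h3]; exact h.x_eq, by rw [h4]; exact h.y_eq,
    by rw [h2 0 (by norm_num), h.cos_eq], by rw [h2 1 (by norm_num), h.sin_eq]⟩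

theorem supportTest_holds (h : Context N p ω i j k s) {e : NatExpr} (he : e.eval s + 1 < 5 * N)
    (X Y : VecExpr) : (supportTest X Y e).Holds s ↔
      0 ≤ orient (X.eval s) (Y.eval s) (p (e.eval s)) ∧
      orient (X.eval s) (Y.eval s) (p (e.eval s)) ≤
        orient (X.eval s) (Y.eval s) (p (e.eval s - 1)) ∧
      orient (X.eval s) (Y.eval s) (p (e.eval s)) ≤
        orient (X.eval s) (Y.eval s) (p (e.eval s + 1)) := by
  have v1 : (vertexExpr e).eval s = p (e.eval s) := h.vertex (by omega)
  have v2 : (vertexExpr (e - .const 1)).eval s = p (e.eval s - 1) := h.vertex (by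
    simp only [NatExpr.eval_sub, NatExpr.eval_const]; omega)
  have v3 : (vertexExpr (e + .const 1)).eval s = p (e.eval s + 1) := h.vertex (by
    simp only [NatExpr.eval_add, NatExpr.eval_const]; omega)
  simp [supportTest, Test.Holds, v1, v2, v3]

/-- By convexity, comparing a vertex with its two neighbours certifies the whole polygon; this makes
the test of admissibility a matter of constant time. -/
theorem orient_nonneg_of_support (hP : IsPolygon N p) {X Y : Plane} {m : ℕ} (hm : 1 ≤ m)
    (h1 : 0 ≤ orient X Y (p m)) (h2 : orient X Y (p m) ≤ orient X Y (p (m - 1)))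
    (h3 : orient X Y (p m) ≤ orient X Y (p (m + 1))) (l : ℕ) : 0 ≤ orient X Y (p l) := by
  obtain ⟨m, rfl⟩ := Nat.exists_eq_add_of_le' hm
  refine h1.trans ?_
  simp only [orient_eq_cr, cr_sub_right _ _ X, Nat.add_sub_cancel] at h2 h3 ⊢
  linarith [hP.le_of_local (by linarith : cr (Y - X) (p (m + 1)) ≤ cr (Y - X) (p m))
    (by linarith) l]


/-- The value of the expression does not depend on the registers `2` to `8`. -/
def VecExpr.Stable (v : VecExpr) : Prop :=
  ∀ (s : State) (f : ℕ → ℝ), (∀ x, x < 2 ∨ 9 ≤ x → f x = s.real x) →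
    v.eval { s with real := f } = v.eval s

theorem stable_vertexExpr (x : ℕ) : (vertexExpr (.reg x)).Stable := fun _ _ _ => rfl

theorem stable_regD : regD.Stable := fun s f h => by simp [regD, h]

theorem stable_regF : regF.Stable := fun s f h => by simp [regF, h]

theorem stable_rotate_regD : (VecExpr.rotate regD).Stable := fun s f h => by
  simp [VecExpr.rotate, regD, h]

theorem VecExpr.Stable.meet {a v b w : VecExpr} (ha : a.Stable) (hv : v.Stable) (hb : b.Stable)
    (hw : w.Stable) : (VecExpr.meet a v b w).Stable := fun s f h => by
  rw [VecExpr.eval_meet, VecExpr.eval_meet, ha s f h, hv s f h, hb s f h, hw s f h]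

/-- The second coordinate is evaluated after the first register has been overwritten; stability
guarantees that this does no harm. -/
theorem setVec_exec {x y : ℕ} {v : VecExpr} (hv : v.Stable) (hx : 2 ≤ x) (hx' : x < 9)
    (s : State) : (setVec x y v).exec s =
      { s with real := Function.update (Function.update s.real x (v.eval s 0)) y (v.eval s 1) } := by
  have h := hv s (Function.update s.real x (v.1.eval s)) (fun z hz => by
    rw [Function.update_of_ne]; omega)
  have h1 := congrArg (fun q : Plane => q 1) h
  simp only [← VecExpr.eval_snd] at h1
  simp only [setVec, Program.exec, VecExpr.eval_fst s v, h1, ← VecExpr.eval_snd s v] at h1 ⊢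

theorem computeCandidate_exec (s : State) : ∃ f : ℕ → ℝ,
    computeCandidate.exec s = { s with real := f } ∧ (∀ x, x < 3 ∨ 9 ≤ x → f x = s.real x) ∧
    pt (f 3) (f 4) = meet ((vertexExpr (.reg 2)).eval s) (regD.eval s)
      ((vertexExpr (.reg 3)).eval s) ((VecExpr.rotate regD).eval s) ∧
    pt (f 5) (f 6) = meet ((vertexExpr (.reg 2)).eval s) (regD.eval s)
      ((vertexExpr (.reg 4)).eval s) (regF.eval s) ∧
    pt (f 7) (f 8) = meet ((vertexExpr (.reg 3)).eval s) ((VecExpr.rotate regD).eval s)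
      ((vertexExpr (.reg 4)).eval s) (regF.eval s) := by
  have h1 := (stable_vertexExpr 2).meet stable_regD (stable_vertexExpr 3) stable_rotate_regD
  have h2 := (stable_vertexExpr 2).meet stable_regD (stable_vertexExpr 4) stable_regF
  have h3 := (stable_vertexExpr 3).meet stable_rotate_regD (stable_vertexExpr 4) stable_regF
  simp only [← VecExpr.eval_meet]
  refine ⟨_, by
    simp only [computeCandidate, Program.exec]
    rw [setVec_exec h1 (by norm_num) (by norm_num), setVec_exec h2 (by norm_num) (by norm_num),
      setVec_exec h3 (by norm_num) (by norm_num), h2 s, h3 _, h3 s]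
    all_goals
      intro x hx
      dsimp only
      rw [Function.update_of_ne, Function.update_of_ne] <;> omega, ?_, ?_, ?_, ?_⟩
  · intro x hx
    dsimp only
    rw [Function.update_of_ne, Function.update_of_ne, Function.update_of_ne,
      Function.update_of_ne, Function.update_of_ne, Function.update_of_ne] <;> omega
  all_goals apply plane_ext <;> simp

theorem admissible_of_test (hP : IsPolygon N p) (h : Context N p ω i j k s)
    (hi : 1 ≤ i ∧ i + 1 < 5 * N) (hj : 1 ≤ j ∧ j + 1 < 5 * N) (hk : 1 ≤ k ∧ k + 1 < 5 * N)
    (ht : admissibleTest.Holds s) :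
    Admissible ω (Set.range p) (regA.eval s) (regB.eval s) (regC.eval s) := by
  obtain ⟨t1, t2, t3, t4, t5⟩ := ht
  rw [supportTest_holds h (by simpa [h.i_eq] using hi.2)] at t3
  rw [supportTest_holds h (by simpa [h.k_eq] using hk.2)] at t4
  rw [supportTest_holds h (by simpa [h.j_eq] using hj.2)] at t5
  simp only [Test.Holds, VecExpr.eval_orient, RealExpr.eval_mul, RealExpr.eval_reg,
    RealExpr.eval_const, VecExpr.eval_dt, VecExpr.eval_sub, NatExpr.eval_reg, h.i_eq, h.j_eq,
    h.k_eq, h.cos_eq, h.sin_eq, Rat.cast_zero] at t1 t2 t3 t4 t5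
  refine ⟨⟨t1, t2⟩, ?_⟩
  rintro _ ⟨l, rfl⟩
  exact ⟨orient_nonneg_of_support hP hi.1 t3.1 t3.2.1 t3.2.2 l,
    orient_nonneg_of_support hP hk.1 t4.1 t4.2.1 t4.2.2 l,
    orient_nonneg_of_support hP hj.1 t5.1 t5.2.1 t5.2.2 l⟩

theorem test_of_admissible (h : Context N p ω i j k s)
    (hi : 1 ≤ i ∧ i + 1 < 5 * N) (hj : 1 ≤ j ∧ j + 1 < 5 * N) (hk : 1 ≤ k ∧ k + 1 < 5 * N)
    (ha : Admissible ω (Set.range p) (regA.eval s) (regB.eval s) (regC.eval s))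
    (h1 : orient (regA.eval s) (regB.eval s) (p i) = 0)
    (h2 : orient (regB.eval s) (regC.eval s) (p k) = 0)
    (h3 : orient (regC.eval s) (regA.eval s) (p j) = 0) : admissibleTest.Holds s := by
  have hm := fun l => ha.2 (p l) ⟨l, rfl⟩
  refine ⟨?_, ?_, (supportTest_holds h (by simpa [h.i_eq] using hi.2) _ _).2 ?_,
    (supportTest_holds h (by simpa [h.k_eq] using hk.2) _ _).2 ?_,
    (supportTest_holds h (by simpa [h.j_eq] using hj.2) _ _).2 ?_⟩
  · simpa [Test.Holds] using ha.1.1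
  · simpa [Test.Holds, h.cos_eq, h.sin_eq] using ha.1.2
  · simp only [NatExpr.eval_reg, h.i_eq, h1]
    exact ⟨le_rfl, (hm _).1, (hm _).1⟩
  · simp only [NatExpr.eval_reg, h.k_eq, h2]
    exact ⟨le_rfl, (hm _).2.1, (hm _).2.1⟩
  · simp only [NatExpr.eval_reg, h.j_eq, h3]
    exact ⟨le_rfl, (hm _).2.2, (hm _).2.2⟩

/-- Soundness assumes nothing about the directions in the registers: meaningless values, such as
those from a division by zero, are filtered out by the test. Completeness rests on
`SideLines.eq_meet`, since the computed points are then the given triangle. -/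
theorem tryCandidate_spec (hP : IsPolygon N p) (h : Context N p ω i j k s)
    (hi : 1 ≤ i ∧ i + 1 < 5 * N) (hj : 1 ≤ j ∧ j + 1 < 5 * N) (hk : 1 ≤ k ∧ k + 1 < 5 * N)
    (hs : Sound ω (Set.range p) s) :
    Context N p ω i j k (tryCandidate.exec s) ∧
    Extends ω (Set.range p) s (tryCandidate.exec s) ∧
    ∀ A B C, Minimal ω (Set.range p) A B C →
      SideLines ω A B C (regD.eval s) (regF.eval s) (p i) (p j) (p k) →
      Recorded (tryCandidate.exec s) A B C := by
  obtain ⟨f, hf, f1, fA, fB, fC⟩ := computeCandidate_exec s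
  set s1 : State := { s with real := f } with hs1
  have c1 : Context N p ω i j k s1 := h.of_eq (fun _ _ => rfl) (fun x hx => f1 x (by omega))
    rfl rfl
  have e1 : Extends ω (Set.range p) s s1 :=
    Extends.of_eq hs rfl (f1 2 (by norm_num)) (fun _ _ => rfl)
  have vi : (vertexExpr (.reg 2)).eval s = p i := by
    rw [h.vertex (by simp only [NatExpr.eval_reg, h.i_eq]; omega), NatExpr.eval_reg, h.i_eq]
  have vj : (vertexExpr (.reg 3)).eval s = p j := by
    rw [h.vertex (by simp only [NatExpr.eval_reg, h.j_eq]; omega), NatExpr.eval_reg, h.j_eq]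
  have vk : (vertexExpr (.reg 4)).eval s = p k := by
    rw [h.vertex (by simp only [NatExpr.eval_reg, h.k_eq]; omega), NatExpr.eval_reg, h.k_eq]
  have vr : (VecExpr.rotate regD).eval s = rotate ω (regD.eval s) := by
    simp [VecExpr.rotate, rotate, h.cos_eq, h.sin_eq]
  rw [vi, vj, vr] at fA
  rw [vi, vk] at fB
  rw [vj, vr, vk] at fC
  have rA : regA.eval s1 = pt (f 3) (f 4) := rfl
  have rB : regB.eval s1 = pt (f 5) (f 6) := rfl
  have rC : regC.eval s1 = pt (f 7) (f 8) := rfl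
  have ex : tryCandidate.exec s = Program.exec (.ite admissibleTest (.seq resetIfSmaller
      (.ite (.realEq (VecExpr.orient regA regB regC) (.reg 2)) append .skip)) .skip) s1 := by
    rw [← hf]; rfl
  have hc : Context N p ω i j k (tryCandidate.exec s) := by
    rw [ex, Program.exec]
    split_ifs
    · simp only [Program.exec]
      have c2 : Context N p ω i j k (resetIfSmaller.exec s1) := by
        simp only [resetIfSmaller, Program.exec]
        split_ifs
        · exact c1.of_eq (fun x hx => Function.update_of_ne (by omega) _ _)
            (fun x hx => Function.update_of_ne (by omega) _ _) rfl rfl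
        · exact c1
      split_ifs
      · obtain ⟨a1, a2, a3, -⟩ := append_spec (resetIfSmaller.exec s1)
        exact c2.of_eq (fun x hx => by rw [a1, Function.update_of_ne (by omega)])
          (fun x hx => by rw [a2]) (a3 6 le_rfl) (a3 7 (by norm_num))
      · exact c2
    · exact c1
  refine ⟨hc, ?_, ?_⟩
  · rw [ex, Program.exec]
    split_ifs with ht
    · exact e1.trans (record_spec e1.1 (admissible_of_test hP c1 hi hj hk ht)).1
    · exact e1
  · intro A B C hm hL
    obtain ⟨m1, m2, m3⟩ := hL.eq_meet
    rw [← rA, m1] at fA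
    rw [← rB, m2] at fB
    rw [← rC, m3] at fC
    have ht : admissibleTest.Holds s1 := by
      apply test_of_admissible c1 hi hj hk <;> simp only [fA, fB, fC]
      exacts [hm.1, hL.onAB, hL.onBC, hL.onCA]
    have := (record_spec e1.1 (admissible_of_test hP c1 hi hj hk ht)).2
    rw [ex, Program.exec, if_pos ht]
    rw [fA, fB, fC] at this
    exact this hm

/-! ### Trying all candidates for one triple of contact vertices -/

/-- The pairs of directions of the candidates. -/
def directionExprs : List (VecExpr × VecExpr) :=
  let P := vertexExpr (.reg 2)
  let Q := vertexExpr (.reg 3)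
  let M := vertexExpr (.reg 4)
  let d₁ := VecExpr.sub P (vertexExpr (.reg 2 - .const 1))
  let d₂ := VecExpr.rot (.reg 0) (.const 0 - .reg 1)
    (VecExpr.sub Q (vertexExpr (.reg 3 - .const 1)))
  let e := VecExpr.sub (vertexExpr (.reg 4 + .const 1)) M
  [(d₁, e), (d₂, e), (d₁, VecExpr.midDir d₁ (VecExpr.rotate d₁) P Q M),
    (d₂, VecExpr.midDir d₂ (VecExpr.rotate d₂) P Q M), (VecExpr.criticalDir 0 e P Q M, e),
    (VecExpr.criticalDir 1 e P Q M, e), (VecExpr.criticalDir 2 e P Q M, e),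
    (VecExpr.criticalDir 3 e P Q M, e)]

/-- Try all pairs of directions of a list. -/
def tryAll : List (VecExpr × VecExpr) → Program
  | [] => .skip
  | v :: l => .seq (.seq (.seq (setVec 9 10 v.1) (setVec 11 12 v.2)) tryCandidate) (tryAll l)

/-- Try all candidates with given vertices. -/
def emit : Program := tryAll directionExprs

theorem loopFree_tryAll (l : List (VecExpr × VecExpr)) : (tryAll l).LoopFree := by
  induction l with
  | nil => trivial
  | cons v l ih => exact ⟨⟨⟨⟨trivial, trivial⟩, trivial, trivial⟩, loopFree_tryCandidate⟩, ih⟩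

/-- The value of the expression is determined by the data of the sweep. -/
def VecExpr.Determined (N : ℕ) (p : ℕ → Plane) (ω : ℝ) (i j k : ℕ) (v : VecExpr) (d : Plane) :
    Prop := ∀ s, Context N p ω i j k s → v.eval s = d

/-- Trying one candidate changes registers, but the remaining expressions depend only on the data in
`Context`, which is preserved. They can thus be evaluated in the initial configuration. -/
theorem tryAll_spec (hP : IsPolygon N p)
    (hi : 1 ≤ i ∧ i + 1 < 5 * N) (hj : 1 ≤ j ∧ j + 1 < 5 * N) (hk : 1 ≤ k ∧ k + 1 < 5 * N)
    {l : List (VecExpr × VecExpr)} (hl : ∀ v ∈ l, ∃ d f, v.1.Determined N p ω i j k d ∧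
      v.2.Determined N p ω i j k f) :
    ∀ {s}, Context N p ω i j k s → Sound ω (Set.range p) s →
    Context N p ω i j k ((tryAll l).exec s) ∧ Extends ω (Set.range p) s ((tryAll l).exec s) ∧
    ∀ v ∈ l, ∀ A B C, Minimal ω (Set.range p) A B C →
      SideLines ω A B C (v.1.eval s) (v.2.eval s) (p i) (p j) (p k) →
      Recorded ((tryAll l).exec s) A B C := by
  induction l with
  | nil => exact fun h hs => ⟨h, ⟨hs, fun _ _ _ _ h => h⟩, by simp⟩
  | cons v l ih =>
    intro s h hs
    obtain ⟨d, f, hd, hf⟩ := hl v (by simp)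
    have upd : ∀ {s : State} {x y : ℕ} {a b : ℝ}, Context N p ω i j k s →
        Sound ω (Set.range p) s → 3 ≤ x → 3 ≤ y →
        Context N p ω i j k
          { s with real := Function.update (Function.update s.real x a) y b } ∧
        Extends ω (Set.range p) s
          { s with real := Function.update (Function.update s.real x a) y b } := by
      intro s x y a b h hs hx hy
      have := fun z (hz : z < 3) => show Function.update (Function.update s.real x a) y b z =
        s.real z by rw [Function.update_of_ne (by omega), Function.update_of_ne (by omega)]
      exact ⟨h.of_eq (fun _ _ => rfl) (fun z hz => this z (by omega)) rfl rfl,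
        Extends.of_eq hs rfl (this 2 (by norm_num)) (fun _ _ => rfl)⟩
    have step : ∀ {s : State} {x y : ℕ} {v : VecExpr} {d : Plane}, Context N p ω i j k s →
        Sound ω (Set.range p) s → 3 ≤ x → 3 ≤ y → v.Determined N p ω i j k d →
        (setVec x y v).exec s =
          { s with real := Function.update (Function.update s.real x (d 0)) y (d 1) } := by
      intro s x y v d h hs hx hy hv
      have h1 := congrArg (fun q : Plane => q 1) (hv _ (upd (a := v.1.eval s) (b := v.1.eval s)
        h hs hx hx).1)
      have h2 := congrArg (fun q : Plane => q 0) (hv _ h)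
      simp only [← VecExpr.eval_snd, ← VecExpr.eval_fst, Function.update_idem] at h1 h2
      rw [h2] at h1
      simp only [setVec, Program.exec, h1, h2]
    obtain ⟨c1, x1⟩ := upd (a := d 0) (b := d 1) h hs (x := 9) (y := 10) (by norm_num) (by norm_num)
    obtain ⟨c2, x2⟩ := upd (a := f 0) (b := f 1) c1 x1.1 (x := 11) (y := 12) (by norm_num)
      (by norm_num)
    have e1 := step h hs (x := 9) (y := 10) (by norm_num) (by norm_num) hd
    have e2 := step c1 x1.1 (x := 11) (y := 12) (by norm_num) (by norm_num) hf
    rw [← e1] at e2 c1 x1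
    set s2 := (setVec 11 12 v.2).exec ((setVec 9 10 v.1).exec s) with hs2
    have ed : regD.eval s2 = d := by apply plane_ext <;> simp [e2, e1, regD]
    have ef : regF.eval s2 = f := by apply plane_ext <;> simp [e2, regF]
    rw [← e1, ← e2] at c2 x2
    obtain ⟨c3, x3, r3⟩ := tryCandidate_spec hP c2 hi hj hk x2.1
    obtain ⟨c4, x4, r4⟩ := ih (fun v hv => hl v (by simp [hv])) c3 x3.1
    have ex : (tryAll (v :: l)).exec s = (tryAll l).exec (tryCandidate.exec s2) := rfl
    rw [ex]
    refine ⟨c4, ((x1.trans x2).trans x3).trans x4, ?_⟩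
    intro w hw A B C hm hL
    rcases List.mem_cons.1 hw with rfl | hw
    · rw [hd s h, hf s h, ← ed, ← ef] at hL
      exact x4.2 _ _ _ hm (r3 A B C hm hL)
    · obtain ⟨d', f', hd', hf'⟩ := hl w (by simp [hw])
      rw [hd' s h, hf' s h, ← hd' _ c3, ← hf' _ c3] at hL
      exact r4 w hw A B C hm hL

theorem emit_spec (hP : IsPolygon N p) (h : Context N p ω i j k s)
    (hi : 1 ≤ i ∧ i + 1 < 5 * N) (hj : 1 ≤ j ∧ j + 1 < 5 * N) (hk : 1 ≤ k ∧ k + 1 < 5 * N)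
    (hs : Sound ω (Set.range p) s) :
    Context N p ω i j k (emit.exec s) ∧ Extends ω (Set.range p) s (emit.exec s) ∧
    ∀ A B C d f, Minimal ω (Set.range p) A B C → IsCandidate ω p i j k d f →
      SideLines ω A B C d f (p i) (p j) (p k) → Recorded (emit.exec s) A B C := by
  have vtx : ∀ {e : NatExpr} {m : ℕ}, (∀ s, Context N p ω i j k s → e.eval s = m) → m < 5 * N →
      (vertexExpr e).Determined N p ω i j k (p m) := by
    intro e m he hm s h
    rw [h.vertex (by rwa [he s h]), he s h]
  have v1 := vtx (e := .reg 2) (fun s h => h.i_eq) (by omega)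
  have v2 := vtx (e := .reg 3) (fun s h => h.j_eq) (by omega)
  have v3 := vtx (e := .reg 4) (fun s h => h.k_eq) (by omega)
  have v4 := vtx (e := .reg 2 - .const 1) (m := i - 1) (fun s h => by simp [h.i_eq]) (by omega)
  have v5 := vtx (e := .reg 3 - .const 1) (m := j - 1) (fun s h => by simp [h.j_eq]) (by omega)
  have v6 := vtx (e := .reg 4 + .const 1) (m := k + 1) (fun s h => by simp [h.k_eq]) (by omega)
  have hrot : ∀ {v : VecExpr} {s}, Context N p ω i j k s →
      (VecExpr.rotate v).eval s = rotate ω (v.eval s) := by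
    intro v s h
    simp [VecExpr.rotate, rotate, h.cos_eq, h.sin_eq]
  have hcd : ∀ {r : Fin 4} {e P Q M : VecExpr} {s}, Context N p ω i j k s →
      (VecExpr.criticalDir r e P Q M).eval s =
        criticalDir ω r (e.eval s) (P.eval s) (Q.eval s) (M.eval s) := fun h =>
    VecExpr.eval_criticalDir _ _ _ _ _ _ h.cos_eq h.sin_eq
  obtain ⟨c, x, r⟩ := tryAll_spec hP hi hj hk (l := directionExprs) (by
    intro v hv
    refine ⟨v.1.eval s, v.2.eval s, ?_⟩
    simp only [directionExprs, List.mem_cons, List.not_mem_nil, or_false] at hv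
    rcases hv with rfl | rfl | rfl | rfl | rfl | rfl | rfl | rfl <;> constructor <;>
      intro s' h' <;>
      simp only [VecExpr.eval_sub, VecExpr.eval_rot, VecExpr.eval_midDir, hrot h, hrot h', hcd h,
        hcd h', v1 s h, v2 s h, v3 s h, v4 s h, v5 s h, v6 s h, v1 s' h', v2 s' h', v3 s' h',
        v4 s' h', v5 s' h', v6 s' h', RealExpr.eval_reg, RealExpr.eval_sub, h.cos_eq, h.sin_eq,
        h'.cos_eq, h'.sin_eq, RealExpr.eval_const]) h hs
  refine ⟨c, x, fun A B C d f hm hc hL => ?_⟩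
  suffices ∃ v ∈ directionExprs, v.1.eval s = d ∧ v.2.eval s = f by
    obtain ⟨v, hv, rfl, rfl⟩ := this
    exact r v hv A B C hm hL
  rcases hc with ⟨rfl | rfl, rfl | rfl⟩ | ⟨r, rfl, rfl⟩
  · refine ⟨_, List.mem_cons_self, ?_⟩
    simp [v1 s h, v3 s h, v4 s h, v6 s h]
  · refine ⟨_, .tail _ (.tail _ (.head _)), ?_⟩
    simp [v1 s h, v2 s h, v3 s h, v4 s h, hrot h]
  · refine ⟨_, .tail _ (.head _), ?_⟩
    simp [v2 s h, v3 s h, v5 s h, v6 s h, h.cos_eq, h.sin_eq]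
  · refine ⟨_, .tail _ (.tail _ (.tail _ (.head _))), ?_⟩
    simp [v1 s h, v2 s h, v3 s h, v5 s h, hrot h, h.cos_eq, h.sin_eq]
  · let e := VecExpr.sub (vertexExpr (.reg 4 + .const 1)) (vertexExpr (.reg 4))
    refine ⟨(VecExpr.criticalDir r e (vertexExpr (.reg 2)) (vertexExpr (.reg 3))
      (vertexExpr (.reg 4)), e), ?_, ?_⟩
    rotate_left
    · simp only [hcd h]
      simp [e, v1 s h, v2 s h, v3 s h, v6 s h]
    · fin_cases r <;> simp [directionExprs, e]

end

end FixedAngleTriangle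

/-! ### The sweep around a convex polygon -/

namespace FixedAngleTriangle

open Real RealRAM

section

variable {N : ℕ} {p : ℕ → Plane} {α r : ℕ → ℝ} {ω φ : ℝ} {i j k : ℕ} {s : State}

theorem sin_nonpos_iff {x : ℝ} (h1 : -π < x) (h2 : x < π) : sin x ≤ 0 ↔ x ≤ 0 :=
  ⟨fun h => not_lt.1 fun hx => absurd (sin_pos_of_pos_of_lt_pi hx h2) (not_lt.2 h),
    fun h => sin_nonpos_of_nonpos_of_neg_pi_le h h1.le⟩

theorem mul_nonpos_iff_of_pos {c x : ℝ} (hc : 0 < c) : c * x ≤ 0 ↔ x ≤ 0 := by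
  rw [← not_lt, mul_pos_iff_of_pos_left hc, not_lt]

theorem mul_neg_iff_of_pos {c x : ℝ} (hc : 0 < c) : c * x < 0 ↔ x < 0 := by
  rw [← not_le, mul_nonneg_iff_of_pos_left hc, not_le]

/-- The machine cannot measure angles; the signs of two cross products decide whether an angle
within one turn exceeds ω + π. -/
theorem sin_neg_and_sin_sub_neg_iff (h0 : 0 < ω) (hπ : ω < π) {x : ℝ} (h1 : 0 < x)
    (h2 : x < 2 * π) : sin x < 0 ∧ sin (x - ω) < 0 ↔ ω + π < x := by
  constructor
  · rintro ⟨h3, h4⟩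
    have h5 : π < x := by
      by_contra h
      exact absurd (sin_nonneg_of_nonneg_of_le_pi h1.le (not_lt.1 h)) (not_le.2 h3)
    by_contra h
    exact absurd (sin_nonneg_of_nonneg_of_le_pi (by linarith) (by linarith)) (not_le.2 h4)
  · intro h
    have h3 := sin_pos_of_pos_of_lt_pi (x := x - π) (by linarith) (by linarith)
    have h4 := sin_pos_of_pos_of_lt_pi (x := x - ω - π) (by linarith) (by linarith)
    rw [sin_sub_pi] at h3 h4
    exact ⟨by linarith, by linarith⟩

theorem rotate_smul_unit (ω ρ θ : ℝ) : rotate ω (ρ • unit θ) = ρ • unit (θ + ω) := by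
  rw [rotate, rot_smul, rot_unit]

theorem cr_smul_unit (a b θ χ : ℝ) : cr (a • unit θ) (b • unit χ) = a * b * sin (χ - θ) := by
  rw [cr_smul_left, cr_smul_right, cr_unit_unit, mul_assoc]

/-- The position of the sweep: with the side `AB` in the direction `φ`, the two sides at `A` touch
the polygon at the vertices number `i` and `j`. -/
structure Position (N : ℕ) (α : ℕ → ℝ) (ω : ℝ) (i j k : ℕ) (φ : ℝ) : Prop where
  i_ge : N ≤ i
  i_le : i ≤ 2 * N
  j_ge : N ≤ j
  k_ge : N ≤ k
  le_i : φ ≤ α i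
  i_pred : α (i - 1) ≤ φ
  le_j : φ + ω + π ≤ α j
  j_pred : α (j - 1) ≤ φ + ω + π
  k_pred : α (k - 1) < φ + π

namespace Position

theorem lt_succ (hα : IsLift N p α r) {m : ℕ} (hm : 1 ≤ m) : α m < α (m - 1) + π := by
  obtain ⟨m, rfl⟩ := Nat.exists_eq_add_of_le' hm
  exact hα.lt_pi m

/-- The sign of one cross product tells whether AB or CA is the first to contain an edge. This is
legitimate because the two remaining turns are both less than π, so their difference lies between -π
and π. -/
theorem next_iff (hα : IsLift N p α r) (hN : 3 ≤ N) (h : Position N α ω i j k φ) :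
    cr (rotate ω (p (i + 1) - p i)) (p (j + 1) - p j) ≤ 0 ↔ α i + ω + π ≤ α j := by
  have h1 := lt_succ hα (hN.trans h.i_ge |>.trans' (by norm_num))
  have h2 := lt_succ hα (hN.trans h.j_ge |>.trans' (by norm_num))
  have h3 := h.le_i
  have h4 := h.i_pred
  have h5 := h.le_j
  have h6 := h.j_pred
  have : sin (α j - (α i + ω)) = sin (α i + ω + π - α j) := by
    rw [← sin_pi_sub]; ring_nf
  rw [hα.edge, hα.edge, rotate_smul_unit, cr_smul_unit,
    mul_nonpos_iff_of_pos (mul_pos (hα.pos i) (hα.pos j)), this,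
    sin_nonpos_iff (by linarith) (by linarith), sub_nonpos]

/-- The three contacts are never more than about one turn apart, so all indices stay inside the
arrays of length `5 N`. -/
theorem bounds (hα : IsLift N p α r) (hN : 3 ≤ N) (hπ : ω < π) (h : Position N α ω i j k φ)
    (hi : i < 2 * N) : j < 4 * N ∧ k < 4 * N := by
  have h1 : α i ≤ α (N - 1 + N) := hα.strictMono.monotone (by omega)
  have h2 := hα.period (N - 1 + N)
  have h3 := h.le_i
  have h4 := h.j_pred
  have h5 := h.k_pred
  constructor
  · have : α (j - 1) < α (N - 1 + N + N) := by linarith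
    have := hα.strictMono.lt_iff_lt.1 this
    omega
  · have : α (k - 1) < α (N - 1 + N + N) := by linarith [pi_pos]
    have := hα.strictMono.lt_iff_lt.1 this
    omega

theorem k_lt (hα : IsLift N p α r) (hN : 3 ≤ N) (h : Position N α ω i j k φ) :
    α k < φ + 2 * π := by
  have h1 := lt_succ hα (hN.trans h.k_ge |>.trans' (by norm_num))
  linarith [h.k_pred]

end Position

/-- Cross products see directions only modulo a full turn. The comparison of indices settles the
edges with `α k ≤ φ`; for the others, `α k` lies between `φ` and `φ + 2π`, and the sign of the cross
product with `d` decides whether it is below `φ + π`. The length of `d` cancels. -/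
theorem beyond_iff (hα : IsLift N p α r) (hP : IsPolygon N p) (h0 : 0 < ω) (hπ : ω < π)
    (hi : 1 ≤ i) (hj : 1 ≤ j) (h1 : φ ≤ α i) (h2 : α (i - 1) ≤ φ) (h3 : φ + ω + π ≤ α j)
    (h4 : α (j - 1) ≤ φ + ω + π) (h5 : α k < φ + 2 * π) {i' : ℕ} (h6 : k < i' → α k ≤ φ)
    (h7 : i' ≤ k → φ < α k) {ρ : ℝ} (hρ : 0 < ρ) {d : Plane} (hd : d = ρ • unit φ) :
    (k < i' ∨ 0 < cr d (p (k + 1) - p k) ∧ (cr (rotate ω d) (p (k + 1) - p k) ≤ 0 ∨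
      cr d (p (k + 1) - p i) * cr (rotate ω d) (p (k + 1) - p k) <
        (0 - cr (rotate ω d) (p (k + 1) - p j)) * cr d (p (k + 1) - p k))) ↔
      Beyond ω p α φ k := by
  have w1 : width p φ (p (k + 1)) = cr (unit φ) (p (k + 1) - p i) := by
    obtain ⟨i, rfl⟩ := Nat.exists_eq_add_of_le' hi
    exact width_eq (hα.contact hP h2 h1) _
  have w2 : width p (φ + ω + π) (p (k + 1)) = - cr (unit (φ + ω)) (p (k + 1) - p j) := by
    obtain ⟨j, rfl⟩ := Nat.exists_eq_add_of_le' hj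
    rw [width_eq (hα.contact hP h4 h3), cr_unit_add_pi, Nat.add_sub_cancel]
  have hk := hα.pos k
  rw [hd, rotate_smul_unit, hα.edge k, cr_smul_unit, cr_smul_unit, Beyond, w1, w2, cr_smul_left,
    cr_smul_left]
  set a := cr (unit φ) (p (k + 1) - p i)
  set b := cr (unit (φ + ω)) (p (k + 1) - p j)
  by_cases hki : k < i'
  · have := h6 hki
    simp only [hki, true_or, true_iff]
    left; linarith
  have h8 := h7 (not_lt.1 hki)
  simp only [hki, false_or]
  have hρr : 0 < ρ * r k := mul_pos hρ hk
  have e1 : 0 < ρ * r k * sin (α k - φ) ↔ α k < φ + π := by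
    rw [mul_pos_iff_of_pos_left hρr]
    constructor
    · intro h
      by_contra h'
      have := sin_nonneg_of_nonneg_of_le_pi (x := α k - φ - π) (by linarith) (by linarith)
      rw [sin_sub_pi] at this
      linarith
    · intro h
      exact sin_pos_of_pos_of_lt_pi (by linarith) (by linarith)
  rw [e1]
  have e2 : ρ * a * (ρ * r k * sin (α k - (φ + ω))) <
      (0 - ρ * b) * (ρ * r k * sin (α k - φ)) ↔
      a * sin (α k - (φ + ω)) < - b * sin (α k - φ) := by
    rw [← mul_lt_mul_iff_right₀ (mul_pos hρ hρr) (b := a * _)]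
    ring_nf
  rw [e2]
  by_cases h9 : α k < φ + π
  · have e3 : ρ * r k * sin (α k - (φ + ω)) ≤ 0 ↔ α k ≤ φ + ω := by
      rw [mul_nonpos_iff_of_pos hρr, sin_nonpos_iff (by linarith) (by linarith)]
      constructor <;> intro h <;> linarith
    rw [e3]
    simp only [h9, true_and]
  · simp only [h9, false_and, or_false, false_iff]
    linarith

/-- A triangle that the sweep still has to find. -/
def Pending (N : ℕ) (p : ℕ → Plane) (α : ℕ → ℝ) (ω : ℝ) (i j k : ℕ) (A B C : Plane) : Prop :=
  ∃ φ i' j' k', i ≤ i' ∧ j ≤ j' ∧ k ≤ k' ∧ i' < 2 * N ∧ α (i' - 1) ≤ φ ∧ φ < α i' ∧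
    α (j' - 1) ≤ φ + ω + π ∧ φ + ω + π < α j' ∧ IsBase ω p α φ k' ∧
    ∃ d f, IsCandidate ω p i' j' k' d f ∧ SideLines ω A B C d f (p i') (p j') (p k')

namespace Pending

variable {A B C : Plane}

/-- Suppose the triple still to come is not the current one, and let χ be its direction. If `k` is
not to change, then `i` or `j` is, so χ is at least `φ`; hence `Beyond` at `φ` would persist at χ
and contradict `not_beyond`. If `Beyond` fails at `φ`, then χ is again at least `φ`: otherwise `k`
would have to advance, `beyond_of_lt` would give `Beyond` at χ, and it would persist at `φ`. So the
contact that is next in turn may be passed. -/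
theorem advance (hα : IsLift N p α r) (hP : IsPolygon N p) (h0 : 0 < ω)
    (h : Pending N p α ω i j k A B C) (h1 : α (i - 1) ≤ φ) (h2 : φ ≤ α i)
    (h3 : φ + ω + π ≤ α j) :
    (∃ d f, IsCandidate ω p i j k d f ∧ SideLines ω A B C d f (p i) (p j) (p k)) ∨
    (Beyond ω p α φ k → Pending N p α ω i j (k + 1) A B C) ∧
    (¬ Beyond ω p α φ k → (φ = α i → Pending N p α ω (i + 1) j k A B C) ∧
      (φ + ω + π = α j → Pending N p α ω i (j + 1) k A B C)) := by
  obtain ⟨χ, i', j', k', hi, hj, hk, hi', a1, a2, b1, b2, hb, hc⟩ := h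
  by_cases he : i = i' ∧ j = j' ∧ k = k'
  · obtain ⟨rfl, rfl, rfl⟩ := he
    exact Or.inl hc
  right
  have hle : k = k' → φ ≤ χ := by
    intro hkk
    by_cases hii : i = i'
    · have : α j ≤ α (j' - 1) := hα.strictMono.monotone (by omega)
      linarith
    · have : α i ≤ α (i' - 1) := hα.strictMono.monotone (by omega)
      linarith
  constructor
  · intro hB
    refine ⟨χ, i', j', k', hi, hj, Nat.lt_of_le_of_ne hk ?_, hi', a1, a2, b1, b2, hb, hc⟩
    rintro rfl
    exact hα.not_beyond hP h0 a1 hb (hα.beyond_mono hP h0 h1 (hle rfl) hB)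
  · intro hB
    have hφχ : φ ≤ χ := by
      rcases hk.eq_or_lt with hk | hk
      · exact hle hk
      · by_contra h
        exact hB (hα.beyond_mono hP h0 a1 (not_le.1 h).le (hα.beyond_of_lt h0 hb hk))
    constructor
    · intro h
      exact ⟨χ, i', j', k', hα.strictMono.lt_iff_lt.1 (by linarith), hj, hk, hi', a1, a2, b1, b2,
        hb, hc⟩
    · intro h
      exact ⟨χ, i', j', k', hi, hα.strictMono.lt_iff_lt.1 (by linarith), hk, hi', a1, a2, b1, b2,
        hb, hc⟩

end Pending

theorem Minimal.pending (hα : IsLift N p α r) (hP : IsPolygon N p) (h0 : 0 < ω) (hπ : ω < π)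
    {A B C : Plane} (h : Minimal ω (Set.range p) A B C)
    (hj : ∀ m, α (N - 1) + ω + π < α m → j ≤ m) : Pending N p α ω N j N A B C := by
  have hN := hP.three
  -- One turn of φ that starts at the edge `N - 1` makes the contact vertex of AB run from `N` to `2
  -- N - 1`.
  obtain ⟨φ, i, j', k, h1, h2, a1, a2, b1, b2, hb, hc⟩ := h.exists_candidate hα hP h0 hπ (N - 1)
  have hb' := hb
  obtain ⟨ψ, c1, -, -, c2, -⟩ := hb'
  have e1 : N - 1 < i + 1 := hα.strictMono.lt_iff_lt.1 (by linarith)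
  have e2 : N - 1 < k := hα.strictMono.lt_iff_lt.1 (by linarith)
  have e3 : i < N - 1 + N := hα.strictMono.lt_iff_lt.1 (by rw [hα.period]; linarith)
  exact ⟨φ, i + 1, j' + 1, k, by omega, hj _ (by linarith), by omega, by omega, a1, a2, b1, b2,
    hb, hc⟩

end

end FixedAngleTriangle

/-! ### The algorithm for a convex polygon in counterclockwise order -/

namespace FixedAngleTriangle

open Real RealRAM

/-- Repeat the vertices of the polygon up to the index `5 N`. -/
def unroll : Program :=
  .seq (.setNat 2 (.reg 1)) (.loop
    (.natLt (.reg 2) (.reg 1 + .reg 1 + .reg 1 + .reg 1 + .reg 1))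
    (.seq (.writeReal 6 (.reg 2) (.read 6 (.reg 2 - .reg 1)))
      (.seq (.writeReal 7 (.reg 2) (.read 7 (.reg 2 - .reg 1))) (.setNat 2 (.reg 2 + .const 1)))))

/-- The edge of the polygon whose number is stored in a register. -/
def edgeExpr (x : ℕ) : VecExpr :=
  VecExpr.sub (vertexExpr (.reg x + .const 1)) (vertexExpr (.reg x))

/-- The edge of the polygon with the number `N - 1`. -/
def firstEdge : VecExpr := VecExpr.sub (vertexExpr (.reg 1)) (vertexExpr (.reg 1 - .const 1))

/-- Find the vertex where the side `CA` touches when `AB` has the direction of the first edge. -/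
def findOpposite : Program :=
  .seq (.seq (.setNat 2 (.reg 1)) (.setNat 3 (.reg 1))) (.loop
    (.and (.natLt (.reg 3 + .const 1) (.reg 1 + .reg 1))
      (.not (.and (.realLt (VecExpr.cr firstEdge (edgeExpr 3)) (.const 0))
        (.realLt (VecExpr.cr (VecExpr.rotate firstEdge) (edgeExpr 3)) (.const 0)))))
    (.setNat 3 (.reg 3 + .const 1)))

/-- Compute the next direction where one of the sides at `A` contains an edge, and the vertices of
contact afterwards. -/
def findNext : Program :=
  .ite (.realLt (.const 0) (VecExpr.cr (VecExpr.rotate (edgeExpr 2)) (edgeExpr 3)))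
    (.seq (setVec 9 10 (VecExpr.rot (.const 0 - .reg 0) (.reg 1) (edgeExpr 3)))
      (.seq (.setNat 6 (.reg 2)) (.setNat 7 (.reg 3 + .const 1))))
    (.seq (setVec 9 10 (edgeExpr 2)) (.seq (.setNat 6 (.reg 2 + .const 1)) (.setNat 7 (.reg 3))))

/-- The test that the side `BC` has to move on before the next direction is reached. -/
def beyondTest : Test :=
  let q := vertexExpr (.reg 4 + .const 1)
  let c := VecExpr.cr regD (edgeExpr 4)
  let c' := VecExpr.cr (VecExpr.rotate regD) (edgeExpr 4)
  .or (.natLt (.reg 4) (.reg 6)) (.and (.realLt (.const 0) c) (.or (.not (.realLt (.const 0) c'))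
    (.realLt (VecExpr.cr regD (VecExpr.sub q (vertexExpr (.reg 2))) * c')
      ((.const 0 - VecExpr.cr (VecExpr.rotate regD) (VecExpr.sub q (vertexExpr (.reg 3)))) * c))))

/-- Move on to the next vertices of contact. -/
def moveOn : Program :=
  .ite beyondTest (.setNat 4 (.reg 4 + .const 1)) (.seq (.setNat 2 (.reg 6)) (.setNat 3 (.reg 7)))

/-- The algorithm for a polygon that is stored in counterclockwise order. -/
def sweep : Program :=
  .seq unroll (.seq findOpposite (.seq
    (.seq (.seq (.setNat 4 (.reg 1)) (.setNat 5 (.const 0)))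
      (.loop (.natLt (.reg 2) (.reg 1 + .reg 1)) (.seq emit (.seq findNext moveOn))))
    (.setNat 0 (.reg 5))))

section

variable {N : ℕ} {p : ℕ → Plane} {α r : ℕ → ℝ} {ω φ : ℝ} {i j k : ℕ} {s : State}

/-- The configuration holds the polygon `p 0, …, p (N - 1)` and the angle. -/
structure Holds (N : ℕ) (p : ℕ → Plane) (ω : ℝ) (s : State) : Prop where
  size : s.nat 1 = N
  x_eq : ∀ m < N, s.realArr 6 m = p m 0
  y_eq : ∀ m < N, s.realArr 7 m = p m 1
  cos_eq : s.real 0 = cos ω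
  sin_eq : s.real 1 = sin ω

theorem exists_unroll_spec : ∃ K, ∀ (N : ℕ) (p : ℕ → Plane) (ω : ℝ) (s : State),
    (∀ m, p (m + N) = p m) → 1 ≤ N → Holds N p ω s →
    Does unroll s (K * N) fun s' => ∃ i j k, Context N p ω i j k s' := by
  refine ⟨_, fun N p ω s hp hN h => Does.mono (Does.setup_loop
      (by exact trivial) (by exact ⟨trivial, trivial, trivial⟩)
      (fun s => s.nat 1 = N ∧ N ≤ s.nat 2 ∧ (∀ m < s.nat 2, s.realArr 6 m = p m 0) ∧
        (∀ m < s.nat 2, s.realArr 7 m = p m 1) ∧ s.real 0 = cos ω ∧ s.real 1 = sin ω)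
      (fun s => 5 * N - s.nat 2) ?_ ?_ 5 hN (Nat.sub_le _ _)) le_rfl ?_⟩
  · rintro s ⟨h1, h2, h3, h4, h5, h6⟩ hb
    simp only [Test.Holds, NatExpr.eval_reg, NatExpr.eval_add, h1] at hb
    have hm : p (s.nat 2) = p (s.nat 2 - N) := by
      conv_lhs => rw [← Nat.sub_add_cancel h2]
      exact hp _
    simp only [Program.exec]
    refine ⟨⟨by simpa using h1, by simp; omega, ?_, ?_, h5, h6⟩, by simp; omega⟩
    · intro m hm'
      simp only [NatExpr.eval_add, NatExpr.eval_reg, NatExpr.eval_const,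
        Function.update_self] at hm'
      rcases Nat.lt_succ_iff_lt_or_eq.1 hm' with h | rfl
      · simp [h.ne, h3 _ h]
      · simp [h1, hm, h3 (s.nat 2 - N) (by omega)]
    · intro m hm'
      simp only [NatExpr.eval_add, NatExpr.eval_reg, NatExpr.eval_const,
        Function.update_self] at hm'
      rcases Nat.lt_succ_iff_lt_or_eq.1 hm' with h | rfl
      · simp [h.ne, h4 _ h]
      · simp [h1, hm, h4 (s.nat 2 - N) (by omega)]
  · simp [Program.exec, h.size, h.cos_eq, h.sin_eq]
    exact ⟨h.x_eq, h.y_eq⟩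
  · rintro s' ⟨⟨h1, h2, h3, h4, h5, h6⟩, hb⟩
    simp only [Test.Holds, NatExpr.eval_reg, NatExpr.eval_add, h1] at hb
    exact ⟨_, _, _, h1, rfl, rfl, rfl, fun m hm => h3 m (by omega), fun m hm => h4 m (by omega),
      h5, h6⟩

/-- The values of the edges. -/
theorem Context.edge (h : Context N p ω i j k s) {x m : ℕ} (hx : s.nat x = m)
    (hm : m + 1 < 5 * N) : (edgeExpr x).eval s = p (m + 1) - p m := by
  rw [edgeExpr, VecExpr.eval_sub, h.vertex (by simpa [hx] using hm),
    h.vertex (by simp [hx]; omega)]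
  simp [hx]

theorem Context.eval_rotate (h : Context N p ω i j k s) (v : VecExpr) :
    (VecExpr.rotate v).eval s = rotate ω (v.eval s) := by
  simp [VecExpr.rotate, rotate, h.cos_eq, h.sin_eq]

/-- A linear search. It may stop untested at `2 N - 1`, whose edge is a full turn, hence more than ω
+ π, ahead of the edge `N - 1`. -/
theorem exists_findOpposite_spec : ∃ K, ∀ (N : ℕ) (p : ℕ → Plane) (α r : ℕ → ℝ) (ω : ℝ)
    (i j k : ℕ) (s : State), IsLift N p α r → 3 ≤ N → 0 < ω → ω < π →
    Context N p ω i j k s → Does findOpposite s (K * N) fun s' => ∃ j k, Context N p ω N j k s' ∧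
      N ≤ j ∧ α (j - 1) ≤ α (N - 1) + ω + π ∧ α (N - 1) + ω + π < α j := by
  refine ⟨_, fun N p α r ω i j k s hα hN h0 hπ h => Does.mono (Does.setup_loop
      (by exact ⟨trivial, trivial⟩) (by exact trivial)
      (fun s => ∃ j k, Context N p ω N j k s ∧ N ≤ j ∧ j < 2 * N ∧
        α (j - 1) ≤ α (N - 1) + ω + π)
      (fun s => 2 * N - s.nat 3) ?_ ?_ 2 (by omega) (Nat.sub_le _ _)) le_rfl ?_⟩
  · rintro s ⟨j, k, h, h1, h2, h3⟩ ⟨hb1, hb2⟩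
    have e1 := h.edge h.j_eq (by omega)
    have e2 : firstEdge.eval s = p (N - 1 + 1) - p (N - 1) := by
      rw [firstEdge, VecExpr.eval_sub, h.vertex (by simp [h.size]; omega),
        h.vertex (by simp [h.size]; omega)]
      simp [h.size, show N - 1 + 1 = N by omega]
    simp only [Test.Holds, NatExpr.eval_reg, NatExpr.eval_add, NatExpr.eval_const, h.size, h.j_eq]
      at hb1
    simp only [Test.Holds, VecExpr.eval_cr, RealExpr.eval_const, h.eval_rotate, e1, e2, hα.edge,
      rotate_smul_unit, cr_smul_unit, Rat.cast_zero,
      mul_neg_iff_of_pos (mul_pos (hα.pos (N - 1)) (hα.pos j))] at hb2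
    have h5 : α (N - 1) < α j := hα.strictMono (by omega)
    have h6 : α j < α (N - 1 + N) := hα.strictMono (by omega)
    rw [hα.period] at h6
    rw [← sub_sub, sin_neg_and_sin_sub_neg_iff h0 hπ (by linarith) (by linarith)] at hb2
    refine ⟨⟨j + 1, k, ⟨?_, ?_, ?_, ?_, h.x_eq, h.y_eq, h.cos_eq, h.sin_eq⟩, by omega, by omega,
      ?_⟩, ?_⟩
    · simpa [Program.exec] using h.size
    · simpa [Program.exec] using h.i_eq
    · simpa [Program.exec] using h.j_eq
    · simpa [Program.exec] using h.k_eq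
    · simp only [Nat.add_sub_cancel]; linarith
    · simp only [Program.exec, Function.update_self, NatExpr.eval_add, NatExpr.eval_reg, h.j_eq,
        NatExpr.eval_const]
      omega
  · refine ⟨N, k, ⟨?_, ?_, ?_, ?_, h.x_eq, h.y_eq, h.cos_eq, h.sin_eq⟩, le_rfl, by omega,
      by linarith [pi_pos]⟩
    · simpa [Program.exec] using h.size
    · simpa [Program.exec] using h.size
    · simpa [Program.exec] using h.size
    · simpa [Program.exec] using h.k_eq
  · rintro s ⟨⟨j, k, h, h1, h2, h3⟩, hb⟩
    refine ⟨j, k, h, h1, h3, ?_⟩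
    have e1 := h.edge h.j_eq (by omega)
    have e2 : firstEdge.eval s = p (N - 1 + 1) - p (N - 1) := by
      rw [firstEdge, VecExpr.eval_sub, h.vertex (by simp [h.size]; omega),
        h.vertex (by simp [h.size]; omega)]
      simp [h.size, show N - 1 + 1 = N by omega]
    by_cases hj : j + 1 < N + N
    · have hb2 : _ := not_not.1 (fun hn => hb ⟨by simpa [Test.Holds, h.size, h.j_eq] using hj, hn⟩)
      simp only [Test.Holds, VecExpr.eval_cr, RealExpr.eval_const, h.eval_rotate, e1, e2, hα.edge,
        rotate_smul_unit, cr_smul_unit, Rat.cast_zero,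
        mul_neg_iff_of_pos (mul_pos (hα.pos (N - 1)) (hα.pos j))] at hb2
      have h5 : α (N - 1) < α j := hα.strictMono (by omega)
      have h6 : α j < α (N - 1 + N) := hα.strictMono (by omega)
      rw [hα.period] at h6
      rw [← sub_sub, sin_neg_and_sin_sub_neg_iff h0 hπ (by linarith) (by linarith)] at hb2
      linarith
    · have : j = N - 1 + N := by omega
      rw [this, hα.period]
      linarith

end

end FixedAngleTriangle

/-! ### The invariant of the sweep -/

namespace FixedAngleTriangle

open Real RealRAM

section

variable {N : ℕ} {p : ℕ → Plane} {α r : ℕ → ℝ} {ω φ : ℝ} {i j k : ℕ} {s : State}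

/-- Turning back by ω + π leads from the direction of CA to that of AB. -/
theorem rot_neg_cos_sin_unit (ω θ : ℝ) :
    rot (-cos ω) (sin ω) (unit θ) = unit (θ - ω - π) := by
  apply plane_ext
  · simp [rot, unit, cos_sub]; ring
  · simp [rot, unit, sin_sub]; ring

/-- The next event is at the smaller one of `α i` and `α j - ω - π`; in case of a tie, `i` moves
first. Only a positive multiple of the unit vector is computed, so no square root is needed. -/
theorem findNext_spec (hα : IsLift N p α r) (hN : 3 ≤ N) (hπ : ω < π)
    (h : Context N p ω i j k s) (hp : Position N α ω i j k φ) (hi : i < 2 * N) :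
    ∃ (s' : State) (φ' ρ : ℝ) (i' j' : ℕ), findNext.exec s = s' ∧ Context N p ω i j k s' ∧
      s'.nat 5 = s.nat 5 ∧ s'.real 2 = s.real 2 ∧ s'.realArr = s.realArr ∧ s'.nat 6 = i' ∧
      s'.nat 7 = j' ∧ 0 < ρ ∧ regD.eval s' = ρ • unit φ' ∧ φ ≤ φ' ∧ φ' ≤ α i ∧
      φ' + ω + π ≤ α j ∧ (i' = i + 1 ∧ j' = j ∧ φ' = α i ∨
        i' = i ∧ j' = j + 1 ∧ φ' + ω + π = α j ∧ φ' < α i) := by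
  obtain ⟨hj, hk⟩ := hp.bounds hα hN hπ hi
  have e2 := h.edge h.i_eq (by omega)
  have e3 := h.edge h.j_eq (by omega)
  have ht := hp.next_iff hα hN
  by_cases hc : α i + ω + π ≤ α j
  · have hn : ¬ (Test.realLt (.const 0)
        (VecExpr.cr (VecExpr.rotate (edgeExpr 2)) (edgeExpr 3))).Holds s := by
      simpa [Test.Holds, h.eval_rotate, e2, e3] using ht.2 hc
    have hex : findNext.exec s = Program.exec (.seq (setVec 9 10 (edgeExpr 2))
        (.seq (.setNat 6 (.reg 2 + .const 1)) (.setNat 7 (.reg 3)))) s := if_neg hn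
    rw [hex]
    refine ⟨_, α i, r i, _, _, rfl, h.of_eq ?_ ?_ rfl rfl, ?_, ?_, rfl, rfl, rfl, hα.pos i, ?_,
      hp.le_i, le_rfl, hc, Or.inl ⟨?_, ?_, rfl⟩⟩
    · intro x hx
      simp [setVec, Program.exec, show x ≠ 6 by omega, show x ≠ 7 by omega]
    · intro x hx
      simp [setVec, Program.exec, show x ≠ 9 by omega, show x ≠ 10 by omega]
    · simp [setVec, Program.exec]
    · simp [setVec, Program.exec]
    · rw [← hα.edge, ← e2]
      apply plane_ext <;>
        simp [setVec, Program.exec, regD, VecExpr.eval_fst, VecExpr.eval_snd, edgeExpr, vertexExpr]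
    · simp [setVec, Program.exec, h.i_eq]
    · simp [setVec, Program.exec, h.j_eq]
  · have hn : (Test.realLt (.const 0)
        (VecExpr.cr (VecExpr.rotate (edgeExpr 2)) (edgeExpr 3))).Holds s := by
      simpa [Test.Holds, h.eval_rotate, e2, e3] using not_le.1 (mt ht.1 hc)
    have hex : findNext.exec s = Program.exec (.seq
        (setVec 9 10 (VecExpr.rot (.const 0 - .reg 0) (.reg 1) (edgeExpr 3)))
        (.seq (.setNat 6 (.reg 2)) (.setNat 7 (.reg 3 + .const 1)))) s := if_pos hn
    rw [hex]
    refine ⟨_, α j - ω - π, r j, _, _, rfl, h.of_eq ?_ ?_ rfl rfl, ?_, ?_, rfl, rfl, rfl,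
      hα.pos j, ?_, by linarith [hp.le_j], by linarith, by linarith,
      Or.inr ⟨?_, ?_, by ring, by linarith⟩⟩
    · intro x hx
      simp [setVec, Program.exec, show x ≠ 6 by omega, show x ≠ 7 by omega]
    · intro x hx
      simp [setVec, Program.exec, show x ≠ 9 by omega, show x ≠ 10 by omega]
    · simp [setVec, Program.exec]
    · simp [setVec, Program.exec]
    · rw [← rot_neg_cos_sin_unit, ← rot_smul, ← hα.edge, ← e3, ← h.cos_eq, ← h.sin_eq]
      apply plane_ext <;>
        simp [setVec, Program.exec, regD, VecExpr.eval_fst, VecExpr.eval_snd, edgeExpr,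
          vertexExpr]
    · simp [setVec, Program.exec, h.i_eq]
    · simp [setVec, Program.exec, h.j_eq]

theorem beyondTest_holds (h : Context N p ω i j k s) (hi : i < 5 * N) (hj : j < 5 * N)
    (hk : k + 1 < 5 * N) : beyondTest.Holds s ↔
    (k < s.nat 6 ∨ 0 < cr (regD.eval s) (p (k + 1) - p k) ∧
      (cr (rotate ω (regD.eval s)) (p (k + 1) - p k) ≤ 0 ∨
      cr (regD.eval s) (p (k + 1) - p i) * cr (rotate ω (regD.eval s)) (p (k + 1) - p k) <
        (0 - cr (rotate ω (regD.eval s)) (p (k + 1) - p j)) *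
          cr (regD.eval s) (p (k + 1) - p k))) := by
  have e4 := h.edge h.k_eq hk
  have v4 : (vertexExpr (.reg 4 + .const 1)).eval s = p (k + 1) := by
    rw [h.vertex (by simpa [h.k_eq] using hk)]; simp [h.k_eq]
  have v2 : (vertexExpr (.reg 2)).eval s = p i := by
    rw [h.vertex (by simpa [h.i_eq] using hi)]; simp [h.i_eq]
  have v3 : (vertexExpr (.reg 3)).eval s = p j := by
    rw [h.vertex (by simpa [h.j_eq] using hj)]; simp [h.j_eq]
  simp [beyondTest, Test.Holds, h.eval_rotate, e4, v4, v2, v3, h.k_eq]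

/-- The invariant of the sweep. -/
def SweepInv (N : ℕ) (p : ℕ → Plane) (α : ℕ → ℝ) (ω : ℝ) (s : State) : Prop :=
  ∃ i j k φ, Context N p ω i j k s ∧ Position N α ω i j k φ ∧ Sound ω (Set.range p) s ∧
    ∀ A B C, Minimal ω (Set.range p) A B C → Recorded s A B C ∨ Pending N p α ω i j k A B C

/-- Every round tries the current triple and then advances exactly one of the three contacts by one,
so the sum of the remaining distances drops. -/
theorem sweep_step (hα : IsLift N p α r) (hP : IsPolygon N p) (h0 : 0 < ω) (hπ : ω < π)
    (h : SweepInv N p α ω s) (hi : s.nat 2 < 2 * N) :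
    let s' := (Program.seq emit (.seq findNext moveOn)).exec s
    SweepInv N p α ω s' ∧
      2 * N - s'.nat 2 + (4 * N - s'.nat 3) + (4 * N - s'.nat 4) <
        2 * N - s.nat 2 + (4 * N - s.nat 3) + (4 * N - s.nat 4) := by
  obtain ⟨i, j, k, φ, h, hp, hs, hr⟩ := h
  have hN := hP.three
  rw [h.i_eq] at hi ⊢
  rw [h.j_eq, h.k_eq]
  obtain ⟨hj, hk⟩ := hp.bounds hα hN hπ hi
  have hi1 := hp.i_ge
  have hj1 := hp.j_ge
  have hk1 := hp.k_ge
  obtain ⟨c1, x1, r1⟩ := emit_spec hP h ⟨by omega, by omega⟩ ⟨by omega, by omega⟩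
    ⟨by omega, by omega⟩ hs
  obtain ⟨s2, φ', ρ, i', j', e2, c2, n2, a2, b2, hi', hj', hρ, hd, q1, q2, q3, q4⟩ :=
    findNext_spec hα hN hπ c1 hp hi
  have x2 : Extends ω (Set.range p) s s2 :=
    x1.trans (.of_eq x1.1 n2 a2 fun a _ => by rw [b2])
  have hp' : Position N α ω i j k φ' := ⟨hi1, hp.i_le, hj1, hk1, q2, hp.i_pred.trans q1, q3,
    by linarith [hp.j_pred], by linarith [hp.k_pred]⟩
  have hB := beyond_iff (i' := i') (k := k) hα hP h0 hπ (by omega) (by omega) q2 hp'.i_pred q3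
    hp'.j_pred (hp'.k_lt hα hN)
    (fun hki => by
      rcases q4 with ⟨rfl, -, h⟩ | ⟨rfl, -, -, -⟩
      · rw [h]; exact hα.strictMono.monotone (by omega)
      · exact (hα.strictMono.monotone (show k ≤ i' - 1 by omega)).trans hp'.i_pred)
    (fun hki => by
      rcases q4 with ⟨rfl, -, h⟩ | ⟨rfl, -, -, h⟩
      · rw [h]; exact hα.strictMono (by omega)
      · exact h.trans_le (hα.strictMono.monotone hki)) hρ hd
  have hT := beyondTest_holds c2 (by omega) (by omega) (by omega)
  rw [hi', hB] at hT
  have hpend : ∀ A B C, Minimal ω (Set.range p) A B C → Recorded s2 A B C ∨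
      (Beyond ω p α φ' k → Pending N p α ω i j (k + 1) A B C) ∧
      (¬ Beyond ω p α φ' k → (φ' = α i → Pending N p α ω (i + 1) j k A B C) ∧
        (φ' + ω + π = α j → Pending N p α ω i (j + 1) k A B C)) := by
    intro A B C hm
    rcases hr A B C hm with h | h
    · exact Or.inl (x2.2 _ _ _ hm h)
    · rcases h.advance hα hP h0 hp'.i_pred q2 q3 with ⟨d, f, hc, hL⟩ | h
      · refine Or.inl ((Extends.of_eq x1.1 n2 a2 fun a _ => by rw [b2]).2 _ _ _ hm
          (r1 A B C d f hm hc hL))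
      · exact Or.inr h
  intro s'
  have hs' : s' = moveOn.exec s2 := by rw [← e2]; rfl
  clear_value s'
  subst hs'
  by_cases hbeyond : Beyond ω p α φ' k
  · have ex : moveOn.exec s2 = (Program.setNat 4 (.reg 4 + .const 1)).exec s2 := if_pos (hT.2 hbeyond)
    rw [ex]
    have x3 : Extends ω (Set.range p) s2 ((Program.setNat 4 (.reg 4 + .const 1)).exec s2) :=
      .of_eq x2.1 (by simp [Program.exec]) rfl fun _ _ => rfl
    refine ⟨⟨i, j, k + 1, φ', ⟨?_, ?_, ?_, ?_, c2.x_eq, c2.y_eq, c2.cos_eq, c2.sin_eq⟩,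
      { hp' with k_ge := by omega, k_pred := ?_ }, x3.1, fun A B C hm => ?_⟩, ?_⟩
    · simpa [Program.exec] using c2.size
    · simpa [Program.exec] using c2.i_eq
    · simpa [Program.exec] using c2.j_eq
    · simpa [Program.exec] using c2.k_eq
    · rw [Nat.add_sub_cancel]
      rcases hbeyond with h | h
      · linarith
      · exact h.1
    · exact (hpend A B C hm).imp (x3.2 _ _ _ hm) fun h => h.1 hbeyond
    · simp [Program.exec, c2.i_eq, c2.j_eq, c2.k_eq]
      omega
  · have ex : moveOn.exec s2 =
        (Program.seq (.setNat 2 (.reg 6)) (.setNat 3 (.reg 7))).exec s2 := if_neg (mt hT.1 hbeyond)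
    rw [ex]
    have x3 : Extends ω (Set.range p) s2
        ((Program.seq (.setNat 2 (.reg 6)) (.setNat 3 (.reg 7))).exec s2) :=
      .of_eq x2.1 (by simp [Program.exec]) rfl fun _ _ => rfl
    refine ⟨⟨i', j', k, φ', ⟨?_, ?_, ?_, ?_, c2.x_eq, c2.y_eq, c2.cos_eq, c2.sin_eq⟩,
      ?_, x3.1, fun A B C hm => ?_⟩, ?_⟩
    · simpa [Program.exec] using c2.size
    · simp [Program.exec, hi']
    · simp [Program.exec, hj']
    · simpa [Program.exec] using c2.k_eq
    · rcases q4 with ⟨rfl, rfl, hφ⟩ | ⟨rfl, rfl, hφ, -⟩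
      · exact { hp' with
          i_ge := by omega
          i_le := by omega
          le_i := hφ.trans_le (hα.lt i).le
          i_pred := by rw [Nat.add_sub_cancel, hφ] }
      · exact { hp' with
          j_ge := by omega
          le_j := hφ.trans_le (hα.lt j).le
          j_pred := by rw [Nat.add_sub_cancel, hφ] }
    · refine (hpend A B C hm).imp (x3.2 _ _ _ hm) fun h' => ?_
      rcases q4 with ⟨rfl, rfl, hφ⟩ | ⟨rfl, rfl, hφ, -⟩
      · exact (h'.2 hbeyond).1 hφ
      · exact (h'.2 hbeyond).2 hφ
    · simp only [Program.exec]
      simp [c2.k_eq, hi', hj']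
      rcases q4 with ⟨rfl, rfl, hφ⟩ | ⟨rfl, rfl, hφ, -⟩ <;> omega

/-- The recorded triangles all have the same area. Since a minimum triangle exists and is recorded,
that area is the minimum, and nothing else can be in the list. -/
theorem reports_of_recorded (h0 : 0 < ω) (hπ : ω < π) {S : Set Plane} (hs : Sound ω S s)
    (hr : ∀ A B C, Minimal ω S A B C → Recorded s A B C) (hm : ∃ A B C, Minimal ω S A B C) :
    ReportsMinTriangles ω S ((Program.setNat 0 (.reg 5)).exec s) := by
  rw [ReportsMinTriangles, setOf_isMinTriangle h0 hπ]
  obtain ⟨A, B, C, hm⟩ := hm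
  obtain ⟨l, hl, hA, hB, hC⟩ := hr A B C hm
  have hl' := (hs l hl).2
  rw [hA, hB, hC] at hl'
  have hout : outputCount ((Program.setNat 0 (.reg 5)).exec s) = s.nat 5 := by
    simp [outputCount, Program.exec]
  rw [hout]
  ext V
  constructor
  · rintro ⟨j, hj, rfl⟩
    exact ⟨outA s j, outB s j, outC s j, ⟨(hs j hj).1, fun A' B' C' h => by
      rw [(hs j hj).2, ← hl']
      exact hm.2 _ _ _ h⟩, rfl⟩
  · rintro ⟨A', B', C', hm', rfl⟩
    obtain ⟨j, hj, rfl, rfl, rfl⟩ := hr A' B' C' hm'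
    exact ⟨j, hj, rfl⟩

theorem exists_sweep_spec : ∃ K, ∀ (N : ℕ) (p : ℕ → Plane) (ω : ℝ) (s : State), IsPolygon N p →
    0 < ω → ω < π → Holds N p ω s → Does sweep s (K * N) (ReportsMinTriangles ω (Set.range p)) := by
  obtain ⟨K1, h1⟩ := exists_unroll_spec
  obtain ⟨K2, h2⟩ := exists_findOpposite_spec
  have h3 : ∃ K, ∀ (N : ℕ) (p : ℕ → Plane) (α r : ℕ → ℝ) (ω : ℝ) (j k : ℕ) (s : State),
      IsPolygon N p → IsLift N p α r → 0 < ω → ω < π → Context N p ω N j k s → N ≤ j →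
      α (j - 1) ≤ α (N - 1) + ω + π → α (N - 1) + ω + π < α j →
      Does (.seq (.seq (.setNat 4 (.reg 1)) (.setNat 5 (.const 0)))
        (.loop (.natLt (.reg 2) (.reg 1 + .reg 1)) (.seq emit (.seq findNext moveOn)))) s (K * N)
        fun s => Sound ω (Set.range p) s ∧
          ∀ A B C, Minimal ω (Set.range p) A B C → Recorded s A B C := by
    refine ⟨_, fun N p α r ω j k s hP hα h0 hπ h hj ha hb => Does.mono (Does.setup_loop
      (by exact ⟨trivial, trivial⟩) (by exact ⟨loopFree_tryAll _, ⟨⟨⟨trivial, trivial⟩,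
        trivial, trivial⟩, ⟨trivial, trivial⟩, trivial, trivial⟩, trivial, trivial, trivial⟩)
      (SweepInv N p α ω)
      -- The three summands are at most 2N, 4N and 4N, hence the constant 10.
      (fun s => 2 * N - s.nat 2 + (4 * N - s.nat 3) + (4 * N - s.nat 4)) ?_ ?_ 10
      (by linarith [hP.three]) (by omega)) le_rfl ?_⟩
    · intro s hs hb
      have hsz : s.nat 1 = N := by obtain ⟨_, _, _, _, h, -⟩ := hs; exact h.size
      simp only [Test.Holds, NatExpr.eval_reg, NatExpr.eval_add, hsz] at hb
      exact sweep_step hα hP h0 hπ hs (by omega)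
    · have hN := hP.three
      refine ⟨N, j, N, α (N - 1), ⟨?_, ?_, ?_, ?_, h.x_eq, h.y_eq, h.cos_eq, h.sin_eq⟩,
        ⟨le_rfl, by omega, hj, le_rfl, hα.strictMono.monotone (by omega), le_rfl, hb.le, ha,
        by linarith⟩, ?_, fun A B C hm => Or.inr (hm.pending hα hP h0 hπ fun m hm => ?_)⟩
      · simpa [Program.exec] using h.size
      · simpa [Program.exec] using h.i_eq
      · simpa [Program.exec] using h.j_eq
      · simpa [Program.exec] using h.size
      · intro j hj
        simp [Program.exec] at hj
      · have := hα.strictMono.lt_iff_lt.1 (ha.trans_lt hm)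
        omega
    · rintro s ⟨⟨i, j, k, φ, h, hp, hs, hr⟩, hb⟩
      simp only [Test.Holds, NatExpr.eval_reg, NatExpr.eval_add, h.size, h.i_eq] at hb
      refine ⟨hs, fun A B C hm => (hr A B C hm).resolve_right ?_⟩
      rintro ⟨_, i', _, _, hi, _, _, hi', -⟩
      omega
  obtain ⟨K3, h3⟩ := h3
  refine ⟨K1 + (K2 + (K3 + (Program.setNat 0 (.reg 5)).bound)), fun N p ω s hP h0 hπ h => ?_⟩
  obtain ⟨α, r, hα⟩ := hP.exists_isLift
  have hN := hP.three
  refine ((h1 N p ω s hP.periodic (by omega) h).seq fun s hs => ?_).mono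
    (T := K1 * N + (K2 * N + (K3 * N + (Program.setNat 0 (.reg 5)).bound))) ?_ fun _ h => h
  · obtain ⟨i, j, k, h⟩ := hs
    refine (h2 N p α r ω i j k s hα hN h0 hπ h).seq ?_
    rintro s ⟨j, k, h, hj, ha, hb⟩
    refine (h3 N p α r ω j k s hP hα h0 hπ h hj ha hb).seq ?_
    rintro s ⟨hs, hr⟩
    exact .of_exec (by exact trivial) (reports_of_recorded h0 hπ hs hr (exists_minimal h0 hπ
      (finite_range_of_isPolygon hP) ⟨0, rfl⟩ ⟨1, rfl⟩ ⟨2, rfl⟩ (hP.turn 0)))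
  · have := Nat.le_mul_of_pos_right (Program.setNat 0 (.reg 5)).bound (show 0 < N by omega)
    rw [add_mul, add_mul, add_mul]
    omega

end

end FixedAngleTriangle

/-! ### Convex polygons in clockwise order -/

namespace FixedAngleTriangle

open Real RealRAM

theorem reportsMinTriangles_congr {ω : ℝ} (h0 : 0 < ω) (hπ : ω < π) {S S' : Set Plane}
    (h : S' ⊆ convexHull ℝ S) (h' : S ⊆ convexHull ℝ S') (s : State) :
    ReportsMinTriangles ω S s ↔ ReportsMinTriangles ω S' s := by
  simp only [ReportsMinTriangles, setOf_isMinTriangle h0 hπ, minimal_congr h h']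

/-- Store the vertices in the reverse order. -/
def reverseCopy : Program :=
  .seq (.seq (.setNat 1 (.reg 0)) (.setNat 2 (.const 0))) (.loop (.natLt (.reg 2) (.reg 0))
    (.seq (.writeReal 6 (.reg 2) (.read 0 (.reg 0 - .const 1 - .reg 2)))
      (.seq (.writeReal 7 (.reg 2) (.read 1 (.reg 0 - .const 1 - .reg 2)))
        (.setNat 2 (.reg 2 + .const 1)))))

/-- The vertices in the reverse order. -/
def reversed {n : ℕ} (v : Fin n → Plane) (m : ℕ) : Plane :=
  if h : n - 1 - m < n then v ⟨n - 1 - m, h⟩ else 0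

theorem exists_reverseCopy_spec : ∃ K, ∀ (n : ℕ) (v : Fin n → Plane) (ω : ℝ), 1 ≤ n →
    Does reverseCopy (inputState v ω) (K * n) (Holds n (fun m => reversed v (m % n)) ω) := by
  refine ⟨_, fun n v ω hn => Does.mono (Does.setup_loop (by exact ⟨trivial, trivial⟩)
    (by exact ⟨trivial, trivial, trivial⟩)
    (fun s => s.nat 0 = n ∧ s.nat 1 = n ∧ (∀ m < s.nat 2, s.realArr 6 m = reversed v m 0) ∧
      (∀ m < s.nat 2, s.realArr 7 m = reversed v m 1) ∧ s.realArr 0 = (inputState v ω).realArr 0 ∧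
      s.realArr 1 = (inputState v ω).realArr 1 ∧ s.real 0 = cos ω ∧ s.real 1 = sin ω)
    (fun s => n - s.nat 2) ?_ ?_ 1 hn (by simp)) le_rfl ?_⟩
  · rintro s ⟨h0, h1, h2, h3, h4, h5, h6, h7⟩ hb
    simp only [Test.Holds, NatExpr.eval_reg, h0] at hb
    have hlt : n - 1 - s.nat 2 < n := by omega
    simp only [Program.exec]
    refine ⟨⟨by simpa using h0, by simpa using h1, ?_, ?_, by simpa using h4, by simpa using h5,
      h6, h7⟩, by simp; omega⟩
    · intro m hm
      simp only [NatExpr.eval_add, NatExpr.eval_reg, NatExpr.eval_const,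
        Function.update_self] at hm
      rcases Nat.lt_succ_iff_lt_or_eq.1 hm with h | rfl
      · simp [h.ne, h2 _ h]
      · simp [h0, h4, inputState, reversed, hlt]
    · intro m hm
      simp only [NatExpr.eval_add, NatExpr.eval_reg, NatExpr.eval_const,
        Function.update_self] at hm
      rcases Nat.lt_succ_iff_lt_or_eq.1 hm with h | rfl
      · simp [h.ne, h3 _ h]
      · simp [h0, h5, inputState, reversed, hlt]
  · simp [Program.exec, inputState]
  · rintro s ⟨⟨h0, h1, h2, h3, -, -, h6, h7⟩, hb⟩
    simp only [Test.Holds, NatExpr.eval_reg, h0] at hb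
    exact ⟨h1, fun m hm => by simp only [Nat.mod_eq_of_lt hm]; exact h2 m (by omega),
      fun m hm => by simp only [Nat.mod_eq_of_lt hm]; exact h3 m (by omega), h6, h7⟩

theorem isPolygon_reversed {n : ℕ} {v : Fin n → Plane} (hv : IsClockwiseConvexPolygon v) :
    IsPolygon n fun m => reversed v (m % n) := by
  refine isPolygon_of_orient_pos hv.1 fun i j k hij hjk hk => ?_
  have h := hv.2 ⟨n - 1 - k, by omega⟩ ⟨n - 1 - j, by omega⟩ ⟨n - 1 - i, by omega⟩
    (by simp only [Fin.mk_lt_mk]; omega) (by simp only [Fin.mk_lt_mk]; omega)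
  rw [reversed, dif_pos (by omega), reversed, dif_pos (by omega), reversed, dif_pos (by omega)]
  simp only [orient] at h ⊢
  linarith

theorem range_reversed {n : ℕ} (hn : 1 ≤ n) (v : Fin n → Plane) :
    Set.range (fun m => reversed v (m % n)) = Set.range v := by
  ext q
  constructor
  · rintro ⟨m, rfl⟩
    exact ⟨⟨n - 1 - m % n, by omega⟩, by simp only [reversed]; rw [dif_pos]⟩
  · rintro ⟨m, rfl⟩
    refine ⟨n - 1 - m, ?_⟩
    have h1 : (n - 1 - m) % n = n - 1 - m := Nat.mod_eq_of_lt (by omega)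
    have h2 : n - 1 - (n - 1 - (m : ℕ)) = m := by omega
    simp only [reversed, h1, h2, m.2, dite_true]

theorem exists_polygon_algorithm : ∃ (prog : Program) (K : ℕ), ∀ (n : ℕ) (v : Fin n → Plane),
    IsClockwiseConvexPolygon v → ∀ ω : ℝ, 0 < ω → ω < π →
      Does prog (inputState v ω) (K * n)
        (ReportsMinTriangles ω (convexHull ℝ (Set.range v))) := by
  obtain ⟨K1, h1⟩ := exists_reverseCopy_spec
  obtain ⟨K2, h2⟩ := exists_sweep_spec
  refine ⟨.seq reverseCopy sweep, K1 + K2, fun n v hv ω h0 hπ => ?_⟩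
  have hn : 1 ≤ n := by linarith [hv.1]
  refine ((h1 n v ω hn).seq fun s hs => h2 n _ ω s (isPolygon_reversed hv) h0 hπ hs).mono
    (by rw [add_mul]) fun s hs => ?_
  rw [range_reversed hn] at hs
  refine (reportsMinTriangles_congr h0 hπ le_rfl ?_ s).1 hs
  exact (subset_convexHull ℝ _).trans (subset_convexHull ℝ _)

end FixedAngleTriangle

/-! ### Sorting around a point -/

namespace FixedAngleTriangle

open Real

/-- `q` follows `P` in the lexicographic order. -/
def InFront (P q : Plane) : Prop := P 0 < q 0 ∨ P 0 = q 0 ∧ P 1 < q 1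

/-- The sorting key: the direction of `q` seen from `P`, then the distance. -/
noncomputable def key (P q : Plane) : ℝ ×ₗ ℝ := toLex (direction (q - P), dt (q - P) (q - P))

namespace InFront

variable {P a b c : Plane}

theorem sub_ne_zero (h : InFront P a) : a - P ≠ 0 := by
  intro h'
  rw [sub_eq_zero] at h'
  subst h'
  rcases h with h | ⟨-, h⟩ <;> exact lt_irrefl _ h

/-- All points after the lexicographic minimum lie in a half-plane that is closed on one boundary
ray only, so directions do not wrap around. -/
theorem direction_mem (h : InFront P a) :
    -(π / 2) < direction (a - P) ∧ direction (a - P) ≤ π / 2 := by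
  have h0 : 0 ≤ (⟨(a - P) 0, (a - P) 1⟩ : ℂ).re := by
    rcases h with h | ⟨h, -⟩ <;> simp [h, h.le]
  have h1 := abs_le.1 (Complex.abs_arg_le_pi_div_two_iff.2 h0)
  refine ⟨lt_of_le_of_ne h1.1 fun he => ?_, h1.2⟩
  have := Complex.arg_eq_neg_pi_div_two_iff.1 (he.symm.trans (by ring : _ = -π / 2) |>.trans (by ring))
  simp at this
  rcases h with h | ⟨-, h⟩ <;> linarith

theorem exists_orient_eq (ha : InFront P a) (hb : InFront P b) :
    ∃ ρ : ℝ, 0 < ρ ∧ orient P a b = ρ * sin (direction (b - P) - direction (a - P)) := by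
  have na := ha.sub_ne_zero
  have nb := hb.sub_ne_zero
  have ea := eq_smul_unit_direction (a - P)
  have eb := eq_smul_unit_direction (b - P)
  refine ⟨_, ?_, by rw [orient_eq_cr, ea, eb, cr_smul_unit, ← ea, ← eb]⟩
  apply mul_pos
  · refine lt_of_le_of_ne (norm_nonneg _) fun h => na ?_
    rw [ea, ← h, zero_smul]
  · refine lt_of_le_of_ne (norm_nonneg _) fun h => nb ?_
    rw [eb, ← h, zero_smul]

/-- Two such directions differ by less than π, so the sign of the sine of their difference is the
sign of the difference. Sorting by angle thus needs only cross products. -/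
theorem orient_pos_iff (ha : InFront P a) (hb : InFront P b) :
    0 < orient P a b ↔ direction (a - P) < direction (b - P) := by
  obtain ⟨ρ, hρ, h⟩ := ha.exists_orient_eq hb
  have h1 := ha.direction_mem
  have h2 := hb.direction_mem
  have h3 := sin_nonpos_iff (x := direction (b - P) - direction (a - P)) (by linarith)
    (by linarith)
  rw [h, mul_pos_iff_of_pos_left hρ, ← not_le, h3, sub_nonpos, not_le]

theorem orient_eq_zero_iff (ha : InFront P a) (hb : InFront P b) :
    orient P a b = 0 ↔ direction (a - P) = direction (b - P) := by
  have h1 := ha.orient_pos_iff hb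
  have h2 := hb.orient_pos_iff ha
  rw [orient_swap] at h2
  constructor
  · intro h
    apply le_antisymm
    · by_contra h'
      linarith [h2.2 (not_le.1 h')]
    · by_contra h'
      linarith [h1.2 (not_le.1 h')]
  · intro h
    apply le_antisymm
    · by_contra h'
      linarith [h1.1 (not_le.1 h')]
    · by_contra h'
      linarith [h2.1 (by linarith)]

theorem key_le_iff (ha : InFront P a) (hb : InFront P b) : key P a ≤ key P b ↔
    0 < orient P a b ∨ orient P a b = 0 ∧ dt (a - P) (a - P) ≤ dt (b - P) (b - P) := by
  rw [key, key, Prod.Lex.toLex_le_toLex, ha.orient_pos_iff hb, ha.orient_eq_zero_iff hb]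

/-- The farther one of two points in the same direction. -/
theorem exists_eq_smul (ha : InFront P a) (hb : InFront P b) (h : orient P a b = 0)
    (hd : dt (a - P) (a - P) ≤ dt (b - P) (b - P)) :
    ∃ x : ℝ, 0 ≤ x ∧ x ≤ 1 ∧ a - P = x • (b - P) := by
  have hdir := (ha.orient_eq_zero_iff hb).1 h
  have ea := eq_smul_unit_direction (a - P)
  have eb := eq_smul_unit_direction (b - P)
  rw [← hdir] at eb
  set x := ‖(⟨(a - P) 0, (a - P) 1⟩ : ℂ)‖
  set y := ‖(⟨(b - P) 0, (b - P) 1⟩ : ℂ)‖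
  have hx : 0 ≤ x := norm_nonneg _
  have hy : 0 < y := by
    refine lt_of_le_of_ne (norm_nonneg _) fun h => hb.sub_ne_zero ?_
    rw [eb, ← h, zero_smul]
  have hu : ∀ z θ : ℝ, dt (z • unit θ) (z • unit θ) = z ^ 2 := by
    intro z θ
    simp only [dt, unit, PiLp.smul_apply, pt_zero, pt_one, smul_eq_mul]
    linear_combination z ^ 2 * sin_sq_add_cos_sq θ
  rw [ea, eb, hu, hu] at hd
  refine ⟨x / y, by positivity, (div_le_one hy).2 (abs_le_of_sq_le_sq' hd hy.le).2, ?_⟩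
  rw [eb, smul_smul, div_mul_cancel₀ _ hy.ne']
  exact ea

theorem mem_convexHull_of_le (ha : InFront P a) (hb : InFront P b) (h : orient P a b = 0)
    (hd : dt (a - P) (a - P) ≤ dt (b - P) (b - P)) : a ∈ convexHull ℝ {P, b} := by
  obtain ⟨x, h0, h1, hx⟩ := ha.exists_eq_smul hb h hd
  rw [convexHull_pair]
  refine ⟨1 - x, x, by linarith, h0, by ring, ?_⟩
  rw [sub_eq_iff_eq_add.1 hx]
  module

theorem orient_nonpos_of_eq_zero (ha : InFront P a) (hb : InFront P b) (h : orient P a b = 0)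
    (hd : dt (a - P) (a - P) ≤ dt (b - P) (b - P)) (hc : 0 ≤ orient P c a) :
    orient c a b ≤ 0 := by
  obtain ⟨x, h0, h1, hx⟩ := ha.exists_eq_smul hb h hd
  have hx0 : x ≠ 0 := by
    rintro rfl
    exact ha.sub_ne_zero (by rw [hx, zero_smul])
  have hxp : 0 < x := lt_of_le_of_ne h0 hx0.symm
  have e : x * orient c a b = - ((1 - x) * orient P c a) := by
    have e0 := congrArg (fun v : Plane => v 0) hx
    have e1 := congrArg (fun v : Plane => v 1) hx
    simp at e0 e1
    simp only [orient]
    linear_combination (a 1 - c 1) * e0 - (a 0 - c 0) * e1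
  by_contra hcon
  have := mul_pos hxp (not_le.1 hcon)
  nlinarith

end InFront

/-- Removing the last point of the chain in the convex hull algorithm. -/
theorem mem_convexHull_of_turn {P a b q : Plane} (ha : InFront P a) (hb : InFront P b)
    (hq : InFront P q) (hab : 0 < orient P a b) (hbq : key P b ≤ key P q)
    (h : orient a b q ≤ 0) : b ∈ convexHull ℝ {P, a, q} := by
  have h1 : direction (b - P) ≤ direction (q - P) := by
    rcases (hb.key_le_iff hq).1 hbq with h | ⟨h, -⟩
    · exact ((hb.orient_pos_iff hq).1 h).le
    · exact ((hb.orient_eq_zero_iff hq).1 h).le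
  have h2 : 0 < orient P a q :=
    (ha.orient_pos_iff hq).2 (((ha.orient_pos_iff hb).1 hab).trans_le h1)
  have h3 : 0 ≤ orient P b q := by
    rcases (hb.key_le_iff hq).1 hbq with h | ⟨h, -⟩ <;> linarith
  rw [mem_convexHull_triangle h2]
  refine ⟨hab.le, ?_, ?_⟩
  · rw [orient_swap]; linarith
  · rwa [orient_rotate, orient_rotate]

/-- Adding a point to the chain in the convex hull algorithm. -/
theorem orient_pos_of_push {M : ℕ} {h : ℕ → Plane} {q : Plane} (hM : 2 ≤ M)
    (hf : ∀ i, 1 ≤ i → i < M → InFront (h 0) (h i) ∧ key (h 0) (h i) ≤ key (h 0) q)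
    (hq : InFront (h 0) q)
    (ho : ∀ i j k, i < j → j < k → k < M → 0 < orient (h i) (h j) (h k))
    (hl : 0 < orient (h (M - 2)) (h (M - 1)) q) {i j : ℕ} (hij : i < j) (hj : j < M) :
    0 < orient (h i) (h j) q := by
  have hbase : ∀ j, 1 ≤ j → j < M → 0 < orient (h 0) (h j) q := by
    have hlast : 0 < orient (h 0) (h (M - 1)) q := by
      rcases hM.eq_or_lt with rfl | hM
      · exact hl
      obtain ⟨h1, h2⟩ := hf (M - 1) (by omega) (by omega)
      rcases (h1.key_le_iff hq).1 h2 with h3 | ⟨h3, h4⟩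
      · exact h3
      · exact absurd (h1.orient_nonpos_of_eq_zero hq h3 h4
          (ho 0 (M - 2) (M - 1) (by omega) (by omega) (by omega)).le) (not_le.2 hl)
    intro j h1 h2
    rcases (show j ≤ M - 1 by omega).eq_or_lt with rfl | h3
    · exact hlast
    · rw [(hf j h1 h2).1.orient_pos_iff hq]
      exact (((hf j h1 h2).1.orient_pos_iff (hf (M - 1) (by omega) (by omega)).1).1
        (ho 0 j (M - 1) (by omega) h3 (by omega))).trans
        (((hf (M - 1) (by omega) (by omega)).1.orient_pos_iff hq).1 hlast)
  have hlast : ∀ i < M - 1, 0 < orient (h i) (h (M - 1)) q := by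
    intro i hi
    rcases Nat.eq_zero_or_pos i with rfl | h0
    · exact hbase _ (by omega) (by omega)
    rcases (show i ≤ M - 2 by omega).eq_or_lt with rfl | h1
    · exact hl
    have a1 := ho 0 (M - 2) (M - 1) (by omega) (by omega) (by omega)
    have a2 := ho 0 i (M - 1) (by omega) (by omega) (by omega)
    have a3 := ho i (M - 2) (M - 1) (by omega) (by omega) (by omega)
    have a4 := hbase (M - 1) (by omega) (by omega)
    -- A Plücker relation. It propagates the left turn at the end of the chain to all earlier
    -- points, as the other factors are known to be positive.
    have e : orient (h i) (h (M - 1)) q * orient (h 0) (h (M - 2)) (h (M - 1)) =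
        orient (h (M - 2)) (h (M - 1)) q * orient (h 0) (h i) (h (M - 1)) +
        orient (h 0) (h (M - 1)) q * orient (h i) (h (M - 2)) (h (M - 1)) := by
      simp only [orient]; ring
    refine pos_of_mul_pos_left ?_ a1.le
    rw [e]
    positivity
  rcases (show j ≤ M - 1 by omega).eq_or_lt with rfl | h1
  · exact hlast i hij
  rcases Nat.eq_zero_or_pos i with rfl | h0
  · exact hbase _ (by omega) hj
  have a1 := ho 0 j (M - 1) (by omega) (by omega) (by omega)
  have a2 := hbase j (by omega) hj
  have a3 := ho i j (M - 1) (by omega) (by omega) (by omega)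
  have a4 := hlast j h1
  have a5 := ho 0 i j (by omega) (by omega) (by omega)
  have e : orient (h i) (h j) q * orient (h 0) (h j) (h (M - 1)) =
      orient (h 0) (h j) q * orient (h i) (h j) (h (M - 1)) +
      orient (h j) (h (M - 1)) q * orient (h 0) (h i) (h j) := by
    simp only [orient]; ring
  refine pos_of_mul_pos_left ?_ a1.le
  rw [e]
  positivity

/-! ### Merging -/

/-- The elements `f x` are in order within each block of length `w`. -/
def SortedBlocks {β γ : Type*} [LE γ] (κ : β → γ) (w m : ℕ) (f : ℕ → β) : Prop :=
  ∀ c x y, c * w ≤ x → x < y → y < (c + 1) * w → y < m → κ (f x) ≤ κ (f y)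

/-- The state of affairs while the blocks of length `w` of `f` are merged in pairs into `g`. The
elements up to `t` are written, the blocks that are being merged have the remaining elements from
`a` to `mid` and from `b` to `hi`. -/
structure Merging {β γ : Type*} [LE γ] (κ : β → γ) (w m : ℕ) (f g : ℕ → β)
    (t a b mid hi : ℕ) : Prop where
  block : ∃ c, c * (w + w) ≤ a ∧ hi ≤ (c + 1) * (w + w) ∧
    ∀ x y, c * (w + w) ≤ x → x < t → (a ≤ y ∧ y < mid ∨ b ≤ y ∧ y < hi) → κ (g x) ≤ κ (f y)
  a_le : a ≤ mid
  mid_le : mid ≤ b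
  b_le : b ≤ hi
  hi_le : hi ≤ m
  t_add : t + mid = a + b
  left : ∀ x y, a ≤ x → x < y → y < mid → κ (f x) ≤ κ (f y)
  right : ∀ x y, b ≤ x → x < y → y < hi → κ (f x) ≤ κ (f y)
  at_end : hi = m ∨ ∃ c, hi = c * (w + w)
  old : ∀ x < t, ∃ y < m, g x = f y
  new : ∀ y, y < a ∨ mid ≤ y ∧ y < b → ∃ x < t, g x = f y
  sorted : SortedBlocks κ (w + w) t g

namespace Merging

variable {β γ : Type*} [LinearOrder γ] {κ : β → γ} {w m : ℕ} {f g : ℕ → β} {t a b mid hi : ℕ}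

theorem init (κ : β → γ) (w m : ℕ) (f g : ℕ → β) : Merging κ w m f g 0 0 0 0 0 where
  block := ⟨0, by simp, by simp, by simp⟩
  a_le := le_rfl
  mid_le := le_rfl
  b_le := le_rfl
  hi_le := Nat.zero_le _
  t_add := rfl
  left := by simp
  right := by simp
  at_end := Or.inr ⟨0, by simp⟩
  old := by simp
  new := by simp
  sorted := fun _ _ _ _ _ _ h => absurd h (Nat.not_lt_zero _)

theorem t_le (h : Merging κ w m f g t a b mid hi) : t ≤ hi := by
  have := h.a_le
  have := h.b_le
  have := h.t_add
  omega

theorem finished (h : Merging κ w m f g t a b mid hi) (ht : t = hi) : a = mid ∧ b = hi := by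
  have := h.a_le
  have := h.b_le
  have := h.t_add
  omega

/-- A finished pair that does not reach the end stops at a multiple of `w + w`, so the next two runs
are blocks of `f`, cut off at `m`. -/
theorem next (h : Merging κ w m f g t a b mid hi) (hf : SortedBlocks κ w m f) (ht : t = hi)
    (htm : t < m) (hw : 1 ≤ w) :
    Merging κ w m f g t t (min m (t + w)) (min m (t + w)) (min m (t + w + w)) := by
  obtain ⟨ha, hb⟩ := h.finished ht
  obtain ⟨c, hc⟩ := h.at_end.resolve_left (by omega)
  have e1 : c * 2 * w = t := by rw [ht, hc]; ring
  have e2 : (c * 2 + 1) * w = t + w := by rw [add_mul, e1, one_mul]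
  have e3 : (c * 2 + 1 + 1) * w = t + w + w := by rw [add_mul, e2, one_mul]
  have e4 : (c + 1) * (w + w) = t + w + w := by rw [← e3]; ring
  refine ⟨⟨c, by omega, by omega, fun x y h1 h2 => by omega⟩, by omega, le_rfl, by omega,
    by omega, by omega, fun x y h1 h2 h3 => hf (c * 2) x y (by omega) h2 (by omega) (by omega),
    fun x y h1 h2 h3 => hf (c * 2 + 1) x y (by omega) h2 (by omega) (by omega), ?_, h.old,
    fun y hy => h.new y (by omega), h.sorted⟩
  rcases le_total m (t + w + w) with h' | h'
  · left; omega
  · exact Or.inr ⟨c + 1, by omega⟩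

/-- Whatever was written in the current pair of blocks is at most every element still waiting in it,
so any waiting element may be appended. -/
theorem sorted_update (h : Merging κ w m f g t a b mid hi) (hthi : t < hi) {z : ℕ}
    (hz : a ≤ z ∧ z < mid ∨ b ≤ z ∧ z < hi) :
    SortedBlocks κ (w + w) (t + 1) (Function.update g t (f z)) := by
  intro c x y h1 h2 h3 h4
  rcases Nat.lt_succ_iff_lt_or_eq.1 h4 with h5 | rfl
  · rw [Function.update_of_ne (by omega), Function.update_of_ne (by omega)]
    exact h.sorted c x y h1 h2 h3 h5
  · obtain ⟨c', k1, k2, k3⟩ := h.block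
    rw [Function.update_self, Function.update_of_ne (by omega)]
    refine k3 x z ?_ h2 hz
    have k4 : c' * (w + w) < (c + 1) * (w + w) := by
      have := h.mid_le; have := h.t_add; omega
    have k5 := Nat.lt_of_mul_lt_mul_right k4
    exact (Nat.mul_le_mul_right _ (by omega : c' ≤ c)).trans h1

theorem takeLeft (h : Merging κ w m f g t a b mid hi) (ha : a < mid)
    (hab : b < hi → κ (f a) ≤ κ (f b)) :
    Merging κ w m f (Function.update g t (f a)) (t + 1) (a + 1) b mid hi := by
  have := h.a_le
  have := h.mid_le
  have := h.b_le
  have := h.hi_le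
  have := h.t_add
  obtain ⟨c, k1, k2, k3⟩ := h.block
  refine ⟨⟨c, by omega, k2, fun x y h1 h2 h3 => ?_⟩, ha, h.mid_le, h.b_le, h.hi_le, by omega,
    fun x y h1 => h.left x y (by omega), h.right, h.at_end, fun x hx => ?_, fun y hy => ?_,
    h.sorted_update (by omega) (Or.inl ⟨le_rfl, ha⟩)⟩
  · rcases Nat.lt_succ_iff_lt_or_eq.1 h2 with h2 | rfl
    · rw [Function.update_of_ne (by omega)]
      exact k3 x y h1 h2 (by omega)
    · rw [Function.update_self]
      rcases h3 with h3 | h3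
      · exact h.left a y le_rfl (by omega) h3.2
      · rcases h3.1.eq_or_lt with rfl | h4
        · exact hab h3.2
        · exact (hab (by omega)).trans (h.right b y le_rfl h4 h3.2)
  · rcases Nat.lt_succ_iff_lt_or_eq.1 hx with hx | rfl
    · rw [Function.update_of_ne (by omega)]
      exact h.old x hx
    · exact ⟨a, by omega, by simp⟩
  · by_cases hya : y = a
    · exact ⟨t, by omega, by simp [hya]⟩
    · obtain ⟨x, hx, he⟩ := h.new y (by omega)
      exact ⟨x, by omega, by rwa [Function.update_of_ne (by omega)]⟩

theorem takeRight (h : Merging κ w m f g t a b mid hi) (hb : b < hi)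
    (hab : a < mid → κ (f b) ≤ κ (f a)) :
    Merging κ w m f (Function.update g t (f b)) (t + 1) a (b + 1) mid hi := by
  have := h.a_le
  have := h.mid_le
  have := h.b_le
  have := h.hi_le
  have := h.t_add
  obtain ⟨c, k1, k2, k3⟩ := h.block
  refine ⟨⟨c, by omega, k2, fun x y h1 h2 h3 => ?_⟩, h.a_le, by omega, hb, h.hi_le, by omega,
    h.left, fun x y h1 => h.right x y (by omega), h.at_end, fun x hx => ?_, fun y hy => ?_,
    h.sorted_update (by omega) (Or.inr ⟨le_rfl, hb⟩)⟩
  · rcases Nat.lt_succ_iff_lt_or_eq.1 h2 with h2 | rfl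
    · rw [Function.update_of_ne (by omega)]
      exact k3 x y h1 h2 (by omega)
    · rw [Function.update_self]
      rcases h3 with h3 | h3
      · rcases h3.1.eq_or_lt with rfl | h4
        · exact hab h3.2
        · exact (hab (by omega)).trans (h.left a y le_rfl h4 h3.2)
      · exact h.right b y le_rfl (by omega) h3.2
  · rcases Nat.lt_succ_iff_lt_or_eq.1 hx with hx | rfl
    · rw [Function.update_of_ne (by omega)]
      exact h.old x hx
    · exact ⟨b, by omega, by simp⟩
  · by_cases hyb : y = b
    · exact ⟨t, by omega, by simp [hyb]⟩
    · obtain ⟨x, hx, he⟩ := h.new y (by omega)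
      exact ⟨x, by omega, by rwa [Function.update_of_ne (by omega)]⟩

end Merging

end FixedAngleTriangle

/-! ### The algorithm for sorting around a point -/

namespace FixedAngleTriangle

open Real RealRAM

/-- The points that are stored in two consecutive arrays. -/
noncomputable def arr (s : State) (A m : ℕ) : Plane := pt (s.realArr A m) (s.realArr (A + 1) m)

/-- The expression for a stored point. -/
def entry (A x : ℕ) : VecExpr := (.read A (.reg x), .read (A + 1) (.reg x))

@[simp] theorem eval_entry (s : State) (A x : ℕ) : (entry A x).eval s = arr s A (s.nat x) := rfl

/-- Copy the point number `y` of the arrays at `B` to the place number `x` of the arrays at `A`;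
the numbers are taken from registers. -/
def copyEntry (A x B y : ℕ) : Program :=
  .seq (.writeReal A (.reg x) (.read B (.reg y)))
    (.writeReal (A + 1) (.reg x) (.read (B + 1) (.reg y)))

/-- The hypothesis prevents the first write from destroying the second coordinate before it is read.
-/
theorem copyEntry_exec {A B : ℕ} (h2 : A ≠ B + 1) (x y : ℕ) (s : State) :
    ((copyEntry A x B y).exec s).nat = s.nat ∧ ((copyEntry A x B y).exec s).real = s.real ∧
    arr ((copyEntry A x B y).exec s) A =
      Function.update (arr s A) (s.nat x) (arr s B (s.nat y)) ∧
    ∀ C, C ≠ A → C ≠ A + 1 → ((copyEntry A x B y).exec s).realArr C = s.realArr C := by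
  refine ⟨rfl, rfl, ?_, fun C hC hC' => ?_⟩
  · funext m
    by_cases hm : m = s.nat x
    · subst hm
      apply plane_ext <;> simp [copyEntry, Program.exec, arr, h2.symm]
    · apply plane_ext <;> simp [copyEntry, Program.exec, arr, hm]
  · simp [copyEntry, Program.exec, hC, hC']

/-- The pivot. -/
def pivotExpr : VecExpr := (.reg 2, .reg 3)

noncomputable def pivot (s : State) : Plane := pivotExpr.eval s

theorem pivot_congr {s s' : State} (h : s'.real = s.real) : pivot s' = pivot s := by
  simp [pivot, pivotExpr, h]

/-- The data of the problem. -/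
structure InputHeld (n : ℕ) (f : ℕ → Plane) (ω : ℝ) (s : State) : Prop where
  size : s.nat 0 = n
  points : arr s 0 = f
  cos_eq : s.real 0 = cos ω
  sin_eq : s.real 1 = sin ω

/-- The lexicographic order. -/
def lexTest (v w : VecExpr) : Test := .or (.realLt v.1 w.1) (.and (.realEq v.1 w.1) (.realLt v.2 w.2))

theorem lexTest_holds (s : State) (v w : VecExpr) :
    (lexTest v w).Holds s ↔ InFront (v.eval s) (w.eval s) := Iff.rfl

/-- Find the smallest point in the lexicographic order. -/
def findPivot : Program :=
  .seq (.seq (.setNat 4 (.const 0)) (setVec 2 3 (entry 0 4))) (.loop (.natLt (.reg 4) (.reg 0))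
    (.seq (.ite (lexTest (entry 0 4) pivotExpr) (setVec 2 3 (entry 0 4)) .skip)
      (.setNat 4 (.reg 4 + .const 1))))

/-- Store the points that are different from the pivot in the arrays `8` and `9`. -/
def collect : Program :=
  .seq (.seq (.setNat 4 (.const 0)) (.setNat 9 (.const 0))) (.loop (.natLt (.reg 4) (.reg 0))
    (.seq (.ite (lexTest pivotExpr (entry 0 4)) (.seq (copyEntry 8 9 0 4)
      (.setNat 9 (.reg 9 + .const 1))) .skip) (.setNat 4 (.reg 4 + .const 1))))

theorem InFront.trans {a b c : Plane} (h : InFront a b) (h' : InFront b c) : InFront a c := by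
  rcases h with h | ⟨h1, h2⟩ <;> rcases h' with h' | ⟨h3, h4⟩
  · exact Or.inl (h.trans h')
  · exact Or.inl (h.trans_eq h3)
  · exact Or.inl (h1.trans_lt h')
  · exact Or.inr ⟨h1.trans h3, h2.trans h4⟩

theorem inFront_or_eq_or (a b : Plane) : InFront a b ∨ a = b ∨ InFront b a := by
  rcases lt_trichotomy (a 0) (b 0) with h | h | h
  · exact Or.inl (Or.inl h)
  · rcases lt_trichotomy (a 1) (b 1) with h' | h' | h'
    · exact Or.inl (Or.inr ⟨h, h'⟩)
    · exact Or.inr (Or.inl (plane_ext h h'))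
    · exact Or.inr (Or.inr (Or.inr ⟨h.symm, h'⟩))
  · exact Or.inr (Or.inr (Or.inl h))

theorem setVec_entry_exec {x y : ℕ} (hxy : x ≠ y) (A z : ℕ) (s : State) :
    ((setVec x y (entry A z)).exec s).nat = s.nat ∧
    ((setVec x y (entry A z)).exec s).realArr = s.realArr ∧
    (∀ w, w ≠ x → w ≠ y → ((setVec x y (entry A z)).exec s).real w = s.real w) ∧
    pt (((setVec x y (entry A z)).exec s).real x) (((setVec x y (entry A z)).exec s).real y) =
      arr s A (s.nat z) := by
  refine ⟨rfl, rfl, fun w h1 h2 => by simp [setVec, Program.exec, h1, h2], ?_⟩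
  simp [setVec, Program.exec, entry, arr, hxy]

theorem exists_findPivot_spec : ∃ K, ∀ (n : ℕ) (f : ℕ → Plane) (ω : ℝ) (s : State), 1 ≤ n →
    InputHeld n f ω s → Does findPivot s (K * n) fun s' => InputHeld n f ω s' ∧
      (∃ x < n, pivot s' = f x) ∧ ∀ x < n, pivot s' = f x ∨ InFront (pivot s') (f x) := by
  refine ⟨_, fun n f ω s hn h => Does.mono (Does.setup_loop
    (by exact ⟨trivial, trivial, trivial⟩) (by exact ⟨⟨⟨trivial, trivial⟩, trivial⟩, trivial⟩)
    (fun s => InputHeld n f ω s ∧ (∃ x < n, pivot s = f x) ∧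
      ∀ x < s.nat 4, pivot s = f x ∨ InFront (pivot s) (f x))
    (fun s => n - s.nat 4) ?_ ?_ 1 hn (by simp)) le_rfl ?_⟩
  · rintro s ⟨h, ⟨x, hx, hpx⟩, hall⟩ hb
    simp only [Test.Holds, NatExpr.eval_reg, h.size] at hb
    have key : ∃ s1, (Program.ite (lexTest (entry 0 4) pivotExpr) (setVec 2 3 (entry 0 4))
        .skip).exec s = s1 ∧ s1.nat = s.nat ∧ InputHeld n f ω s1 ∧ (∃ x < n, pivot s1 = f x) ∧
        ∀ x < s.nat 4 + 1, pivot s1 = f x ∨ InFront (pivot s1) (f x) := by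
      obtain ⟨e1, e2, e3, e4⟩ := setVec_entry_exec (x := 2) (y := 3) (by norm_num) 0 4 s
      by_cases ht : (lexTest (entry 0 4) pivotExpr).Holds s
      · refine ⟨_, if_pos ht, e1, ⟨by rw [e1]; exact h.size, ?_, ?_, ?_⟩, ?_, ?_⟩
        · rw [← h.points]; unfold arr; rw [e2]
        · rw [e3 0 (by norm_num) (by norm_num)]; exact h.cos_eq
        · rw [e3 1 (by norm_num) (by norm_num)]; exact h.sin_eq
        · exact ⟨s.nat 4, hb, by rw [← h.points]; exact e4⟩
        · have e5 : pivot ((setVec 2 3 (entry 0 4)).exec s) = f (s.nat 4) := by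
            rw [← h.points]; exact e4
          rw [lexTest_holds, eval_entry, h.points] at ht
          intro x hx
          rw [e5]
          rcases Nat.lt_succ_iff_lt_or_eq.1 hx with hx | rfl
          · rcases hall x hx with h' | h'
            · right; rw [← h']; exact ht
            · right; exact ht.trans h'
          · exact Or.inl rfl
      · refine ⟨_, if_neg ht, rfl, h, ⟨x, hx, hpx⟩, fun y hy => ?_⟩
        change pivot s = f y ∨ InFront (pivot s) (f y)
        rcases Nat.lt_succ_iff_lt_or_eq.1 hy with hy | rfl
        · exact hall y hy
        · rw [lexTest_holds, eval_entry, h.points] at ht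
          rcases inFront_or_eq_or (f (s.nat 4)) (pivot s) with h' | h' | h'
          · exact absurd h' ht
          · exact Or.inl h'.symm
          · exact Or.inr h'
    obtain ⟨s1, he, e1, h1, h2, h3⟩ := key
    rw [show Program.exec (.seq _ (.setNat 4 (.reg 4 + .const 1))) s =
      (Program.setNat 4 (.reg 4 + .const 1)).exec s1 by rw [← he]; rfl]
    refine ⟨⟨⟨by simpa [Program.exec] using h1.size, h1.points, h1.cos_eq, h1.sin_eq⟩, h2, ?_⟩, ?_⟩
    · rw [show ((Program.setNat 4 (.reg 4 + .const 1)).exec s1).nat 4 = s.nat 4 + 1 by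
        simp [Program.exec, e1]]
      exact h3
    · simp [Program.exec, e1]; omega
  · obtain ⟨e1, e2, e3, e4⟩ := setVec_entry_exec (x := 2) (y := 3) (by norm_num) 0 4
      ((Program.setNat 4 (.const 0)).exec s)
    refine ⟨⟨?_, ?_, ?_, ?_⟩, ⟨0, hn, ?_⟩, ?_⟩
    · simpa [Program.exec, setVec] using h.size
    · rw [← h.points]; rfl
    · simpa [Program.exec, setVec] using h.cos_eq
    · simpa [Program.exec, setVec] using h.sin_eq
    · rw [← h.points]
      exact e4.trans (by simp [Program.exec, arr])
    · intro x hx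
      simp [Program.exec, setVec] at hx
  · rintro s ⟨⟨h1, h2, h3⟩, hb⟩
    simp only [Test.Holds, NatExpr.eval_reg, h1.size] at hb
    exact ⟨h1, h2, fun x hx => h3 x (by omega)⟩

/-- The arrays `8` and `9` hold the points of `S` other than `P`. -/
structure Collected (n : ℕ) (S : Set Plane) (P : Plane) (ω : ℝ) (s : State) : Prop where
  length_le : s.nat 9 ≤ n
  cos_eq : s.real 0 = cos ω
  sin_eq : s.real 1 = sin ω
  pivot_eq : pivot s = P
  mem_iff : ∀ q, q ∈ S ↔ q = P ∨ ∃ y < s.nat 9, arr s 8 y = q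
  front : ∀ y < s.nat 9, InFront P (arr s 8 y)

/-- Repetitions of the pivot are dropped, since they have no direction from the pivot; other
repetitions are harmless and remain. -/
theorem exists_collect_spec : ∃ K, ∀ (n : ℕ) (f : ℕ → Plane) (ω : ℝ) (P : Plane) (s : State),
    1 ≤ n → InputHeld n f ω s → pivot s = P → (∃ x < n, P = f x) →
    (∀ x < n, P = f x ∨ InFront P (f x)) →
    Does collect s (K * n) (Collected n {q | ∃ x < n, f x = q} P ω) := by
  refine ⟨_, fun n f ω P s hn h hP hex hfr => Does.mono (Does.setup_loop
    (by exact ⟨trivial, trivial⟩) (by exact ⟨⟨⟨⟨trivial, trivial⟩, trivial⟩, trivial⟩, trivial⟩)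
    (fun s => InputHeld n f ω s ∧ pivot s = P ∧ s.nat 4 ≤ n ∧ s.nat 9 ≤ s.nat 4 ∧
      (∀ y < s.nat 9, InFront P (arr s 8 y) ∧ ∃ x < n, f x = arr s 8 y) ∧
      ∀ x < s.nat 4, f x = P ∨ ∃ y < s.nat 9, arr s 8 y = f x)
    (fun s => n - s.nat 4) ?_ ?_ 1 hn (by simp)) le_rfl ?_⟩
  · rintro s ⟨h, hp, hn4, h9, hold, hnew⟩ hb
    simp only [Test.Holds, NatExpr.eval_reg, h.size] at hb
    have key : ∃ s1, (Program.ite (lexTest pivotExpr (entry 0 4)) (.seq (copyEntry 8 9 0 4)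
      (.setNat 9 (.reg 9 + .const 1))) .skip).exec s = s1 ∧ s1.nat 4 = s.nat 4 ∧
        InputHeld n f ω s1 ∧ pivot s1 = P ∧ s1.nat 9 ≤ s.nat 4 + 1 ∧
        (∀ y < s1.nat 9, InFront P (arr s1 8 y) ∧ ∃ x < n, f x = arr s1 8 y) ∧
        ∀ x < s.nat 4 + 1, f x = P ∨ ∃ y < s1.nat 9, arr s1 8 y = f x := by
      by_cases ht : (lexTest pivotExpr (entry 0 4)).Holds s
      · obtain ⟨e1, e2, e3, e4⟩ := copyEntry_exec (A := 8) (B := 0) (by norm_num)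
          9 4 s
        have ht' := ht
        rw [lexTest_holds, eval_entry, h.points] at ht
        change InFront (pivot s) _ at ht
        rw [hp] at ht
        set s0 := (copyEntry 8 9 0 4).exec s with hs0
        have e5 : ((Program.setNat 9 (.reg 9 + .const 1)).exec s0).nat 9 = s.nat 9 + 1 := by
          simp [Program.exec, e1]
        have e6 : arr ((Program.setNat 9 (.reg 9 + .const 1)).exec s0) 8 =
            Function.update (arr s 8) (s.nat 9) (f (s.nat 4)) := by
          rw [← h.points]; exact e3
        refine ⟨_, if_pos ht', ?_, ⟨?_, ?_, ?_, ?_⟩, ?_, ?_, ?_, ?_⟩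
        · simp [Program.exec, ← hs0, e1]
        · simpa [Program.exec, ← hs0, e1] using h.size
        · rw [← h.points]
          unfold arr
          simp [Program.exec, ← hs0, e4]
        · simpa [Program.exec, ← hs0, e2] using h.cos_eq
        · simpa [Program.exec, ← hs0, e2] using h.sin_eq
        · rw [← hp]; exact pivot_congr e2
        · change ((Program.setNat 9 (.reg 9 + .const 1)).exec s0).nat 9 ≤ _
          omega
        · intro y hy
          change y < ((Program.setNat 9 (.reg 9 + .const 1)).exec s0).nat 9 at hy
          change InFront P (arr ((Program.setNat 9 (.reg 9 + .const 1)).exec s0) 8 y) ∧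
            ∃ x < n, f x = arr ((Program.setNat 9 (.reg 9 + .const 1)).exec s0) 8 y
          rw [e5] at hy
          rw [e6]
          rcases Nat.lt_succ_iff_lt_or_eq.1 hy with hy | rfl
          · rw [Function.update_of_ne hy.ne]
            exact hold y hy
          · rw [Function.update_self]
            exact ⟨ht, _, hb, rfl⟩
        · intro x hx
          change f x = P ∨ ∃ y < ((Program.setNat 9 (.reg 9 + .const 1)).exec s0).nat 9,
            arr ((Program.setNat 9 (.reg 9 + .const 1)).exec s0) 8 y = f x
          rw [e5, e6]
          rcases Nat.lt_succ_iff_lt_or_eq.1 hx with hx | rfl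
          · refine (hnew x hx).imp id ?_
            rintro ⟨y, hy, he⟩
            exact ⟨y, by omega, by rwa [Function.update_of_ne hy.ne]⟩
          · exact Or.inr ⟨s.nat 9, by omega, by simp⟩
      · refine ⟨_, if_neg ht, rfl, h, hp, ?_, hold, ?_⟩
        · change s.nat 9 ≤ _
          omega
        · intro x hx
          rcases Nat.lt_succ_iff_lt_or_eq.1 hx with hx | rfl
          · exact hnew x hx
          · rw [lexTest_holds, eval_entry, h.points] at ht
            change ¬ InFront (pivot s) _ at ht
            rw [hp] at ht
            exact Or.inl ((hfr _ hb).resolve_right ht).symm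
    obtain ⟨s1, he, e1, h1, h2, h3, h4, h5⟩ := key
    rw [show Program.exec (.seq _ (.setNat 4 (.reg 4 + .const 1))) s =
      (Program.setNat 4 (.reg 4 + .const 1)).exec s1 by rw [← he]; rfl]
    refine ⟨⟨⟨by simpa [Program.exec] using h1.size, h1.points, h1.cos_eq, h1.sin_eq⟩, h2, ?_⟩, ?_⟩
    · have h6 : ∀ x, x ≠ 4 → ((Program.setNat 4 (.reg 4 + .const 1)).exec s1).nat x = s1.nat x :=
        fun x hx => by simp [Program.exec, hx]
      have h7 : ((Program.setNat 4 (.reg 4 + .const 1)).exec s1).nat 4 = s.nat 4 + 1 := by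
        simp [Program.exec, e1]
      rw [h7, h6 9 (by norm_num)]
      exact ⟨hb, h3, h4, h5⟩
    · simp [Program.exec, e1]; omega
  · exact ⟨⟨by simpa [Program.exec] using h.size, h.points, h.cos_eq, h.sin_eq⟩, hP,
      by simp [Program.exec], by simp [Program.exec], by simp [Program.exec],
      by simp [Program.exec]⟩
  · rintro s ⟨⟨h1, h2, h3, h4, h5, h6⟩, hb⟩
    simp only [Test.Holds, NatExpr.eval_reg, h1.size] at hb
    refine ⟨by omega, h1.cos_eq, h1.sin_eq, h2, fun q => ⟨?_, ?_⟩, fun y hy => (h5 y hy).1⟩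
    · rintro ⟨x, hx, rfl⟩
      exact h6 x (by omega)
    · rintro (rfl | ⟨y, hy, rfl⟩)
      · obtain ⟨x, hx, he⟩ := hex
        exact ⟨x, hx, he.symm⟩
      · exact (h5 y hy).2

end FixedAngleTriangle

/-! ### Merge sort on the machine -/

namespace FixedAngleTriangle

open Real RealRAM

/-- The minimum of the number of points and of another number. -/
def minExpr (e : NatExpr) : NatExpr := .reg 9 - (.reg 9 - e)

/-- Compare the points number `a` and `b` in the order around the pivot. -/
def orderTest (a b : VecExpr) : Test :=
  let v := VecExpr.sub a pivotExpr
  let w := VecExpr.sub b pivotExpr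
  .or (.realLt (.const 0) (VecExpr.cr v w))
    (.and (.realEq (VecExpr.cr v w) (.const 0)) (.not (.realLt (VecExpr.dt w w) (VecExpr.dt v v))))

theorem orderTest_holds {s : State} {a b : VecExpr} (ha : InFront (pivot s) (a.eval s))
    (hb : InFront (pivot s) (b.eval s)) :
    (orderTest a b).Holds s ↔ key (pivot s) (a.eval s) ≤ key (pivot s) (b.eval s) := by
  rw [ha.key_le_iff hb, orient_eq_cr]
  simp [orderTest, Test.Holds, pivot]

/-- If the current blocks are finished, turn to the next two blocks. -/
def nextBlocks : Program :=
  .ite (.natEq (.reg 2) (.reg 8)) (.seq (.setNat 5 (.reg 2)) (.seq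
    (.setNat 7 (minExpr (.reg 2 + .reg 3))) (.seq (.setNat 6 (.reg 7))
      (.setNat 8 (minExpr (.reg 2 + .reg 3 + .reg 3)))))) .skip

/-- Write the smaller one of the first points of the two blocks. -/
def takeOne : Program :=
  .ite (.and (.natLt (.reg 5) (.reg 7)) (.or (.not (.natLt (.reg 6) (.reg 8)))
      (orderTest (entry 8 5) (entry 8 6))))
    (.seq (copyEntry 10 2 8 5) (.setNat 5 (.reg 5 + .const 1)))
    (.seq (copyEntry 10 2 8 6) (.setNat 6 (.reg 6 + .const 1)))

/-- Merge the blocks in pairs. -/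
def mergePass : Program :=
  .seq (.seq (.setNat 2 (.const 0)) (.seq (.setNat 5 (.const 0)) (.seq (.setNat 6 (.const 0))
    (.seq (.setNat 7 (.const 0)) (.setNat 8 (.const 0))))))
    (.loop (.natLt (.reg 2) (.reg 9))
      (.seq nextBlocks (.seq takeOne (.setNat 2 (.reg 2 + .const 1)))))

/-- Copy the points back. -/
def copyBack : Program :=
  .seq (.setNat 2 (.const 0)) (.loop (.natLt (.reg 2) (.reg 9))
    (.seq (copyEntry 8 2 10 2) (.setNat 2 (.reg 2 + .const 1))))

/-- Sort the points around the pivot. -/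
def mergeSort : Program :=
  .seq (.setNat 3 (.const 1)) (.loop (.natLt (.reg 3) (.reg 9))
    (.seq mergePass (.seq copyBack (.setNat 3 (.reg 3 + .reg 3)))))

/-- The situation during a merging pass. -/
structure MergeState (m w : ℕ) (f : ℕ → Plane) (ρ : ℕ → ℝ) (s : State) : Prop where
  length : s.nat 9 = m
  width : s.nat 3 = w
  points : arr s 8 = f
  real_eq : s.real = ρ

/-- A single loop suffices: every round writes one point and opens the next pair of blocks when the
current one is exhausted. This makes the linear bound immediate. -/
theorem exists_mergePass_spec : ∃ K, ∀ (n m w : ℕ) (f : ℕ → Plane) (s : State), 1 ≤ n → m ≤ n →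
    1 ≤ w → (∀ y < m, InFront (pivot s) (f y)) → SortedBlocks (key (pivot s)) w m f →
    MergeState m w f s.real s → Does mergePass s (K * n) fun s' => MergeState m w f s.real s' ∧
      SortedBlocks (key (pivot s)) (w + w) m (arr s' 10) ∧
      (∀ x < m, ∃ y < m, arr s' 10 x = f y) ∧ ∀ y < m, ∃ x < m, arr s' 10 x = f y := by
  refine ⟨_, fun n m w f s hn hmn hw hfr hsort h => Does.mono (Does.setup_loop
    (by exact ⟨trivial, trivial, trivial, trivial, trivial⟩)
    (by exact ⟨⟨⟨trivial, trivial, trivial, trivial⟩, trivial⟩,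
      ⟨⟨⟨trivial, trivial⟩, trivial⟩, ⟨trivial, trivial⟩, trivial⟩, trivial⟩)
    (fun s' => MergeState m w f s.real s' ∧ Merging (key (pivot s)) w m f (arr s' 10) (s'.nat 2)
      (s'.nat 5) (s'.nat 6) (s'.nat 7) (s'.nat 8))
    (fun s => m - s.nat 2) ?_ ?_ 1 hn (by omega)) le_rfl ?_⟩
  · rintro s1 ⟨h1, hM⟩ hb
    simp only [Test.Holds, NatExpr.eval_reg, h1.length] at hb
    obtain ⟨s2, e2, h2, hM2, ht2, hlt⟩ : ∃ s2, nextBlocks.exec s1 = s2 ∧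
        MergeState m w f s.real s2 ∧ Merging (key (pivot s)) w m f (arr s2 10) (s2.nat 2)
        (s2.nat 5) (s2.nat 6) (s2.nat 7) (s2.nat 8) ∧ s2.nat 2 = s1.nat 2 ∧
        s2.nat 2 < s2.nat 8 := by
      by_cases ht : s1.nat 2 = s1.nat 8
      · have hN := hM.next hsort ht hb hw
        have hmin : ∀ x, m - (m - x) = min m x := fun x => by omega
        refine ⟨_, if_pos (by exact ht), ⟨?_, ?_, h1.points, h1.real_eq⟩, ?_, ?_, ?_⟩
        · simpa [Program.exec] using h1.length
        · simpa [Program.exec] using h1.width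
        · convert hN using 1 <;>
            first | rfl | simp [Program.exec, minExpr, h1.length, h1.width, hmin]
        · simp [Program.exec]
        · simp [Program.exec, minExpr, h1.length, h1.width, hmin]
          omega
      · have := hM.t_le
        exact ⟨_, if_neg (by exact ht), h1, hM, rfl, by change s1.nat 2 < s1.nat 8; omega⟩
    have hp2 : pivot s2 = pivot s := pivot_congr h2.real_eq
    obtain ⟨s3, e3, h3, hM3, ht3⟩ : ∃ s3, takeOne.exec s2 = s3 ∧
        MergeState m w f s.real s3 ∧ Merging (key (pivot s)) w m f (arr s3 10) (s2.nat 2 + 1)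
        (s3.nat 5) (s3.nat 6) (s3.nat 7) (s3.nat 8) ∧ s3.nat 2 = s2.nat 2 := by
      have k1 := hM2.a_le
      have k2 := hM2.mid_le
      have k3 := hM2.b_le
      have k4 := hM2.hi_le
      have k5 := hM2.t_add
      have ho : s2.nat 5 < s2.nat 7 → s2.nat 6 < s2.nat 8 →
          ((orderTest (entry 8 5) (entry 8 6)).Holds s2 ↔
            key (pivot s) (f (s2.nat 5)) ≤ key (pivot s) (f (s2.nat 6))) := by
        intro ha hb
        rw [orderTest_holds] <;> rw [hp2, eval_entry, h2.points]
        · rw [eval_entry, h2.points]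
        · exact hfr _ (by omega)
        · exact hfr _ (by omega)
      by_cases ht : (Test.and (.natLt (.reg 5) (.reg 7)) (.or (.not (.natLt (.reg 6) (.reg 8)))
          (orderTest (entry 8 5) (entry 8 6)))).Holds s2
      · obtain ⟨e1, e2, e3, e4⟩ := copyEntry_exec (A := 10) (B := 8) (by norm_num) 2 5 s2
        rw [h2.points] at e3
        refine ⟨_, if_pos ht, ⟨?_, ?_, ?_, e2.trans h2.real_eq⟩, ?_, ?_⟩
        · simpa [Program.exec, e1] using h2.length
        · simpa [Program.exec, e1] using h2.width
        · rw [← h2.points]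
          unfold arr
          simp [Program.exec, e4]
        · have := hM2.takeLeft ht.1 fun hb => (ho ht.1 hb).1 (ht.2.resolve_left (not_not.2 hb))
          rw [← e3] at this
          convert this using 1 <;> rfl
        · simp [Program.exec, e1]
      · obtain ⟨e1, e2, e3, e4⟩ := copyEntry_exec (A := 10) (B := 8) (by norm_num) 2 6 s2
        rw [h2.points] at e3
        have hb : s2.nat 6 < s2.nat 8 := by
          by_contra hb
          exact ht ⟨show s2.nat 5 < s2.nat 7 by omega, Or.inl hb⟩
        refine ⟨_, if_neg ht, ⟨?_, ?_, ?_, e2.trans h2.real_eq⟩, ?_, ?_⟩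
        · simpa [Program.exec, e1] using h2.length
        · simpa [Program.exec, e1] using h2.width
        · rw [← h2.points]
          unfold arr
          simp [Program.exec, e4]
        · have := hM2.takeRight hb fun ha =>
            (not_le.1 fun hle => ht ⟨ha, Or.inr ((ho ha hb).2 hle)⟩).le
          rw [← e3] at this
          convert this using 1 <;> rfl
        · simp [Program.exec, e1]
    rw [show Program.exec (.seq nextBlocks (.seq takeOne (.setNat 2 (.reg 2 + .const 1)))) s1 =
      (Program.setNat 2 (.reg 2 + .const 1)).exec s3 by rw [← e3, ← e2]; rfl]
    refine ⟨⟨⟨?_, ?_, h3.points, h3.real_eq⟩, ?_⟩, ?_⟩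
    · simpa [Program.exec] using h3.length
    · simpa [Program.exec] using h3.width
    · convert hM3 using 1 <;> first | rfl | simp [Program.exec, ht3]
    · simp [Program.exec, ht3, ht2]; omega
  · refine ⟨⟨?_, ?_, h.points, h.real_eq⟩, ?_⟩
    · simpa [Program.exec] using h.length
    · simpa [Program.exec] using h.width
    · convert Merging.init (key (pivot s)) w m f _ using 1 <;> rfl
  · rintro s' ⟨⟨h1, hM⟩, hb⟩
    simp only [Test.Holds, NatExpr.eval_reg, h1.length] at hb
    have k1 := hM.t_le
    have k2 := hM.hi_le
    obtain ⟨k3, k4⟩ := hM.finished (by omega)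
    have k5 : s'.nat 2 = m := by omega
    refine ⟨h1, ?_, ?_, fun y hy => ?_⟩
    · rw [← k5]; exact hM.sorted
    · rw [← k5]; exact fun x hx => by simpa [k5] using hM.old x hx
    · obtain ⟨x, hx, he⟩ := hM.new y (by omega)
      exact ⟨x, by omega, he⟩

theorem exists_copyBack_spec : ∃ K, ∀ (n m w : ℕ) (g : ℕ → Plane) (s : State), 1 ≤ n → m ≤ n →
    s.nat 9 = m → s.nat 3 = w → arr s 10 = g → Does copyBack s (K * n) fun s' =>
      s'.nat 9 = m ∧ s'.nat 3 = w ∧ s'.real = s.real ∧ ∀ x < m, arr s' 8 x = g x := by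
  refine ⟨_, fun n m w g s hn hmn h1 h2 h3 => Does.mono (Does.setup_loop (by exact trivial)
    (by exact ⟨⟨trivial, trivial⟩, trivial⟩)
    (fun s' => s'.nat 9 = m ∧ s'.nat 3 = w ∧ s'.real = s.real ∧ arr s' 10 = g ∧
      ∀ x < s'.nat 2, arr s' 8 x = g x) (fun s => m - s.nat 2) ?_ ?_ 1 hn (by omega)) le_rfl ?_⟩
  · rintro s1 ⟨h1, h2, h3, h4, h5⟩ hb
    simp only [Test.Holds, NatExpr.eval_reg, h1] at hb
    obtain ⟨e1, e2, e3, e4⟩ := copyEntry_exec (A := 8) (B := 10) (by norm_num) 2 2 s1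
    have e5 : ((Program.seq (copyEntry 8 2 10 2) (.setNat 2 (.reg 2 + .const 1))).exec s1).nat 2 =
        s1.nat 2 + 1 := by simp [Program.exec, e1]
    refine ⟨⟨?_, ?_, ?_, ?_, fun x hx => ?_⟩, by omega⟩
    · simpa [Program.exec, e1] using h1
    · simpa [Program.exec, e1] using h2
    · exact e2.trans h3
    · rw [← h4]
      unfold arr
      simp [Program.exec, e4]
    · refine (congrFun e3 x).trans ?_
      rw [e5] at hx
      rcases Nat.lt_succ_iff_lt_or_eq.1 hx with hx | rfl
      · rw [Function.update_of_ne hx.ne, h5 x hx]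
      · rw [Function.update_self, h4]
  · exact ⟨by simpa [Program.exec] using h1, by simpa [Program.exec] using h2, rfl, h3,
      by simp [Program.exec]⟩
  · rintro s' ⟨⟨h1, h2, h3, h4, h5⟩, hb⟩
    simp only [Test.Holds, NatExpr.eval_reg, h1] at hb
    exact ⟨h1, h2, h3, fun x hx => h5 x (by omega)⟩

/-- One round of the sorting algorithm. -/
theorem exists_round_spec : ∃ K, ∀ (n w : ℕ) (S : Set Plane) (P : Plane) (ω : ℝ) (s : State),
    1 ≤ n → 1 ≤ w → Collected n S P ω s → s.nat 3 = w →
    SortedBlocks (key P) w (s.nat 9) (arr s 8) →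
    Does (.seq mergePass (.seq copyBack (.setNat 3 (.reg 3 + .reg 3)))) s (K * n) fun s' =>
      Collected n S P ω s' ∧ s'.nat 3 = w + w ∧
      SortedBlocks (key P) (w + w) (s'.nat 9) (arr s' 8) := by
  obtain ⟨K1, H1⟩ := exists_mergePass_spec
  obtain ⟨K2, H2⟩ := exists_copyBack_spec
  refine ⟨K1 + (K2 + (Program.setNat 3 (.reg 3 + .reg 3)).bound),
    fun n w S P ω s hn hw h h3 hs => ?_⟩
  have hp := h.pivot_eq
  subst hp
  refine ((H1 n (s.nat 9) w (arr s 8) s hn h.length_le hw h.front hs ⟨rfl, h3, rfl, rfl⟩).seq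
    (T' := K2 * n + (Program.setNat 3 (.reg 3 + .reg 3)).bound) fun s1 ⟨h1, k1, k2, k3⟩ =>
      (H2 n (s.nat 9) w (arr s1 10) s1 hn h.length_le h1.length h1.width rfl).seq
      fun s2 ⟨a1, a2, a3, a4⟩ => Does.of_exec (by exact trivial) ?_).mono ?_ fun _ h => h
  · have b1 : ((Program.setNat 3 (.reg 3 + .reg 3)).exec s2).nat 9 = s.nat 9 := by
      simpa [Program.exec] using a1
    have b2 : arr ((Program.setNat 3 (.reg 3 + .reg 3)).exec s2) 8 = arr s2 8 := rfl
    have b3 : ((Program.setNat 3 (.reg 3 + .reg 3)).exec s2).real = s.real := a3.trans h1.real_eq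
    refine ⟨⟨?_, ?_, ?_, ?_, ?_, ?_⟩, ?_, ?_⟩
    · rw [b1]; exact h.length_le
    · rw [b3]; exact h.cos_eq
    · rw [b3]; exact h.sin_eq
    · exact pivot_congr b3
    · intro q
      rw [h.mem_iff, b1, b2]
      refine or_congr Iff.rfl ⟨?_, ?_⟩
      · rintro ⟨y, hy, rfl⟩
        obtain ⟨x, hx, he⟩ := k3 y hy
        exact ⟨x, hx, (a4 x hx).trans he⟩
      · rintro ⟨x, hx, rfl⟩
        obtain ⟨y, hy, he⟩ := k2 x hx
        exact ⟨y, hy, (he.symm.trans (a4 x hx).symm)⟩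
    · intro y hy
      rw [b1] at hy
      obtain ⟨x, hx, he⟩ := k2 y hy
      rw [b2, a4 y hy, he]
      exact h.front x hx
    · simp [Program.exec, a2]
    · rw [b1, b2]
      intro c x y h1 h2 h3 h4
      rw [a4 x (by omega), a4 y h4]
      exact k1 c x y h1 h2 h3 h4
  · have := Nat.le_mul_of_pos_right (Program.setNat 3 (.reg 3 + .reg 3)).bound hn
    rw [add_mul, add_mul]
    omega

/-- The block length is a power of two and doubles in each round. Its exponent stays below `Nat.clog
2 n` as long as the length is less than the number of points, so the rest of the exponent is a
variant. -/
theorem exists_mergeSort_spec : ∃ K, ∀ (n : ℕ) (S : Set Plane) (P : Plane) (ω : ℝ) (s : State),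
    1 ≤ n → Collected n S P ω s → Does mergeSort s (K * (n * (Nat.clog 2 n + 1))) fun s' =>
      Collected n S P ω s' ∧ ∀ x y, x < y → y < s'.nat 9 → key P (arr s' 8 x) ≤ key P (arr s' 8 y)
    := by
  obtain ⟨K, H⟩ := exists_round_spec
  refine ⟨(Program.setNat 3 (.const 1)).bound +
    ((Test.natLt (.reg 3) (.reg 9)).cost + K + (Test.natLt (.reg 3) (.reg 9)).cost),
    fun n S P ω s hn h => ?_⟩
  refine ((Does.of_exec (p := .setNat 3 (.const 1)) (Q := fun s' => Collected n S P ω s' ∧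
    ∃ e, s'.nat 3 = 2 ^ e ∧ SortedBlocks (key P) (2 ^ e) (s'.nat 9) (arr s' 8)) trivial ?_).seq
    (T' := Nat.clog 2 n * ((Test.natLt (.reg 3) (.reg 9)).cost + K * n) +
      (Test.natLt (.reg 3) (.reg 9)).cost)
    fun s1 h1 => (Does.loop (fun s' => Collected n S P ω s' ∧
      ∃ e, s'.nat 3 = 2 ^ e ∧ SortedBlocks (key P) (2 ^ e) (s'.nat 9) (arr s' 8))
      (fun s => Nat.clog 2 n - Nat.log 2 (s.nat 3)) (K * n) ?_ h1).mono (by gcongr; omega)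
      ?_).mono ?_ fun _ h => h
  · have b1 : ((Program.setNat 3 (.const 1)).exec s).nat 9 = s.nat 9 := by simp [Program.exec]
    refine ⟨⟨by rw [b1]; exact h.length_le, h.cos_eq, h.sin_eq, h.pivot_eq, ?_, ?_⟩, 0,
      by simp [Program.exec], ?_⟩
    · rw [b1]; exact h.mem_iff
    · rw [b1]; exact h.front
    · intro c x y h1 h2 h3
      omega
  · rintro s2 ⟨h2, e, he, hs⟩ hb
    simp only [Test.Holds, NatExpr.eval_reg, he] at hb
    refine (H n (2 ^ e) S P ω s2 hn Nat.one_le_two_pow h2 he hs).mono le_rfl ?_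
    rintro s3 ⟨h3, h4, h5⟩
    have e2 : 2 ^ e + 2 ^ e = 2 ^ (e + 1) := by rw [pow_succ]; ring
    rw [e2] at h4 h5
    refine ⟨⟨h3, e + 1, h4, h5⟩, ?_⟩
    rw [h4, he, Nat.log_pow (by norm_num), Nat.log_pow (by norm_num)]
    have : e < Nat.clog 2 n :=
      (Nat.lt_clog_iff_pow_lt (by norm_num)).2 (hb.trans_le h2.length_le)
    omega
  · rintro s2 ⟨⟨h2, e, he, hs⟩, hb⟩
    simp only [Test.Holds, NatExpr.eval_reg, he] at hb
    exact ⟨h2, fun x y hxy hy => hs 0 x y (by omega) hxy (by omega) hy⟩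
  · have h1 : 1 ≤ n * (Nat.clog 2 n + 1) := Nat.mul_pos hn (Nat.succ_pos _)
    have h2 : Nat.clog 2 n ≤ n * (Nat.clog 2 n + 1) := by nlinarith
    have h3 : n * Nat.clog 2 n ≤ n * (Nat.clog 2 n + 1) := by gcongr; omega
    set c := (Test.natLt (.reg 3) (.reg 9)).cost
    set d := (Program.setNat 3 (.const 1)).bound
    set X := n * (Nat.clog 2 n + 1)
    have h4 := Nat.mul_le_mul_left c h2
    have h5 := Nat.mul_le_mul_left K h3
    have h6 := Nat.mul_le_mul_left d h1
    have h7 := Nat.mul_le_mul_left c h1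
    have e : Nat.clog 2 n * (c + K * n) = c * Nat.clog 2 n + K * (n * Nat.clog 2 n) := by ring
    rw [e]
    linarith

end FixedAngleTriangle

/-! ### The convex hull algorithm -/

namespace FixedAngleTriangle

open Real RealRAM

/-- The chain `h 0, …, h (M - 1)` of the convex hull algorithm after the first `t` of the sorted
points `f 0, …, f (m - 1)` around `P`. -/
structure Chain (P : Plane) (f : ℕ → Plane) (m M t : ℕ) (h : ℕ → Plane) : Prop where
  pos : 1 ≤ M
  le : M ≤ t + 1
  t_le : t ≤ m
  base : h 0 = P
  mem : ∀ i, 1 ≤ i → i < M → ∃ x < t, h i = f x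
  orient_pos : ∀ i j k, i < j → j < k → k < M → 0 < orient (h i) (h j) (h k)
  hull : ∀ x < m, f x ∈ convexHull ℝ ({q | ∃ i < M, h i = q} ∪ {q | ∃ y, t ≤ y ∧ y < m ∧ f y = q})

namespace Chain

variable {P : Plane} {f h : ℕ → Plane} {m M t : ℕ}

/-- A left turn at the end of the chain and the angular order make all triples that involve the new
point turn left, by `orient_pos_of_push`. -/
theorem push (hc : Chain P f m M t h) (hf : ∀ x < m, InFront P (f x))
    (hs : ∀ x y, x < y → y < m → key P (f x) ≤ key P (f y)) (ht : t < m)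
    (hl : 2 ≤ M → 0 < orient (h (M - 2)) (h (M - 1)) (f t)) :
    Chain P f m (M + 1) (t + 1) (Function.update h M (f t)) where
  pos := by omega
  le := by linarith [hc.le]
  t_le := ht
  base := by rw [Function.update_of_ne (by linarith [hc.pos]), hc.base]
  mem := fun i h1 h2 => by
    rcases Nat.lt_succ_iff_lt_or_eq.1 h2 with h2 | rfl
    · obtain ⟨x, hx, he⟩ := hc.mem i h1 h2
      exact ⟨x, by omega, by rwa [Function.update_of_ne h2.ne]⟩
    · exact ⟨t, by omega, by simp⟩
  orient_pos := fun i j k hij hjk hk => by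
    rw [Function.update_of_ne (by omega : i ≠ M), Function.update_of_ne (by omega : j ≠ M)]
    rcases Nat.lt_succ_iff_lt_or_eq.1 hk with hk | rfl
    · rw [Function.update_of_ne hk.ne]
      exact hc.orient_pos i j k hij hjk hk
    · rw [Function.update_self]
      refine orient_pos_of_push (by omega) (fun l h1 h2 => ?_) ?_ hc.orient_pos (hl (by omega)) hij
        hjk
      · obtain ⟨x, hx, he⟩ := hc.mem l h1 h2
        rw [hc.base, he]
        exact ⟨hf x (by omega), hs x t hx ht⟩
      · rw [hc.base]; exact hf t ht
  hull := fun x hx => by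
    refine convexHull_mono ?_ (hc.hull x hx)
    rintro q (⟨i, hi, rfl⟩ | ⟨y, h1, h2, rfl⟩)
    · exact Or.inl ⟨i, by omega, by rw [Function.update_of_ne hi.ne]⟩
    · rcases h1.eq_or_lt with rfl | h1
      · exact Or.inl ⟨M, by omega, by simp⟩
      · exact Or.inr ⟨y, h1, h2, rfl⟩

/-- The removed point lies in the triangle of the pivot, its predecessor and the new point. If the
predecessor is the pivot itself, it lies on the segment from the pivot to the new point, by the
sorting by distance. -/
theorem pop (hc : Chain P f m M t h) (hf : ∀ x < m, InFront P (f x))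
    (hs : ∀ x y, x < y → y < m → key P (f x) ≤ key P (f y)) (ht : t < m) (hM : 2 ≤ M)
    (hl : orient (h (M - 2)) (h (M - 1)) (f t) ≤ 0) : Chain P f m (M - 1) t h where
  pos := by omega
  le := by linarith [hc.le, Nat.sub_le M 1]
  t_le := hc.t_le
  base := hc.base
  mem := fun i h1 h2 => hc.mem i h1 (by omega)
  orient_pos := fun i j k hij hjk hk => hc.orient_pos i j k hij hjk (by omega)
  hull := fun x hx => by
    set U := {q | ∃ i < M - 1, h i = q} ∪ {q | ∃ y, t ≤ y ∧ y < m ∧ f y = q} with hU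
    have mP : P ∈ U := Or.inl ⟨0, by omega, hc.base⟩
    have mq : f t ∈ U := Or.inr ⟨t, le_rfl, ht, rfl⟩
    have key : h (M - 1) ∈ convexHull ℝ U := by
      obtain ⟨y, hy, he⟩ := hc.mem (M - 1) (by omega) (by omega)
      have hb : InFront P (h (M - 1)) := he ▸ hf y (by omega)
      have hbq : FixedAngleTriangle.key P (h (M - 1)) ≤ FixedAngleTriangle.key P (f t) :=
        he ▸ hs y t hy ht
      rcases hM.eq_or_lt with rfl | hM
      · rw [Nat.sub_self, hc.base] at hl
        rcases (hb.key_le_iff (hf t ht)).1 hbq with h1 | ⟨h1, h2⟩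
        · exact absurd hl (not_le.2 h1)
        · refine convexHull_mono ?_ (hb.mem_convexHull_of_le (hf t ht) h1 h2)
          rintro _ (rfl | rfl)
          exacts [mP, mq]
      · obtain ⟨z, hz, he'⟩ := hc.mem (M - 2) (by omega) (by omega)
        have h1 := hc.orient_pos 0 (M - 2) (M - 1) (by omega) (by omega) (by omega)
        rw [hc.base] at h1
        refine convexHull_mono ?_
          (mem_convexHull_of_turn (he' ▸ hf z (by omega)) hb (hf t ht) h1 hbq hl)
        rintro _ (rfl | rfl | rfl)
        exacts [mP, Or.inl ⟨M - 2, by omega, rfl⟩, mq]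
    refine convexHull_min ?_ (convex_convexHull ℝ U) (hc.hull x hx)
    rintro q (⟨i, hi, rfl⟩ | hq)
    · rcases (show i ≤ M - 1 by omega).eq_or_lt with rfl | hi
      · exact key
      · exact subset_convexHull ℝ _ (Or.inl ⟨i, hi, rfl⟩)
    · exact subset_convexHull ℝ _ (Or.inr hq)

end Chain

/-- The test that the last point of the chain is not a vertex of the convex hull. -/
def popTest : Test :=
  .and (.natLt (.const 1) (.reg 1)) (.not (.realLt (.const 0)
    (VecExpr.orient (vertexExpr (.reg 1 - .const 2)) (vertexExpr (.reg 1 - .const 1))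
      (entry 8 2))))

/-- Compute the vertices of the convex hull from the sorted points. -/
def convexHullScan : Program :=
  .seq (.seq (.writeReal 6 (.const 0) (.reg 2)) (.seq (.writeReal 7 (.const 0) (.reg 3))
      (.seq (.setNat 1 (.const 1)) (.setNat 2 (.const 0)))))
    (.loop (.natLt (.reg 2) (.reg 9)) (.ite popTest (.setNat 1 (.reg 1 - .const 1))
      (.seq (copyEntry 6 1 8 2) (.seq (.setNat 1 (.reg 1 + .const 1))
        (.setNat 2 (.reg 2 + .const 1))))))

theorem popTest_holds (s : State) : popTest.Holds s ↔ 2 ≤ s.nat 1 ∧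
    orient (arr s 6 (s.nat 1 - 2)) (arr s 6 (s.nat 1 - 1)) (arr s 8 (s.nat 2)) ≤ 0 := by
  have h : ∀ e : NatExpr, (vertexExpr e).eval s = arr s 6 (e.eval s) := fun _ => rfl
  simp only [popTest, Test.Holds, VecExpr.eval_orient, h, eval_entry, RealExpr.eval_const,
    NatExpr.eval_sub, NatExpr.eval_reg, NatExpr.eval_const, Rat.cast_zero, not_lt, Nat.succ_le_iff]

theorem exists_convexHullScan_spec : ∃ K, ∀ (n : ℕ) (S : Set Plane) (P : Plane) (ω : ℝ)
    (s : State), 1 ≤ n → Collected n S P ω s →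
    (∀ x y, x < y → y < s.nat 9 → key P (arr s 8 x) ≤ key P (arr s 8 y)) →
    Does convexHullScan s (K * n) fun s' => s'.real 0 = cos ω ∧ s'.real 1 = sin ω ∧
      1 ≤ s'.nat 1 ∧ s'.nat 1 ≤ n + 1 ∧ (∀ i < s'.nat 1, arr s' 6 i ∈ S) ∧
      S ⊆ convexHull ℝ {q | ∃ i < s'.nat 1, arr s' 6 i = q} ∧
      ∀ i j k, i < j → j < k → k < s'.nat 1 → 0 < orient (arr s' 6 i) (arr s' 6 j) (arr s' 6 k)
    := by
  refine ⟨_, fun n S P ω s hn h hs => Does.mono (Does.setup_loop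
    (by exact ⟨trivial, trivial, trivial, trivial⟩)
    (by exact ⟨trivial, ⟨trivial, trivial⟩, trivial, trivial⟩)
    (fun s' => s'.nat 9 = s.nat 9 ∧ s'.real = s.real ∧ arr s' 8 = arr s 8 ∧
      Chain P (arr s 8) (s.nat 9) (s'.nat 1) (s'.nat 2) (arr s' 6))
    -- Removing a point shortens the chain by one; adding a point lengthens it by one but uses up an
    -- input point, which counts twice. So every round lowers the variant, although a single point
    -- may cause many removals.
    (fun s' => 2 * (s.nat 9 - s'.nat 2) + s'.nat 1) ?_ ?_ 3 hn ?_) le_rfl ?_⟩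
  · rintro s1 ⟨h1, h2, h3, hc⟩ hb
    simp only [Test.Holds, NatExpr.eval_reg, h1] at hb
    have ht := popTest_holds s1
    rw [h3] at ht
    by_cases hp : popTest.Holds s1
    · rw [show Program.exec (.ite popTest _ _) s1 = _ from if_pos hp]
      obtain ⟨p1, p2⟩ := ht.1 hp
      have hc' := hc.pop h.front hs hb p1 p2
      refine ⟨⟨?_, h2, h3, ?_⟩, ?_⟩
      · simpa [Program.exec] using h1
      · convert hc' using 1 <;> rfl
      · simp [Program.exec]; omega
    · rw [show Program.exec (.ite popTest _ _) s1 = _ from if_neg hp]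
      obtain ⟨e1, e2, e3, e4⟩ := copyEntry_exec (A := 6) (B := 8) (by norm_num) 1 2 s1
      have hc' := hc.push h.front hs hb fun hM => by
        by_contra hcon
        exact hp (ht.2 ⟨hM, not_lt.1 hcon⟩)
      rw [h3] at e3
      rw [← e3] at hc'
      refine ⟨⟨?_, e2.trans h2, ?_, ?_⟩, ?_⟩
      · simpa [Program.exec, e1] using h1
      · rw [← h3]
        unfold arr
        simp [Program.exec, e4]
      · convert hc' using 1 <;> rfl
      · simp [Program.exec, e1]; omega
  · refine ⟨by simp [Program.exec], rfl, ?_, ?_⟩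
    · unfold arr
      simp [Program.exec]
    · refine ⟨by simp [Program.exec], by simp [Program.exec], by simp [Program.exec], ?_, ?_, ?_,
        ?_⟩
      · rw [← h.pivot_eq]
        simp [Program.exec, arr, pivot, pivotExpr]
      · intro i h1 h2
        simp [Program.exec] at h2
        omega
      · intro i j k hij hjk hk
        simp [Program.exec] at hk
        omega
      · intro x hx
        exact subset_convexHull ℝ _ (Or.inr ⟨x, by simp [Program.exec], hx, rfl⟩)
  · have := h.length_le
    simp [Program.exec]
    omega
  · rintro s1 ⟨⟨h1, h2, h3, hc⟩, hb⟩
    simp only [Test.Holds, NatExpr.eval_reg, h1] at hb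
    have hle := hc.le
    have htle := hc.t_le
    have hlen := h.length_le
    have hP : P ∈ S := (h.mem_iff P).2 (Or.inl rfl)
    refine ⟨by rw [h2, h.cos_eq], by rw [h2, h.sin_eq], hc.pos, by omega, fun i hi => ?_,
      fun q hq => ?_, hc.orient_pos⟩
    · rcases Nat.eq_zero_or_pos i with rfl | hi0
      · rw [hc.base]; exact hP
      · obtain ⟨x, hx, he⟩ := hc.mem i hi0 hi
        exact (h.mem_iff _).2 (Or.inr ⟨x, by omega, he.symm⟩)
    · rcases (h.mem_iff q).1 hq with rfl | ⟨y, hy, rfl⟩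
      · exact subset_convexHull ℝ _ ⟨0, hc.pos, hc.base⟩
      · refine convexHull_mono ?_ (hc.hull y hy)
        rintro q (hq | ⟨z, h4, h5, -⟩)
        · exact hq
        · omega

/-! ### The algorithm for finite point sets -/

theorem reports_nothing {ω : ℝ} (h0 : 0 < ω) (hπ : ω < π) {S : Set Plane} {x y : Plane}
    (hS : S ⊆ convexHull ℝ {x, y}) (s : State) :
    ReportsMinTriangles ω S ((Program.setNat 0 (.const 0)).exec s) := by
  rw [ReportsMinTriangles, setOf_isMinTriangle h0 hπ]
  ext V
  constructor
  · rintro ⟨j, hj, -⟩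
    simp [outputCount, Program.exec] at hj
  · rintro ⟨A, B, C, h, -⟩
    exact absurd h (not_minimal_of_subset_segment h0 hπ hS A B C)

/-- The algorithm for finite point sets. -/
def pointSetAlgorithm : Program :=
  .ite (.natLt (.reg 0) (.const 3)) (.setNat 0 (.const 0))
    (.seq findPivot (.seq collect (.seq mergeSort (.seq convexHullScan
      (.ite (.natLt (.reg 1) (.const 3)) (.setNat 0 (.const 0)) sweep)))))

/-- A chain of at most two points means that the set lies in a segment. Otherwise the chain is a
strictly convex polygon, to which the sweep applies. -/
theorem exists_hull_spec : ∃ K, ∀ (n : ℕ) (S : Set Plane) (ω : ℝ) (s : State), 0 < ω → ω < π →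
    1 ≤ n → s.real 0 = cos ω → s.real 1 = sin ω → 1 ≤ s.nat 1 → s.nat 1 ≤ n + 1 →
    (∀ i < s.nat 1, arr s 6 i ∈ S) → S ⊆ convexHull ℝ {q | ∃ i < s.nat 1, arr s 6 i = q} →
    (∀ i j k, i < j → j < k → k < s.nat 1 → 0 < orient (arr s 6 i) (arr s 6 j) (arr s 6 k)) →
    Does (.ite (.natLt (.reg 1) (.const 3)) (.setNat 0 (.const 0)) sweep) s (K * n)
      (ReportsMinTriangles ω S) := by
  obtain ⟨K, H⟩ := exists_sweep_spec
  refine ⟨(Test.natLt (.reg 1) (.const 3)).cost + (Program.setNat 0 (.const 0)).bound + 2 * K,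
    fun n S ω s h0 hπ hn h1 h2 h3 h4 h5 h6 h7 => ?_⟩
  have b1 := Nat.le_mul_of_pos_right (Test.natLt (.reg 1) (.const 3)).cost hn
  have b2 := Nat.le_mul_of_pos_right (Program.setNat 0 (.const 0)).bound hn
  by_cases ht : s.nat 1 < 3
  · refine (Does.ite_true _ (by exact ht) (.of_exec (by exact trivial)
      (reports_nothing h0 hπ (h6.trans (convexHull_mono (t := {arr s 6 0, arr s 6 (s.nat 1 - 1)})
      ?_)) s))).mono ?_ fun _ h => h
    · rintro _ ⟨i, hi, rfl⟩
      rcases Nat.eq_zero_or_pos i with rfl | h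
      · exact Or.inl rfl
      · exact Or.inr (congrArg _ (by omega))
    · rw [add_mul, add_mul]
      omega
  · refine (Does.ite_false _ (by exact ht) (H (s.nat 1) _ ω s (isPolygon_of_orient_pos
      (not_lt.1 ht) h7) h0 hπ ⟨rfl, ?_, ?_, h1, h2⟩)).mono ?_ fun s' hs' => ?_
    · intro m hm
      simp only [Nat.mod_eq_of_lt hm]; rfl
    · intro m hm
      simp only [Nat.mod_eq_of_lt hm]; rfl
    -- The chain bound only gives `n + 1` vertices, which is at most `2 * n`.
    · have : K * s.nat 1 ≤ K * (2 * n) := Nat.mul_le_mul_left _ (by omega)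
      rw [add_mul, add_mul]
      linarith
    · have e : Set.range (fun m => arr s 6 (m % s.nat 1)) = {q | ∃ i < s.nat 1, arr s 6 i = q} := by
        ext q
        constructor
        · rintro ⟨m, rfl⟩
          exact ⟨_, Nat.mod_lt _ (by omega), rfl⟩
        · rintro ⟨i, hi, rfl⟩
          exact ⟨i, by simp only [Nat.mod_eq_of_lt hi]⟩
      rw [e] at hs'
      refine (reportsMinTriangles_congr h0 hπ h6 ?_ s').1 hs'
      rintro _ ⟨i, hi, rfl⟩
      exact subset_convexHull ℝ _ (h5 i hi)

theorem exists_pointSet_spec : ∃ K, ∀ (n : ℕ) (p : Fin n → Plane) (ω : ℝ), 0 < ω → ω < π →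
    Does pointSetAlgorithm (inputState p ω) (K * (if n < 3 then 1 else n * (Nat.clog 2 n + 1)))
      (ReportsMinTriangles ω (Set.range p)) := by
  obtain ⟨K1, H1⟩ := exists_findPivot_spec
  obtain ⟨K2, H2⟩ := exists_collect_spec
  obtain ⟨K3, H3⟩ := exists_mergeSort_spec
  obtain ⟨K4, H4⟩ := exists_convexHullScan_spec
  obtain ⟨K5, H5⟩ := exists_hull_spec
  refine ⟨(Test.natLt (.reg 0) (.const 3)).cost + (Program.setNat 0 (.const 0)).bound +
    (K1 + (K2 + (K3 + (K4 + K5)))), fun n p ω h0 hπ => ?_⟩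
  set f := arr (inputState p ω) 0 with hf
  have hfp : ∀ i : Fin n, f i = p i := fun i => by
    apply plane_ext <;> simp [hf, arr, inputState]
  have hS : Set.range p = {q | ∃ x < n, f x = q} := by
    ext q
    constructor
    · rintro ⟨i, rfl⟩
      exact ⟨i, i.2, hfp i⟩
    · rintro ⟨x, hx, rfl⟩
      exact ⟨⟨x, hx⟩, (hfp ⟨x, hx⟩).symm⟩
  rw [hS]
  by_cases hn : n < 3
  · refine (Does.ite_true _ (by exact hn) (.of_exec (by exact trivial)
      (reports_nothing h0 hπ (x := f 0) (y := f (n - 1)) ?_ _))).mono ?_ fun _ h => h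
    · refine Set.Subset.trans ?_ (subset_convexHull ℝ _)
      rintro _ ⟨i, hi, rfl⟩
      rcases Nat.eq_zero_or_pos i with rfl | h
      · exact Or.inl rfl
      · exact Or.inr (congrArg _ (by omega))
    · rw [if_pos hn]
      omega
  · have hn1 : 1 ≤ n := by omega
    have hI : InputHeld n f ω (inputState p ω) := ⟨rfl, rfl, rfl, rfl⟩
    rw [if_neg hn]
    refine (Does.ite_false _ (by exact hn) ((H1 n f ω _ hn1 hI).seq fun s1 ⟨a1, a2, a3⟩ =>
      (H2 n f ω _ s1 hn1 a1 rfl a2 a3).seq fun s2 a4 => (H3 n _ _ ω s2 hn1 a4).seq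
      fun s3 ⟨a5, a6⟩ => (H4 n _ _ ω s3 hn1 a5 a6).seq fun s4 ⟨b1, b2, b3, b4, b5, b6, b7⟩ =>
      H5 n _ ω s4 h0 hπ hn1 b1 b2 b3 b4 b5 b6 b7)).mono ?_ fun _ h => h
    have hX : n ≤ n * (Nat.clog 2 n + 1) := Nat.le_mul_of_pos_right n (Nat.succ_pos _)
    set X := n * (Nat.clog 2 n + 1)
    have c1 := Nat.mul_le_mul_left K1 hX
    have c2 := Nat.mul_le_mul_left K2 hX
    have c4 := Nat.mul_le_mul_left K4 hX
    have c5 := Nat.mul_le_mul_left K5 hX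
    have c6 := Nat.le_mul_of_pos_right (Test.natLt (.reg 0) (.const 3)).cost (hn1.trans hX)
    rw [add_mul, add_mul, add_mul, add_mul, add_mul, add_mul]
    omega

/-- From `n ≥ 3` comes `log n ≥ 1`, which absorbs the additive constant 2 in `clog + 1 = (clog - 1)
+ 2`; the rest is `2 ^ (clog - 1) ≤ n` and `log 2 > 1/2`. -/
theorem clog_add_one_le {n : ℕ} (hn : 3 ≤ n) : ((Nat.clog 2 n + 1 : ℕ) : ℝ) ≤ 4 * Real.log n := by
  have h1 : 2 ^ (Nat.clog 2 n - 1) ≤ n := (Nat.pow_pred_clog_lt_self (by norm_num) (by omega)).le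
  have h2 : (2 : ℝ) ^ (Nat.clog 2 n - 1) ≤ n := by exact_mod_cast h1
  have h3 := Real.log_le_log (by positivity) h2
  rw [Real.log_pow] at h3
  have h4 : 1 ≤ Nat.clog 2 n := Nat.clog_pos (by norm_num) (by omega)
  rw [Nat.cast_sub h4] at h3
  have h5 := Real.log_two_gt_d9
  have h6 : 1 ≤ Real.log n := by
    rw [Real.le_log_iff_exp_le (by positivity)]
    have : (3 : ℝ) ≤ n := by exact_mod_cast hn
    linarith [Real.exp_one_lt_d9]
  have h7 : (1 : ℝ) ≤ Nat.clog 2 n := by exact_mod_cast h4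
  push_cast at h3 ⊢
  nlinarith

end FixedAngleTriangle

theorem mainTheorem1 :
    (∃ (prog : RealRAM.Program) (C : ℝ),
      ∀ (n : ℕ) (p : Fin n → FixedAngleTriangle.Plane) (ω : ℝ), 0 < ω → ω < Real.pi →
        ∃ (s : RealRAM.State) (t : ℕ),
          RealRAM.Runs prog (FixedAngleTriangle.inputState p ω) s t ∧
          (t : ℝ) ≤ C * ((n : ℝ) * Real.log n + 1) ∧
          FixedAngleTriangle.ReportsMinTriangles ω (Set.range p) s) ∧
    (∃ (prog : RealRAM.Program) (C : ℝ),
      ∀ (n : ℕ) (v : Fin n → FixedAngleTriangle.Plane),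
        FixedAngleTriangle.IsClockwiseConvexPolygon v →
        ∀ ω : ℝ, 0 < ω → ω < Real.pi →
          ∃ (s : RealRAM.State) (t : ℕ),
            RealRAM.Runs prog (FixedAngleTriangle.inputState v ω) s t ∧
            (t : ℝ) ≤ C * (n : ℝ) ∧
            FixedAngleTriangle.ReportsMinTriangles ω (convexHull ℝ (Set.range v)) s) := by
  constructor
  · obtain ⟨K, H⟩ := FixedAngleTriangle.exists_pointSet_spec
    refine ⟨FixedAngleTriangle.pointSetAlgorithm, 4 * K, fun n p ω h0 hπ => ?_⟩
    obtain ⟨s, t, hr, ht, hs⟩ := H n p ω h0 hπ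
    refine ⟨s, t, hr, (Nat.cast_le.2 ht).trans ?_, hs⟩
    have hK : (0 : ℝ) ≤ K := Nat.cast_nonneg K
    have hlog : 0 ≤ (n : ℝ) * Real.log n := mul_nonneg (Nat.cast_nonneg n) (Real.log_natCast_nonneg n)
    rw [Nat.cast_mul, mul_comm 4, mul_assoc]
    refine mul_le_mul_of_nonneg_left ?_ hK
    -- Inputs with fewer than three points cost a constant, which the summand 1 of the bound covers.
    -- For `n ≤ 1` the bound is itself constant, because `n log n` is zero.
    split_ifs with hn
    · push_cast
      linarith
    · have h1 := mul_le_mul_of_nonneg_left (FixedAngleTriangle.clog_add_one_le (not_lt.1 hn))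
        (Nat.cast_nonneg (α := ℝ) n)
      rw [Nat.cast_mul]
      linarith
  · obtain ⟨prog, K, H⟩ := FixedAngleTriangle.exists_polygon_algorithm
    refine ⟨prog, K, fun n v hv ω h0 hπ => ?_⟩
    obtain ⟨s, t, hr, ht, hs⟩ := H n v hv ω h0 hπ
    exact ⟨s, t, hr, by exact_mod_cast ht, hs⟩
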